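/- **Setting.** Let $d\ge 1$ and let $\Omega\subset\mathbb R^d$ be a bounded open set with $\operatorname{diam}(\Omega)\le 1$. Let $a$ be a symmetric $d\times d$ matrix with entries in $L^\infty(\Omega)$ such that $\lambda_{\min}(a)|l|^2\le l^Ta(x)l\le\lambda_{\max}(a)|l|^2$ for a.e. $x\in\Omega$ and all $l\in\mathbb R^d$, where $\lambda_{\min}(a)>0$. Write $\langle u,v\rangle_a=\int_\Omega(\nabla u)^Ta\nabla v$ and $\|u\|_a^2=\langle u,u\rangle_a$ on $H^1_0(\Omega)$. Let $q\ge1$ and let $\mathcal I^{(1)},\dots,\mathcal I^{(q)}$ be the levels of an index tree: $\mathcal I^{(k)}$ is the set of $k$-tuples $(i_1,\dots,i_k)$ with $1\le i_1\le m_0$ and $1\le i_j\le m_{(i_1,\dots,i_{j-1})}$ for $2\le j\le k$, where $m_0$ and the $m_{(i_1,\dots,i_{j-1})}$ are strictly positive integers. For $2\le k\le q$ let $\mathcal J^{(k)}$ be the set of $k$-tuples $(s,t)$ with $s\in\mathcal I^{(k-1)}$ and $1\le t\le m_s-1$. Let $\delta\in(0,1)$ and $0<H_q<\dots<H_1<1$.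 For each $k\in\{1,\dots,q\}$ let $(\tau^{(k)}_i)_{i\in\mathcal I^{(k)}}$ be a partition of $\Omega$ (up to null sets) into convex subsets of $\Omega$ of diameter at most $H_k$, each containing a ball of diameter $\delta H_k$. Assume that the partitions are nested: for $k<q$, $\tau^{(k)}_s$ is, up to a null set, the union of the $\tau^{(k+1)}_{(s,t)}$, $1\le t\le m_s$. Let $\phi^{(k)}_i$ be the indicator function of $\tau^{(k)}_i$. Let $\pi^{(k,k+1)}$ be the $\mathcal I^{(k)}\times\mathcal I^{(k+1)}$ matrix with entry $(i,j)$ equal to $1$ if $j=(i,t)$ for some $t$, and $0$ otherwise. Let $\psi^{(k)}_i$ (gamblet) be the minimizer of $\|\psi\|_a$ over $\psi\in H^1_0(\Omega)$ subject to $\int_\Omega\phi^{(k)}_j\psi=\delta_{i,j}$ for all $j\in\mathcal I^{(k)}$. Let $\mathfrak V^{(k)}=\operatorname{span}\{\psi^{(k)}_i: i\in\mathcal I^{(k)}\}$ and, for $k\ge2$, let $\mathfrak W^{(k)}$ be the set of $w\in\mathfrak V^{(k)}$ with $\langle w,v\rangle_a=0$ for all $v\in\mathfrak V^{(k-1)}$.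 Let $A^{(k)}_{i,j}=\langle\psi^{(k)}_i,\psi^{(k)}_j\rangle_a$. For $k\ge 2$ let $W^{(k)}$ be a $\mathcal J^{(k)}\times\mathcal I^{(k)}$ matrix with $\operatorname{Im}(W^{(k),T})=\operatorname{Ker}(\pi^{(k-1,k)})$, and let $\chi^{(k)}_i=\sum_jW^{(k)}_{i,j}\psi^{(k)}_j$ and $B^{(k)}_{i,j}=\langle\chi^{(k)}_i,\chi^{(k)}_j\rangle_a$. For a square matrix $M$ let $\operatorname{Cond}(M)=\sqrt{\lambda_{\max}(M^TM)}/\sqrt{\lambda_{\min}(M^TM)}$. **Theorem.** Each gamblet $\psi_i^{(k)}$ exists and is unique, and the following holds. 1. For $1\le k\le q$ and $v\in\mathfrak V^{(k)}$, the weak divergence $\operatorname{div}(a\nabla v)$ is a unique element of $L^2(\Omega)$, and $$\frac{\delta^{1+d/2}}{\sqrt{\lambda_{\max}(a)}\,2^{5/2+d/2}}\,H_k\,\|\operatorname{div}(a\nabla v)\|_{L^2(\Omega)}\le\|v\|_a .$$ 2. For $v\in\mathfrak V^{(1)}$, $\|v\|_a\le\frac{1}{\sqrt{\lambda_{\min}(a)}}\|\operatorname{div}(a\nabla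 v)\|_{L^2(\Omega)}$; for $2\le k\le q$ and $v\in\mathfrak W^{(k)}$, $\|v\|_a\le\frac{1}{\sqrt{\lambda_{\min}(a)}}H_{k-1}\|\operatorname{div}(a\nabla v)\|_{L^2(\Omega)}$. 3. $A^{(1)}$ is positive definite and $$\operatorname{Cond}(A^{(1)})\le\frac1{H_1^2}\,\frac{\lambda_{\max}(a)\,2^{5+d}}{\lambda_{\min}(a)\,\delta^{2+2d}} .$$ 4. For $2\le k\le q$ and every $W^{(k)}$ as above, $B^{(k)}=W^{(k)}A^{(k)}W^{(k),T}$ is positive definite and $$\operatorname{Cond}(B^{(k)})\le\Big(\frac{H_{k-1}}{H_k}\Big)^2\Big(\frac{\lambda_{\max}(a)}{\lambda_{\min}(a)}\Big)^2\frac{2^{11+2d}}{\delta^{4+7d}\pi^2}\operatorname{Cond}(W^{(k)}W^{(k),T})$$ (if $\mathcal J^{(k)}=\emptyset$ the matrices are empty and nothing is claimed). 5. For $2\le k\le q$ the following two choices of $W^{(k)}$ satisfy $\operatorname{Im}(W^{(k),T})=\operatorname{Ker}(\pi^{(k-1,k)})$. In both, the entry $((s,t),(s',t'))$ vanishes if $s\ne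 s'$. (a) $W^{(k)}_{(s,t),(s,t')}$ equals $1/\sqrt{t(t+1)}$ if $t'\le t$, $-t/\sqrt{t(t+1)}$ if $t'=t+1$, and $0$ if $t'>t+1$. Here $\operatorname{Cond}(W^{(k)}W^{(k),T})=1$ if $\mathcal J^{(k)}\neq\emptyset$. (b) $W^{(k)}_{(s,t),(s,t')}=\delta_{t,t'}-\delta_{t+1,t'}$. Here $\operatorname{Cond}(W^{(k)}W^{(k),T})\le2\big(H_{k-1}/(\delta H_k)\big)^{2d}$ (if $\mathcal J^{(k)}\neq\emptyset$). 6. Consequently, if $H_{k-1}/H_k\le\rho$ for some $k\in\{2,\dots,q\}$, then, with $K=\rho^2\big(\frac{\lambda_{\max}(a)}{\lambda_{\min}(a)}\big)^2\frac{2^{11+2d}}{\delta^{4+7d}\pi^2}$, one has $\operatorname{Cond}(B^{(k)})\le K$ for the choice (a) and $\operatorname{Cond}(B^{(k)})\le 2(\rho/\delta)^{2d}K$ for the choice (b) (if $\mathcal J^{(k)}\ne\emptyset$). So the condition numbers are uniformly bounded if $H_{k-1}/H_k$ is uniformly bounded. -/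

import Mathlib

open MeasureTheory
open scoped ContDiff

noncomputable section

namespace Gamblets

/-! ### The space `H¹₀(Ω)`, the energy product and the operator `div (a ∇ ·)` -/

/-- The ambient space `ℝᵈ`. -/
abbrev E (d : ℕ) := EuclideanSpace ℝ (Fin d)

/-- `φ ∈ C_c^∞(Ω)`. -/
def IsTest {d : ℕ} (Ω : Set (E d)) (φ : E d → ℝ) : Prop :=
  ContDiff ℝ ∞ φ ∧ HasCompactSupport φ ∧ tsupport φ ⊆ Ω

/-- `L²(Ω)`. -/
abbrev L2 {d : ℕ} (Ω : Set (E d)) := Lp ℝ 2 (volume.restrict Ω)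

/-- The Hilbert space `L²(Ω) × L²(Ω; ℝᵈ)` with the norm `(‖u‖² + ‖G‖²)^(1/2)`. -/
abbrev L2Pair {d : ℕ} (Ω : Set (E d)) :=
  WithLp 2 (Lp ℝ 2 (volume.restrict Ω) × Lp (E d) 2 (volume.restrict Ω))

/-- `H¹₀(Ω)`, the closure of `C_c^∞(Ω)` in the `H¹` norm. A function `u` is stored together with
its weak gradient, as the pair `(u, ∇u)`; the `H¹` norm of `u` is the norm of this pair. -/
def H10 {d : ℕ} (Ω : Set (E d)) : Submodule ℝ (L2Pair Ω) :=
  (Submodule.span ℝ {p : L2Pair Ω | ∃ φ : E d → ℝ, IsTest Ω φ ∧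
    p.fst =ᵐ[volume.restrict Ω] φ ∧
    p.snd =ᵐ[volume.restrict Ω] fun x => gradient φ x}).topologicalClosure

/-- The function underlying an element of `H¹₀(Ω)`. -/
def valFn {d : ℕ} {Ω : Set (E d)} (u : H10 Ω) : E d → ℝ := fun x => u.1.fst x

/-- The weak gradient of an element of `H¹₀(Ω)`. -/
def gradFn {d : ℕ} {Ω : Set (E d)} (u : H10 Ω) : E d → E d := fun x => u.1.snd x

/-- `a` is symmetric with entries in `L^∞(Ω)` and
`lmin |l|² ≤ lᵀ a(x) l ≤ lmax |l|²` on `Ω`, with `lmin > 0`. -/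
structure IsUniformlyElliptic {d : ℕ} (Ω : Set (E d)) (a : E d → Matrix (Fin d) (Fin d) ℝ)
    (lmin lmax : ℝ) : Prop where
  entries : ∀ i j, MemLp (fun x => a x i j) ⊤ (volume.restrict Ω)
  symm : ∀ᵐ x ∂(volume.restrict Ω), (a x).IsSymm
  pos : 0 < lmin
  bounds : ∀ᵐ x ∂(volume.restrict Ω), ∀ l : Fin d → ℝ,
    lmin * (l ⬝ᵥ l) ≤ l ⬝ᵥ (a x).mulVec l ∧ l ⬝ᵥ (a x).mulVec l ≤ lmax * (l ⬝ᵥ l)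

/-- The energy product `⟨u, v⟩_a = ∫_Ω (∇u)ᵀ a ∇v`. -/
def energy {d : ℕ} {Ω : Set (E d)} (a : E d → Matrix (Fin d) (Fin d) ℝ) (u v : H10 Ω) : ℝ :=
  ∫ x in Ω, (gradFn u x).ofLp ⬝ᵥ (a x).mulVec (gradFn v x).ofLp

/-- The energy norm `‖u‖_a`. -/
def energyNorm {d : ℕ} {Ω : Set (E d)} (a : E d → Matrix (Fin d) (Fin d) ℝ) (u : H10 Ω) : ℝ :=
  Real.sqrt (energy a u u)

/-- `div (a ∇v) = f` on `Ω` in the weak sense, with `f ∈ L²(Ω)`. -/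
def IsWeakDiv {d : ℕ} {Ω : Set (E d)} (a : E d → Matrix (Fin d) (Fin d) ℝ) (v : H10 Ω)
    (f : L2 Ω) : Prop :=
  ∀ φ : E d → ℝ, IsTest Ω φ →
    ∫ x in Ω, (gradient φ x).ofLp ⬝ᵥ (a x).mulVec (gradFn v x).ofLp = -∫ x in Ω, f x * φ x

/-! ### The index tree and the nested partitions -/

/-- The set `ℐ⁽ᵏ⁾` of the index tree in which the node `s` has `m s` children (the root being `[]`).
The `k`-tuple `(i₁, …, i_k)` is stored as the list `[i_k, …, i₁]` with entries counted from `0`, so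
the children of `s` are `t :: s` with `t < m s`, and the parent of `i` is `i.tail`. -/
def nodes (m : List ℕ → ℕ) : ℕ → Finset (List ℕ)
  | 0 => {[]}
  | k + 1 => (nodes m k).biUnion fun s => (Finset.range (m s)).image fun t => t :: s

/-- The set `𝒥⁽ᵏ⁾`, `k ≥ 1`: as `ℐ⁽ᵏ⁾`, but the last entry takes the first `m s - 1` values only. -/
def subNodes (m : List ℕ → ℕ) : ℕ → Finset (List ℕ)
  | 0 => ∅
  | k + 1 => (nodes m k).biUnion fun s => (Finset.range (m s - 1)).image fun t => t :: s

/-- `(τ i)`, `i ∈ ℐ⁽ᵏ⁾`, `1 ≤ k ≤ q`, are nested partitions of `Ω` (up to null sets) into convex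
subsets of diameter at most `H k` that contain a ball of diameter `δ * H k`. (A bounded convex set
that contains a ball is a Lipschitz set.) -/
structure IsNestedPartition {d : ℕ} (Ω : Set (E d)) (q : ℕ) (m : List ℕ → ℕ)
    (τ : List ℕ → Set (E d)) (δ : ℝ) (H : ℕ → ℝ) : Prop where
  m_pos : ∀ k < q, ∀ s ∈ nodes m k, 0 < m s
  δ_pos : 0 < δ
  δ_lt_one : δ < 1
  H_pos : ∀ k, 1 ≤ k → k ≤ q → 0 < H k
  H_one_lt : H 1 < 1
  H_anti : ∀ k, 1 ≤ k → k + 1 ≤ q → H (k + 1) < H k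
  subset : ∀ k, 1 ≤ k → k ≤ q → ∀ i ∈ nodes m k, τ i ⊆ Ω
  convex : ∀ k, 1 ≤ k → k ≤ q → ∀ i ∈ nodes m k, Convex ℝ (τ i)
  diam_le : ∀ k, 1 ≤ k → k ≤ q → ∀ i ∈ nodes m k, Metric.diam (τ i) ≤ H k
  ball_subset : ∀ k, 1 ≤ k → k ≤ q → ∀ i ∈ nodes m k,
    ∃ c, Metric.ball c (δ * H k / 2) ⊆ τ i
  disjoint : ∀ k, 1 ≤ k → k ≤ q → ∀ i ∈ nodes m k, ∀ j ∈ nodes m k, i ≠ j →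
    AEDisjoint volume (τ i) (τ j)
  cover : ∀ k, 1 ≤ k → k ≤ q → (⋃ i ∈ nodes m k, τ i) =ᵐ[volume] Ω
  nested : ∀ k, 1 ≤ k → k + 1 ≤ q → ∀ i ∈ nodes m k,
    τ i =ᵐ[volume] ⋃ t ∈ Finset.range (m i), τ (t :: i)

/-- The matrix `π⁽ᵏ'ᵏ⁺¹⁾`: its `(i, j)` entry is `1` if `j` is a child of `i` and `0` otherwise. -/
def piMat (m : List ℕ → ℕ) (k : ℕ) : Matrix (nodes m k) (nodes m (k + 1)) ℝ :=
  Matrix.of fun i j => if j.1.tail = i.1 then 1 else 0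

/-! ### Gamblets, their spaces and stiffness matrices -/

section

variable {d : ℕ} (Ω : Set (E d)) (a : E d → Matrix (Fin d) (Fin d) ℝ) (τ : List ℕ → Set (E d))
  (m : List ℕ → ℕ) (k : ℕ)

/-- `∫_Ω φ_j⁽ᵏ⁾ ψ = δ_{i,j}` for all `j ∈ ℐ⁽ᵏ⁾`, where `φ_j⁽ᵏ⁾` is the indicator function
of `τ j`. -/
def Feasible (i : nodes m k) (ψ : H10 Ω) : Prop :=
  ∀ j : nodes m k, ∫ x in Ω, (τ j.1).indicator (fun _ => (1 : ℝ)) x * valFn ψ x = if i = j then 1 else 0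

/-- `ψ` minimizes the energy norm among the elements of `H¹₀(Ω)` that satisfy the constraints. -/
def IsGamblet (i : nodes m k) (ψ : H10 Ω) : Prop :=
  Feasible Ω τ m k i ψ ∧ ∀ ψ' : H10 Ω, Feasible Ω τ m k i ψ' → energyNorm a ψ ≤ energyNorm a ψ'

/-- The gamblet `ψ_i⁽ᵏ⁾`, the minimizer (existence and uniqueness of it are not built in). -/
def gamblet (i : nodes m k) : H10 Ω := Classical.epsilon (IsGamblet Ω a τ m k i)

/-- `𝔙⁽ᵏ⁾`, the span of the gamblets of level `k`. -/
def spaceV : Submodule ℝ (H10 Ω) := Submodule.span ℝ (Set.range (gamblet Ω a τ m k))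

/-- `𝔚⁽ᵏ⁺¹⁾`, the energy-orthogonal complement of `𝔙⁽ᵏ⁾` in `𝔙⁽ᵏ⁺¹⁾`. -/
def spaceW : Set (H10 Ω) :=
  {w | w ∈ spaceV Ω a τ m (k + 1) ∧ ∀ v ∈ spaceV Ω a τ m k, energy a w v = 0}

/-- The stiffness matrix `A⁽ᵏ⁾` of the gamblets of level `k`. -/
def stiffA : Matrix (nodes m k) (nodes m k) ℝ :=
  Matrix.of fun i j => energy a (gamblet Ω a τ m k i) (gamblet Ω a τ m k j)

/-- `χ_i⁽ᵏ⁾ = ∑_j W_{i,j} ψ_j⁽ᵏ⁾`. -/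
def chi (W : Matrix (subNodes m k) (nodes m k) ℝ) (i : subNodes m k) : H10 Ω :=
  ∑ j, W i j • gamblet Ω a τ m k j

/-- The stiffness matrix `B⁽ᵏ⁾` of the elements `χ_i⁽ᵏ⁾`. -/
def stiffB (W : Matrix (subNodes m k) (nodes m k) ℝ) :
    Matrix (subNodes m k) (subNodes m k) ℝ :=
  Matrix.of fun i j => energy a (chi Ω a τ m k W i) (chi Ω a τ m k W j)

end

/-! ### The matrices `W⁽ᵏ⁾` -/

/-- `Im (Wᵀ) = Ker (π⁽ᵏ'ᵏ⁺¹⁾)` for a `𝒥⁽ᵏ⁺¹⁾ × ℐ⁽ᵏ⁺¹⁾` matrix `W`. -/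
def IsAdmissible (m : List ℕ → ℕ) (k : ℕ)
    (W : Matrix (subNodes m (k + 1)) (nodes m (k + 1)) ℝ) : Prop :=
  LinearMap.range W.transpose.mulVecLin = LinearMap.ker (piMat m k).mulVecLin

/-- The difference matrix: `W_{(s,t),(s,t')} = δ_{t,t'} - δ_{t+1,t'}`, and the entries between
different parents vanish. -/
def diffW (m : List ℕ → ℕ) (k : ℕ) : Matrix (subNodes m (k + 1)) (nodes m (k + 1)) ℝ :=
  Matrix.of fun j i =>
    if j.1.tail = i.1.tail then
      (if j.1.headI = i.1.headI then 1 else 0) - (if j.1.headI + 1 = i.1.headI then 1 else 0)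
    else 0

/-- The rows `(1, …, 1, -n, 0, …, 0)`, with `n` ones, here with `n = t + 1` and columns `t'`
counted from `0`. -/
def orthRow (t t' : ℕ) : ℝ :=
  if t' ≤ t then 1 else if t' = t + 1 then -((t : ℝ) + 1) else 0

/-- The block diagonal matrix whose blocks consist of the normalized rows `orthRow`
(the squared norm of row `t` is `(t + 1) + (t + 1)² = (t + 1) (t + 2)`). -/
def orthW (m : List ℕ → ℕ) (k : ℕ) : Matrix (subNodes m (k + 1)) (nodes m (k + 1)) ℝ :=
  Matrix.of fun j i =>
    if j.1.tail = i.1.tail then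
      orthRow j.1.headI i.1.headI / Real.sqrt (((j.1.headI : ℝ) + 1) * ((j.1.headI : ℝ) + 2))
    else 0

/-- The condition number `√(λ_max(Mᵀ M)) / √(λ_min(Mᵀ M))` (meaningful for invertible `M` with at
least one row; for a real matrix `Mᴴ = Mᵀ`). -/
def condNum {n : Type*} [Fintype n] [DecidableEq n] (M : Matrix n n ℝ) : ℝ :=
  Real.sqrt (⨆ i, (Matrix.isHermitian_conjTranspose_mul_self M).eigenvalues i) /
    Real.sqrt (⨅ i, (Matrix.isHermitian_conjTranspose_mul_self M).eigenvalues i)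

end Gamblets

end

open Gamblets

open scoped ENNReal

/-! Everything rests on the functionals u ↦ ∫_{τ_j} u over the cells of one level. By Lax–Milgram
they have energy representers, and inverting the Gram matrix of these gives a dual family ψ_i
(`IsCoercive.exists_dual`). An element satisfying the same constraints as ψ_i differs from it by
something energy-orthogonal to ψ_i, so ψ_i is the unique minimizer, the gamblet
(`IsDualFamily.isGamblet_iff`). For v = ∑ x_i ψ_i two facts follow: x_j = ∫_{τ_j} v, and ⟨v, w⟩_a =
∑ c_j ∫_{τ_j} w for some vector c, so that div(a∇v) = -∑ c_j 1_{τ_j} is piecewise constant.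

Upper bounds on energy. Each cell contains a ball, and each ball carries a bump b_j; all bumps have
the same integral β, disjoint supports and energy at most Γβ². Testing v against ∑ c_j b_j and
applying Cauchy–Schwarz gives |c|² ≤ Γ‖v‖_a², the inverse inequality (`IsCoercive.sum_sq_le`). Since
‖v‖_a² = c · x, also ‖v‖_a² ≤ Γ|x|² (`IsCoercive.quadForm_le`). The bumps are mollified cones, and
the isodiametric inequality bounds the cell volumes; in the product of the two constants the volume
of the unit ball cancels (`cellVol_mul_bumpEnergy`).

Lower bounds on energy. If all integrals of v over cells of diameter at most H vanish, the Poincaré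
inequality on convex sets gives ‖v‖ ≤ H‖∇v‖. The integrals over the coarser cells vanish for v
energy-orthogonal to the coarser gamblets, and for v whose coefficients lie in Ker π. On the
coarsest level Friedrichs' inequality plays this role, with H = 1. Bessel's inequality for the cell
indicators turns a bound on ‖v‖ into one on |x| (`IsDualFamily.dotProduct_self_le`).

The Poincaré inequality is needed with constant at most the diameter in every dimension. It comes
from Prékopa–Leindler: for a strongly log-concave density this yields an infimum convolution
inequality, whose second order expansion around constants is a Poincaré inequality
(`mul_integral_sq_le_of_logConcave`). Lebesgue measure on a convex set is within a factor e of such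
a density.

Condition numbers are quotients of bounds on quadratic forms (`condNum_le`); W enters only through
the extreme values of the form of W Wᵀ (`exists_condNum_eq`). The two explicit W are admissible by a
dimension count. One has orthonormal rows; the other is controlled by a discrete Poincaré inequality
and a volume bound on the number of children. -/

namespace Gamblets

/-! ### The Prékopa–Leindler inequality -/

/-- The Brunn–Minkowski inequality on the line, for compact sets. -/
theorem volume_add_le_of_isCompact {A B C : Set ℝ} (hA : IsCompact A) (hB : IsCompact B)
    (hA0 : A.Nonempty) (hB0 : B.Nonempty) (hC : ∀ x ∈ A, ∀ y ∈ B, (x + y) / 2 ∈ C) :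
    volume A + volume B ≤ 2 * volume C := by
  obtain ⟨α, hα, hαm⟩ := hA.exists_isGreatest hA0
  obtain ⟨β, hβ, hβm⟩ := hB.exists_isLeast hB0
  -- With α = max A and β = min B, the translates A + β and α + B both lie in 2C. They share at most
  -- the point α + β, because x + β ≤ α + β ≤ α + y.
  have h1 : (fun x : ℝ => x + β) '' A ⊆ (fun x : ℝ => 2 * x) '' C := by
    rintro _ ⟨x, hx, rfl⟩
    exact ⟨(x + β) / 2, hC x hx β hβ, by ring⟩
  have h2 : (fun x : ℝ => α + x) '' B ⊆ (fun x : ℝ => 2 * x) '' C := by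
    rintro _ ⟨x, hx, rfl⟩
    exact ⟨(α + x) / 2, hC α hα x hx, by ring⟩
  have hd : AEDisjoint volume ((fun x : ℝ => x + β) '' A) ((fun x : ℝ => α + x) '' B) := by
    refine measure_mono_null (t := {α + β}) ?_ Real.volume_singleton
    rintro _ ⟨⟨x, hx, rfl⟩, ⟨y, hy, hxy⟩⟩
    have := hαm hx
    have := hβm hy
    simp only at hxy
    simp only [Set.mem_singleton_iff]
    linarith
  have hm : NullMeasurableSet ((fun x : ℝ => α + x) '' B) volume :=
    (hB.image (by fun_prop)).measurableSet.nullMeasurableSet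
  have h3 : volume ((fun x : ℝ => 2 * x) '' C) = 2 * volume C := by
    have := Measure.addHaar_smul (volume : Measure ℝ) 2 C
    simp only [Module.finrank_self, pow_one, abs_two, ENNReal.ofReal_ofNat] at this
    exact this
  calc volume A + volume B
      = volume ((fun x : ℝ => x + β) '' A) + volume ((fun x : ℝ => α + x) '' B) := by
        simp [Set.image_add_right, Set.image_add_left]
    _ = volume (((fun x : ℝ => x + β) '' A) ∪ ((fun x : ℝ => α + x) '' B)) :=
        (measure_union₀ hm hd).symm
    _ ≤ volume ((fun x : ℝ => 2 * x) '' C) := measure_mono (Set.union_subset h1 h2)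
    _ = _ := h3

/-- The Brunn–Minkowski inequality on the line. -/
theorem volume_add_le_of_midpoint_mem {A B C : Set ℝ} (hA : MeasurableSet A)
    (hB : MeasurableSet B) (hA0 : A.Nonempty) (hB0 : B.Nonempty)
    (hC : ∀ x ∈ A, ∀ y ∈ B, (x + y) / 2 ∈ C) :
    volume A + volume B ≤ 2 * volume C := by
  obtain ⟨a, ha⟩ := hA0
  obtain ⟨b, hb⟩ := hB0
  rw [hA.measure_eq_iSup_isCompact, hB.measure_eq_iSup_isCompact]
  simp only [iSup_and']
  refine ENNReal.biSup_add_biSup_le' ⟨{a}, by simpa, isCompact_singleton⟩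
    ⟨{b}, by simpa, isCompact_singleton⟩ fun K hK L hL => ?_
  -- Inserting a and b keeps the approximating compact sets nonempty without leaving A and B.
  refine (add_le_add (measure_mono (Set.subset_insert a K))
    (measure_mono (Set.subset_insert b L))).trans ?_
  refine volume_add_le_of_isCompact (hK.2.insert a) (hL.2.insert b) (Set.insert_nonempty _ _)
    (Set.insert_nonempty _ _) fun x hx y hy => hC x ?_ y ?_
  · exact Set.insert_subset ha hK.1 hx
  · exact Set.insert_subset hb hL.1 hy

theorem ENNReal_mul_le_sq_of_add_le {a b c : ℝ≥0∞} (h : a + b ≤ 2 * c) : a * b ≤ c ^ 2 := by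
  rcases eq_or_ne c ⊤ with rfl | hc
  · simp
  have hab : a + b ≠ ⊤ := ne_top_of_le_ne_top (ENNReal.mul_ne_top (by simp) hc) h
  obtain ⟨ha, hb⟩ := ENNReal.add_ne_top.1 hab
  lift a to NNReal using ha
  lift b to NNReal using hb
  lift c to NNReal using hc
  norm_cast at h ⊢
  rw [← NNReal.coe_le_coe] at h ⊢
  push_cast at h ⊢
  nlinarith [sq_nonneg ((a : ℝ) - b), a.2, b.2, c.2, mul_self_le_mul_self (by positivity) h]

/-- The Prékopa–Leindler inequality on the line, for bounded functions. -/
theorem prekopaLeindler_real_of_bounded {f g h : ℝ → ℝ} (hf : Measurable f) (hg : Measurable g)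
    (hh : Measurable h) (hf0 : ∀ x, 0 ≤ f x) (hg0 : ∀ x, 0 ≤ g x) (hh0 : ∀ x, 0 ≤ h x)
    (hfb : BddAbove (Set.range f)) (hgb : BddAbove (Set.range g))
    (H : ∀ x y, f x * g y ≤ h ((x + y) / 2) ^ 2) :
    (∫⁻ x, ENNReal.ofReal (f x)) * (∫⁻ x, ENNReal.ofReal (g x))
      ≤ (∫⁻ x, ENNReal.ofReal (h x)) ^ 2 := by
  -- After division by the suprema, the superlevel sets of f/α and g/β at height t are nonempty for
  -- every t < 1 and empty for t ≥ 1, so Brunn–Minkowski applies level by level. Layer cake gives an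
  -- additive inequality, which the arithmetic–geometric mean inequality makes multiplicative.
  set α := ⨆ x, f x with hα
  set β := ⨆ x, g x with hβ
  have hfα : ∀ x, f x ≤ α := le_ciSup hfb
  have hgβ : ∀ x, g x ≤ β := le_ciSup hgb
  rcases ((hf0 0).trans (hfα 0)).eq_or_lt with h0 | hαpos
  · have : ∀ x, f x = 0 := fun x => le_antisymm (h0 ▸ hfα x) (hf0 x)
    simp [this]
  rcases ((hg0 0).trans (hgβ 0)).eq_or_lt with h0 | hβpos
  · have : ∀ x, g x = 0 := fun x => le_antisymm (h0 ▸ hgβ x) (hg0 x)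
    simp [this]
  set γ := Real.sqrt (α * β) with hγ
  have hγpos : 0 < γ := Real.sqrt_pos.2 (by positivity)
  have hγ2 : γ ^ 2 = α * β := Real.sq_sqrt (by positivity)
  have scale : ∀ (c : ℝ) (_ : 0 < c) (u : ℝ → ℝ), Measurable u →
      ∫⁻ x, ENNReal.ofReal (u x) = ENNReal.ofReal c * ∫⁻ x, ENNReal.ofReal (u x / c) := by
    intro c hc u hu
    rw [← lintegral_const_mul _ (by fun_prop)]
    refine lintegral_congr fun x => ?_
    rw [← ENNReal.ofReal_mul hc.le, mul_div_cancel₀ _ hc.ne']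
  have cake : ∀ (c : ℝ) (_ : 0 < c) (u : ℝ → ℝ), Measurable u → (∀ x, 0 ≤ u x) →
      ∫⁻ x, ENNReal.ofReal (u x / c) = ∫⁻ t in Set.Ioi 0, volume {x | t < u x / c} := by
    intro c hc u hu hu0
    exact lintegral_eq_lintegral_meas_lt _ (ae_of_all _ fun x => div_nonneg (hu0 x) hc.le)
      (by fun_prop)
  have key : (∫⁻ x, ENNReal.ofReal (f x / α)) + (∫⁻ x, ENNReal.ofReal (g x / β))
      ≤ 2 * ∫⁻ x, ENNReal.ofReal (h x / γ) := by
    rw [cake α hαpos f hf hf0, cake β hβpos g hg hg0, cake γ hγpos h hh hh0]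
    have anti : ∀ (c : ℝ) (u : ℝ → ℝ), Antitone fun t : ℝ => volume {x | t < u x / c} :=
      fun c u s t hst => measure_mono fun x hx => lt_of_le_of_lt hst hx
    rw [← lintegral_add_left (anti α f).measurable, ← lintegral_const_mul _ (anti γ h).measurable]
    refine setLIntegral_mono' measurableSet_Ioi fun t ht => ?_
    rcases lt_or_ge t 1 with h1 | h1
    · refine volume_add_le_of_midpoint_mem (measurableSet_lt (by fun_prop) (by fun_prop))
        (measurableSet_lt (by fun_prop) (by fun_prop)) ?_ ?_ ?_
      · obtain ⟨x, hx⟩ := exists_lt_of_lt_ciSup (f := f) (b := t * α) (by rw [← hα]; nlinarith)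
        exact ⟨x, (lt_div_iff₀ hαpos).2 hx⟩
      · obtain ⟨x, hx⟩ := exists_lt_of_lt_ciSup (f := g) (b := t * β) (by rw [← hβ]; nlinarith)
        exact ⟨x, (lt_div_iff₀ hβpos).2 hx⟩
      · intro x hx y hy
        have hx' : t * α < f x := (lt_div_iff₀ hαpos).1 hx
        have hy' : t * β < g y := (lt_div_iff₀ hβpos).1 hy
        refine (lt_div_iff₀ hγpos).2 ?_
        refine lt_of_pow_lt_pow_left₀ 2 (hh0 _) (lt_of_lt_of_le ?_ (H x y))
        rw [mul_pow, hγ2]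
        have : t * α * (t * β) < f x * g y :=
          mul_lt_mul'' hx' hy' (mul_nonneg (le_of_lt ht) hαpos.le)
            (mul_nonneg (le_of_lt ht) hβpos.le)
        nlinarith
    · have e1 : {x | t < f x / α} = ∅ := by
        refine Set.eq_empty_of_forall_notMem fun x (hx : t < f x / α) => ?_
        have := (div_le_one hαpos).2 (hfα x)
        linarith
      have e2 : {x | t < g x / β} = ∅ := by
        refine Set.eq_empty_of_forall_notMem fun x (hx : t < g x / β) => ?_
        have := (div_le_one hβpos).2 (hgβ x)
        linarith
      simp [e1, e2]
  have key2 := ENNReal_mul_le_sq_of_add_le key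
  rw [scale α hαpos f hf, scale β hβpos g hg, scale γ hγpos h hh, mul_pow,
    ← ENNReal.ofReal_pow hγpos.le, hγ2, ENNReal.ofReal_mul hαpos.le, mul_mul_mul_comm]
  gcongr

/-- The Prékopa–Leindler inequality on the line. -/
theorem prekopaLeindler_real {f g h : ℝ → ℝ≥0∞} (hf : Measurable f) (hg : Measurable g)
    (hh : Measurable h) (H : ∀ x y, f x * g y ≤ h ((x + y) / 2) ^ 2) :
    (∫⁻ x, f x) * (∫⁻ x, g x) ≤ (∫⁻ x, h x) ^ 2 := by
  have bdd : ∀ n : ℕ, (∫⁻ x, min (f x) n) * (∫⁻ x, min (g x) n) ≤ (∫⁻ x, h x) ^ 2 := by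
    intro n
    have conv : ∀ u : ℝ → ℝ≥0∞, ∀ x, ENNReal.ofReal (min (u x) n).toReal = min (u x) n :=
      fun u x => ENNReal.ofReal_toReal (ne_top_of_le_ne_top (ENNReal.natCast_ne_top n)
        (min_le_right _ _))
    have le : ∀ u : ℝ → ℝ≥0∞, ∀ x, (min (u x) n).toReal ≤ n := fun u x =>
      ENNReal.toReal_le_of_le_ofReal (by positivity) (by simp)
    -- The function h is truncated at n too. This preserves the hypothesis, since the product of the
    -- truncated f and g is at most n².
    have := prekopaLeindler_real_of_bounded (f := fun x => (min (f x) n).toReal)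
      (g := fun x => (min (g x) n).toReal) (h := fun x => (min (h x) n).toReal)
      (by fun_prop) (by fun_prop) (by fun_prop) (fun _ => by positivity) (fun _ => by positivity)
      (fun _ => by positivity) ⟨n, by rintro _ ⟨x, rfl⟩; exact le f x⟩
      ⟨n, by rintro _ ⟨x, rfl⟩; exact le g x⟩ (fun x y => by
        rw [← ENNReal.toReal_mul, ← ENNReal.toReal_pow]
        refine ENNReal.toReal_mono (ENNReal.pow_ne_top (ne_top_of_le_ne_top
          (ENNReal.natCast_ne_top n) (min_le_right _ _))) ?_
        rcases le_total (h ((x + y) / 2)) n with h1 | h1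
        · rw [min_eq_left h1]
          exact (mul_le_mul' (min_le_left _ _) (min_le_left _ _)).trans (H x y)
        · rw [min_eq_right h1, sq]
          exact mul_le_mul' (min_le_right _ _) (min_le_right _ _))
    simp only [conv] at this
    refine this.trans (pow_le_pow_left₀ (zero_le) (lintegral_mono fun x => min_le_left _ _) 2)
  have sup : ∀ u : ℝ → ℝ≥0∞, Measurable u → ∫⁻ x, u x = ⨆ n : ℕ, ∫⁻ x, min (u x) n := by
    intro u hu
    rw [← lintegral_iSup (fun n => by fun_prop)]
    · refine lintegral_congr fun x => ?_
      rw [← inf_iSup_eq, ENNReal.iSup_natCast, inf_top_eq]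
    · intro n k hnk x
      exact min_le_min le_rfl (by exact_mod_cast hnk)
  have mono : ∀ u : ℝ → ℝ≥0∞, Monotone fun n : ℕ => ∫⁻ x, min (u x) n := fun u n k hnk =>
    lintegral_mono fun x => min_le_min le_rfl (by exact_mod_cast hnk)
  rw [sup f hf, sup g hg, ENNReal.iSup_mul]
  refine iSup_le fun n => ?_
  rw [ENNReal.mul_iSup]
  refine iSup_le fun k => ?_
  exact (mul_le_mul' (mono f (le_max_left n k)) (mono g (le_max_right n k))).trans (bdd _)

/-- The Prékopa–Leindler inequality on `ℝⁿ`. -/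
theorem prekopaLeindler_pi (n : ℕ) {f g h : (Fin n → ℝ) → ℝ≥0∞} (hf : Measurable f)
    (hg : Measurable g) (hh : Measurable h)
    (H : ∀ x y, f x * g y ≤ h (fun i => (x i + y i) / 2) ^ 2) :
    (∫⁻ x, f x) * (∫⁻ x, g x) ≤ (∫⁻ x, h x) ^ 2 := by
  induction n with
  | zero =>
    have e : ∀ u : (Fin 0 → ℝ) → ℝ≥0∞, ∫⁻ x, u x = u default := fun u => by
      rw [lintegral_unique, volume_pi, Measure.pi_empty_univ, mul_one]
      congr 1
      exact Subsingleton.elim _ _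
    rw [e, e, e]
    convert H default default
  | succ n ih =>
    have ec : ∀ p : ℝ × (Fin n → ℝ), (MeasurableEquiv.piFinSuccAbove
        (fun _ : Fin (n + 1) => ℝ) 0).symm p = Fin.cons p.1 p.2 := fun p => by
      simp [MeasurableEquiv.piFinSuccAbove]
      rfl
    have e : ∀ u : (Fin (n + 1) → ℝ) → ℝ≥0∞, Measurable u →
        ∫⁻ x, u x = ∫⁻ s : ℝ, ∫⁻ x : Fin n → ℝ, u (Fin.cons s x) := by
      intro u hu
      have h1 := (volume_preserving_piFinSuccAbove (fun _ : Fin (n + 1) => ℝ) 0).symm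
      rw [← h1.lintegral_comp hu, Measure.volume_eq_prod, lintegral_prod _ (by fun_prop)]
      simp only [ec]
    have m : ∀ u : (Fin (n + 1) → ℝ) → ℝ≥0∞, Measurable u →
        Measurable fun p : ℝ × (Fin n → ℝ) => u (Fin.cons p.1 p.2) := fun u hu => by
      simp only [← ec]
      exact hu.comp (MeasurableEquiv.measurable _)
    rw [e f hf, e g hg, e h hh]
    -- Tensorization: for first coordinates s and t the slices satisfy the n-dimensional hypothesis,
    -- so the slice integrals satisfy the one-dimensional one.
    refine prekopaLeindler_real (m f hf).lintegral_prod_right' (m g hg).lintegral_prod_right'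
      (m h hh).lintegral_prod_right' fun s t => ?_
    refine ih ((m f hf).comp measurable_prodMk_left) ((m g hg).comp measurable_prodMk_left)
      ((m h hh).comp measurable_prodMk_left) fun x y => ?_
    convert H (Fin.cons s x) (Fin.cons t y) using 4 with i
    refine Fin.cases ?_ (fun i => ?_) i <;> simp

/-- The Prékopa–Leindler inequality on Euclidean space. -/
theorem prekopaLeindler {d : ℕ} {f g h : E d → ℝ≥0∞} (hf : Measurable f)
    (hg : Measurable g) (hh : Measurable h)
    (H : ∀ x y, f x * g y ≤ h (midpoint ℝ x y) ^ 2) :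
    (∫⁻ x, f x) * (∫⁻ x, g x) ≤ (∫⁻ x, h x) ^ 2 := by
  have hp := PiLp.volume_preserving_toLp (Fin d)
  rw [← hp.lintegral_comp hf, ← hp.lintegral_comp hg, ← hp.lintegral_comp hh]
  refine prekopaLeindler_pi d (hf.comp hp.measurable) (hg.comp hp.measurable)
    (hh.comp hp.measurable) fun x y => ?_
  convert H (WithLp.toLp 2 x) (WithLp.toLp 2 y) using 3
  ext i
  simp [midpoint_eq_smul_add]
  ring

/-- The isodiametric inequality. -/
theorem volume_le_volume_closedBall_of_dist_le {d : ℕ} {K : Set (E d)} (hK : MeasurableSet K)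
    {D : ℝ} (hD : ∀ x ∈ K, ∀ y ∈ K, dist x y ≤ D) :
    volume K ≤ volume (Metric.closedBall (0 : E d) (D / 2)) := by
  have hK' : MeasurableSet (-K) := hK.neg
  -- K is compared with -K: if x and -y lie in K then |x + y| ≤ D, so the midpoint of x and y lies
  -- in the ball of radius D/2.
  have key := prekopaLeindler (f := K.indicator 1) (g := (-K).indicator 1)
    (h := (Metric.closedBall (0 : E d) (D / 2)).indicator 1)
    (measurable_one.indicator hK) (measurable_one.indicator hK')
    (measurable_one.indicator Metric.isClosed_closedBall.measurableSet) (fun x y => by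
      by_cases hx : x ∈ K
      · by_cases hy : y ∈ -K
        · have : midpoint ℝ x y ∈ Metric.closedBall (0 : E d) (D / 2) := by
            have h1 := hD x hx (-y) hy
            rw [dist_eq_norm, sub_neg_eq_add] at h1
            rw [mem_closedBall_zero_iff, midpoint_eq_smul_add, norm_smul]
            simp
            linarith
          simp [hx, hy, this]
        · simp [hy]
      · simp [hx])
  rw [lintegral_indicator_one hK, lintegral_indicator_one hK',
    lintegral_indicator_one Metric.isClosed_closedBall.measurableSet, Measure.measure_neg,
    ← sq] at key
  exact (ENNReal.pow_le_pow_left_iff (by simp)).1 key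


/-! ### The Poincaré inequality on convex sets -/

theorem one_add_add_sq_sub_le_exp {s : ℝ} (hs : |s| ≤ 1) :
    1 + s + s ^ 2 / 2 - |s| ^ 3 ≤ Real.exp s := by
  have h := (abs_le.1 (Real.exp_bound hs (n := 3) (by norm_num))).1
  simp [Finset.sum_range_succ, Nat.factorial] at h
  have : 0 ≤ |s| ^ 3 := by positivity
  linarith

open Filter Topology in
/-- If `ε ↦ (Z + ε² α) (Z + ε² β)` does not exceed `Z²` for small `ε`, then `α + β ≤ 0` at `0`. -/
theorem add_le_zero_of_mul_le_sq {Z : ℝ} (hZ : 0 < Z) {α β : ℝ → ℝ} (hα : ContinuousAt α 0)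
    (hβ : ContinuousAt β 0) (h : ∀ᶠ ε in 𝓝[>] (0 : ℝ), ∃ X Y : ℝ, Z + ε ^ 2 * α ε ≤ X ∧
      Z + ε ^ 2 * β ε ≤ Y ∧ X * Y ≤ Z ^ 2) : α 0 + β 0 ≤ 0 := by
  have ca : ContinuousAt (fun ε => Z + ε ^ 2 * α ε) 0 := by fun_prop
  have cb : ContinuousAt (fun ε => Z + ε ^ 2 * β ε) 0 := by fun_prop
  have pa : ∀ᶠ ε in 𝓝[>] (0 : ℝ), 0 < Z + ε ^ 2 * α ε :=
    (ca.eventually (lt_mem_nhds (by simpa using hZ))).filter_mono nhdsWithin_le_nhds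
  have pb : ∀ᶠ ε in 𝓝[>] (0 : ℝ), 0 < Z + ε ^ 2 * β ε :=
    (cb.eventually (lt_mem_nhds (by simpa using hZ))).filter_mono nhdsWithin_le_nhds
  have cc : ContinuousAt (fun ε => Z * (α ε + β ε) + ε ^ 2 * (α ε * β ε)) 0 := by fun_prop
  have lim := (cc.tendsto.mono_left (nhdsWithin_le_nhds (s := Set.Ioi 0)))
  have := le_of_tendsto lim (b := 0) (by
    filter_upwards [h, pa, pb, self_mem_nhdsWithin] with ε ⟨X, Y, hX, hY, hXY⟩ ha hb hε
    have h1 : (Z + ε ^ 2 * α ε) * (Z + ε ^ 2 * β ε) ≤ Z ^ 2 :=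
      (mul_le_mul hX hY hb.le (ha.le.trans hX)).trans hXY
    have h2 : 0 < ε ^ 2 := pow_pos hε 2
    refine le_of_mul_le_mul_left ?_ h2
    nlinarith)
  simp only [ne_eq, OfNat.ofNat_ne_zero, not_false_eq_true, zero_pow, zero_mul, add_zero] at this
  nlinarith

/-- Admissibility of the pair of functions used in the linearization. The Taylor error ε M D² is
paid for by lowering lam to lam - 4εM, and the linear term ε n D is split by Young's inequality. -/
theorem sub_sq_div_add_neg_le {ε M lam gx gy n i D : ℝ} (hε : 0 < ε) (hl : 0 < lam - 4 * ε * M)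
    (h1 : |gy - gx - i| ≤ M * D ^ 2) (h2 : -(n * D) ≤ i) :
    ε * gx - ε ^ 2 * n ^ 2 / (lam - 4 * ε * M) + -(ε * gy) ≤ lam * D ^ 2 / 4 := by
  have b1 := (abs_le.1 h1).1
  have b3 : ε * n * D ≤ ε ^ 2 * n ^ 2 / (lam - 4 * ε * M) + (lam - 4 * ε * M) * D ^ 2 / 4 := by
    have e1 : ε ^ 2 * n ^ 2 / (lam - 4 * ε * M)
        = (ε * n / (lam - 4 * ε * M)) ^ 2 * (lam - 4 * ε * M) := by
      field_simp
    have e2 : ε * n * D = (ε * n / (lam - 4 * ε * M)) * (lam - 4 * ε * M) * D := by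
      rw [div_mul_cancel₀ _ hl.ne']
    rw [e1, e2]
    nlinarith [mul_nonneg hl.le (sq_nonneg (ε * n / (lam - 4 * ε * M) - D / 2))]
  have b4 : (lam - 4 * ε * M) * D ^ 2 / 4 = lam * D ^ 2 / 4 - ε * (M * D ^ 2) := by ring
  nlinarith

/-! ### Infimum convolution and spectral gap for strongly log-concave densities. -/

section LogConcave

variable {d : ℕ} {K : Set (E d)} {V : E d → ℝ} {lam : ℝ}

/-- The infimum convolution inequality for a strongly log-concave density on a convex set. -/
theorem integral_exp_mul_integral_exp_le (hK : MeasurableSet K) (hKc : Convex ℝ K)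
    (hV : Measurable V)
    (hVmid : ∀ x ∈ K, ∀ y ∈ K, V (midpoint ℝ x y) ≤ (V x + V y) / 2 - lam * dist x y ^ 2 / 8)
    {F G : E d → ℝ} (hF : Measurable F) (hG : Measurable G)
    (hFG : ∀ x y, F x + G y ≤ lam * dist x y ^ 2 / 4) :
    (∫⁻ x in K, ENNReal.ofReal (Real.exp (F x) * Real.exp (-V x))) *
      (∫⁻ x in K, ENNReal.ofReal (Real.exp (G x) * Real.exp (-V x))) ≤
      (∫⁻ x in K, ENNReal.ofReal (Real.exp (-V x))) ^ 2 := by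
  simp only [← lintegral_indicator hK]
  refine prekopaLeindler (Measurable.indicator (by fun_prop) hK)
    (Measurable.indicator (by fun_prop) hK) (Measurable.indicator (by fun_prop) hK) fun x y => ?_
  by_cases hx : x ∈ K
  · by_cases hy : y ∈ K
    · have hm : midpoint ℝ x y ∈ K := hKc.midpoint_mem hx hy
      simp only [Set.indicator_of_mem hx, Set.indicator_of_mem hy, Set.indicator_of_mem hm]
      rw [← ENNReal.ofReal_mul (by positivity), ← ENNReal.ofReal_pow (by positivity)]
      refine ENNReal.ofReal_le_ofReal ?_
      rw [← Real.exp_add, ← Real.exp_add, ← Real.exp_add, ← Real.exp_nat_mul]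
      -- The allowance lam |x - y|²/4 for F x + G y is exactly twice the convexity gain lam |x -
      -- y|²/8 of V at the midpoint.
      refine Real.exp_le_exp.2 ?_
      have := hVmid x hx y hy
      have := hFG x y
      push_cast
      linarith
    · simp [hy]
  · simp [hx]

set_option maxHeartbeats 800000 in
open Filter Topology in
/-- The Poincaré inequality for a strongly log-concave density on a convex set. -/
theorem mul_integral_sq_le_of_logConcave (hK : MeasurableSet K) (hKc : Convex ℝ K)
    (hV : Measurable V) (hlam : 0 < lam)
    (hVmid : ∀ x ∈ K, ∀ y ∈ K, V (midpoint ℝ x y) ≤ (V x + V y) / 2 - lam * dist x y ^ 2 / 8)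
    (hint : IntegrableOn (fun x => Real.exp (-V x)) K) (hpos : 0 < ∫ x in K, Real.exp (-V x))
    {g : E d → ℝ} {p : E d → E d} (hg : Measurable g) (hp : Measurable p) {M : ℝ}
    (hgM : ∀ x, |g x| ≤ M) (hpM : ∀ x, ‖p x‖ ≤ M)
    (hM : ∀ x y, |g y - g x - inner ℝ (p x) (y - x)| ≤ M * dist x y ^ 2)
    (hmean : ∫ x in K, g x * Real.exp (-V x) = 0) :
    lam * ∫ x in K, g x ^ 2 * Real.exp (-V x) ≤ ∫ x in K, ‖p x‖ ^ 2 * Real.exp (-V x) := by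
  have hM0 : 0 ≤ M := (abs_nonneg _).trans (hgM 0)
  replace hint : Integrable (fun x => Real.exp (-V x)) (volume.restrict K) := hint
  have bint : ∀ (u : E d → ℝ), Measurable u → ∀ C : ℝ, (∀ x, |u x| ≤ C) →
      Integrable (fun x => u x * Real.exp (-V x)) (volume.restrict K) := by
    intro u hu C hC
    exact hint.bdd_mul (c := C) hu.aestronglyMeasurable (ae_of_all _ hC)
  set Z := ∫ x in K, Real.exp (-V x) with hZ
  set S := ∫ x in K, g x ^ 2 * Real.exp (-V x) with hS
  set P := ∫ x in K, ‖p x‖ ^ 2 * Real.exp (-V x) with hP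
  have ig := bint g hg M hgM
  have ig2 := bint (fun x => g x ^ 2) (by fun_prop) (M ^ 2) (fun x => by
    rw [abs_pow]; exact pow_le_pow_left₀ (abs_nonneg _) (hgM x) 2)
  have ip2 := bint (fun x => ‖p x‖ ^ 2) (by fun_prop) (M ^ 2) (fun x => by
    rw [abs_pow, abs_norm]; exact pow_le_pow_left₀ (norm_nonneg _) (hpM x) 2)
  -- For small ε one has |F| ≤ ε C₁ for the F defined below, and ε³ C₂ dominates every error beyond
  -- second order: half the cross term in F² and the cubic remainder of the exponential.
  set C₁ := M + 2 * M ^ 2 / lam with hC₁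
  set C₂ := 2 * M ^ 3 / lam + C₁ ^ 3 with hC₂
  have hC₁0 : 0 ≤ C₁ := by positivity
  have hC₂0 : 0 ≤ C₂ := by positivity
  have hMC₁ : M ≤ C₁ := by rw [hC₁]; have : 0 ≤ 2 * M ^ 2 / lam := by positivity
                           linarith
  have hMC₂ : M ^ 3 ≤ C₂ := by
    have : 0 ≤ 2 * M ^ 3 / lam := by positivity
    have := pow_le_pow_left₀ hM0 hMC₁ 3
    linarith
  -- The infimum convolution inequality is expanded with G = -εg and F = εg - ε²|p|²/(lam - 4εM).
  -- The zero mean of g removes the first order terms, and in the limit the ε² coefficients add up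
  -- to S - P/lam ≤ 0.
  have key := add_le_zero_of_mul_le_sq hpos
    (α := fun ε => S / 2 - P / (lam - 4 * ε * M) - ε * C₂ * Z) (β := fun ε => S / 2 - ε * C₂ * Z)
    (by
      have : ContinuousAt (fun ε : ℝ => P / (lam - 4 * ε * M)) 0 :=
        continuousAt_const.div (by fun_prop) (by simpa using hlam.ne')
      fun_prop) (by fun_prop) ?_
  · simp only [mul_zero, zero_mul, sub_zero] at key
    have : S ≤ P / lam := by linarith
    rw [le_div_iff₀ hlam] at this
    linarith
  have e1 : ∀ᶠ ε in 𝓝[>] (0 : ℝ), lam / 2 ≤ lam - 4 * ε * M := by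
    have : ContinuousAt (fun ε : ℝ => lam - 4 * ε * M) 0 := by fun_prop
    filter_upwards [(this.eventually (lt_mem_nhds (a := lam / 2) (by simpa using half_lt_self hlam))).filter_mono
      nhdsWithin_le_nhds] with ε h using h.le
  have e2 : ∀ᶠ ε in 𝓝[>] (0 : ℝ), ε * C₁ ≤ 1 := by
    have : ContinuousAt (fun ε : ℝ => ε * C₁) 0 := by fun_prop
    filter_upwards [(this.tendsto.eventually_lt_const
      (by simp : 0 * C₁ < 1)).filter_mono nhdsWithin_le_nhds] with ε h using h.le
  have e3 : ∀ᶠ ε in 𝓝[>] (0 : ℝ), ε ≤ 1 :=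
    (eventually_le_nhds zero_lt_one).filter_mono nhdsWithin_le_nhds
  filter_upwards [e1, e2, e3, self_mem_nhdsWithin] with ε h1 h2 h3 (hε : 0 < ε)
  set lam' := lam - 4 * ε * M with hlam'
  have hl' : 0 < lam' := lt_of_lt_of_le (by positivity) h1
  set F : E d → ℝ := fun x => ε * g x - ε ^ 2 * ‖p x‖ ^ 2 / lam' with hFdef
  have hFm : Measurable F := by fun_prop
  have hpd : ∀ x, ε ^ 2 * ‖p x‖ ^ 2 / lam' ≤ ε * (2 * M ^ 2 / lam) := fun x => by
    have a1 : ‖p x‖ ^ 2 ≤ M ^ 2 := pow_le_pow_left₀ (norm_nonneg _) (hpM x) 2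
    have a2 : ε * (2 * M ^ 2 / lam) = ε * M ^ 2 / (lam / 2) := by field_simp
    rw [a2]
    gcongr
    nlinarith
  have hpd0 : ∀ x, 0 ≤ ε ^ 2 * ‖p x‖ ^ 2 / lam' := fun x => by positivity
  have hFC : ∀ x, |F x| ≤ ε * C₁ := fun x => by
    have a1 := abs_le.1 (hgM x)
    have a2 := hpd x
    have a3 := hpd0 x
    rw [abs_le, hFdef, hC₁]
    constructor <;> nlinarith
  have hgC : ∀ x, |-(ε * g x)| ≤ ε * M := fun x => by
    rw [abs_neg, abs_mul, abs_of_pos hε]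
    exact mul_le_mul_of_nonneg_left (hgM x) hε.le
  have bexp : ∀ (u : E d → ℝ) (hu : Measurable u) (_ : ∀ x, |u x| ≤ 1),
      Integrable (fun x => Real.exp (u x) * Real.exp (-V x)) (volume.restrict K) := fun u hu hu1 =>
    bint (fun x => Real.exp (u x)) (by fun_prop) (Real.exp 1) fun x => by
      rw [abs_of_pos (Real.exp_pos _)]
      exact Real.exp_le_exp.2 ((le_abs_self _).trans (hu1 x))
  have iF := bexp F hFm fun x => (hFC x).trans h2
  have iG := bexp (fun x => -(ε * g x)) (by fun_prop) fun x => (hgC x).trans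
    ((mul_le_mul_of_nonneg_left hMC₁ hε.le).trans h2)
  refine ⟨∫ x in K, Real.exp (F x) * Real.exp (-V x),
    ∫ x in K, Real.exp (-(ε * g x)) * Real.exp (-V x), ?_, ?_, ?_⟩
  · have : Z + ε ^ 2 * (S / 2 - P / lam' - ε * C₂ * Z) = ∫ x in K, (Real.exp (-V x) +
        ε * (g x * Real.exp (-V x)) + ε ^ 2 / 2 * (g x ^ 2 * Real.exp (-V x))
        - ε ^ 2 / lam' * (‖p x‖ ^ 2 * Real.exp (-V x)) - ε ^ 3 * C₂ * Real.exp (-V x)) := by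
      rw [integral_sub, integral_sub, integral_add, integral_add]
      · simp only [integral_const_mul, hmean, ← hZ, ← hS, ← hP]
        ring
      all_goals fun_prop
    rw [this]
    refine integral_mono (by fun_prop) iF fun x => ?_
    have a1 := one_add_add_sq_sub_le_exp ((hFC x).trans h2)
    have a2 : |F x| ^ 3 ≤ ε ^ 3 * C₁ ^ 3 := by
      rw [← mul_pow]; exact pow_le_pow_left₀ (abs_nonneg _) (hFC x) 3
    have a3 : ε ^ 2 * g x ^ 2 - ε ^ 3 * (4 * M ^ 3 / lam) ≤ F x ^ 2 := by
      have b1 := abs_le.1 (hgM x)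
      have b2 := hpd x
      have b3 := hpd0 x
      have b4 : ε * g x * (ε ^ 2 * ‖p x‖ ^ 2 / lam') ≤ ε * M * (ε * (2 * M ^ 2 / lam)) :=
        mul_le_mul (mul_le_mul_of_nonneg_left b1.2 hε.le) b2 b3 (by positivity)
      have b5 : ε * g x * (ε ^ 2 * ‖p x‖ ^ 2 / lam') ≤ ε ^ 3 * (2 * M ^ 3 / lam) := by
        have a1 : ‖p x‖ ^ 2 ≤ M ^ 2 := pow_le_pow_left₀ (norm_nonneg _) (hpM x) 2
        have a2 : ε ^ 3 * (2 * M ^ 3 / lam) = ε * M * (ε ^ 2 * M ^ 2 / (lam / 2)) := by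
          field_simp
        rw [a2]
        refine mul_le_mul (mul_le_mul_of_nonneg_left b1.2 hε.le) ?_ b3 (by positivity)
        gcongr
      have b6 : ε ^ 3 * (4 * M ^ 3 / lam) = 2 * (ε ^ 3 * (2 * M ^ 3 / lam)) := by ring
      rw [b6, hFdef]
      nlinarith [sq_nonneg (ε ^ 2 * ‖p x‖ ^ 2 / lam')]
    have a4 : 1 + ε * g x + ε ^ 2 / 2 * g x ^ 2 - ε ^ 2 / lam' * ‖p x‖ ^ 2 - ε ^ 3 * C₂
        ≤ Real.exp (F x) := by
      have c1 : ε ^ 3 * C₂ = ε ^ 3 * (4 * M ^ 3 / lam) / 2 + ε ^ 3 * C₁ ^ 3 := by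
        rw [hC₂]; ring
      have c2 : ε ^ 2 / lam' * ‖p x‖ ^ 2 = ε ^ 2 * ‖p x‖ ^ 2 / lam' := by ring
      have c3 : F x = ε * g x - ε ^ 2 * ‖p x‖ ^ 2 / lam' := rfl
      rw [c1, c2]
      linarith
    have := mul_le_mul_of_nonneg_right a4 (Real.exp_pos (-V x)).le
    simp only
    linarith
  · have : Z + ε ^ 2 * (S / 2 - ε * C₂ * Z) = ∫ x in K, (Real.exp (-V x) -
        ε * (g x * Real.exp (-V x)) + ε ^ 2 / 2 * (g x ^ 2 * Real.exp (-V x))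
        - ε ^ 3 * C₂ * Real.exp (-V x)) := by
      rw [integral_sub, integral_add, integral_sub]
      · simp only [integral_const_mul, hmean, ← hZ, ← hS]
        ring
      all_goals fun_prop
    rw [this]
    refine integral_mono (by fun_prop) iG fun x => ?_
    have a1 := one_add_add_sq_sub_le_exp (((hgC x).trans
      ((mul_le_mul_of_nonneg_left hMC₁ hε.le).trans h2)))
    have a2 : |-(ε * g x)| ^ 3 ≤ ε ^ 3 * C₂ := by
      refine (pow_le_pow_left₀ (abs_nonneg _) (hgC x) 3).trans ?_
      rw [mul_pow]
      gcongr
    have a4 : 1 - ε * g x + ε ^ 2 / 2 * g x ^ 2 - ε ^ 3 * C₂ ≤ Real.exp (-(ε * g x)) := by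
      linarith
    have := mul_le_mul_of_nonneg_right a4 (Real.exp_pos (-V x)).le
    simp only
    linarith
  · have main := integral_exp_mul_integral_exp_le (F := F) (G := fun x => -(ε * g x)) hK hKc hV
      hVmid hFm (by fun_prop) (fun x y => sub_sq_div_add_neg_le hε hl' (hM x y) (by
        rw [dist_comm, dist_eq_norm]
        exact (abs_le.1 (abs_real_inner_le_norm (p x) (y - x))).1))
    rw [← ofReal_integral_eq_lintegral_ofReal iF (ae_of_all _ fun x => by positivity),
      ← ofReal_integral_eq_lintegral_ofReal iG (ae_of_all _ fun x => by positivity),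
      ← ofReal_integral_eq_lintegral_ofReal hint (ae_of_all _ fun x => by positivity),
      ← ENNReal.ofReal_mul (integral_nonneg fun x => by positivity),
      ← ENNReal.ofReal_pow hpos.le] at main
    exact (ENNReal.ofReal_le_ofReal_iff (by positivity)).1 main

end LogConcave

/-- The Poincaré inequality on a bounded convex set, from a strongly convex potential of small
oscillation. -/
theorem exists_integral_sub_sq_le_of_potential {d : ℕ} {K : Set (E d)} (hK : MeasurableSet K)
    (hKc : Convex ℝ K) (hKfin : volume K ≠ ⊤) (hK0 : volume K ≠ 0) {D : ℝ} (hD : 0 < D)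
    {U : E d → ℝ} (hU : Measurable U) {u₀ : ℝ} (hU₀ : ∀ x ∈ K, u₀ ≤ U x)
    (hU₁ : ∀ x ∈ K, U x ≤ u₀ + D ^ 2 / 2)
    (hUmid : ∀ x ∈ K, ∀ y ∈ K, U (midpoint ℝ x y) ≤ (U x + U y) / 2 - dist x y ^ 2 / 4)
    {g : E d → ℝ} {p : E d → E d} (hg : Measurable g) (hp : Measurable p) {M : ℝ}
    (hgM : ∀ x, |g x| ≤ M) (hpM : ∀ x, ‖p x‖ ≤ M)
    (hM : ∀ x y, |g y - g x - inner ℝ (p x) (y - x)| ≤ M * dist x y ^ 2) :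
    ∃ c : ℝ, ∫ x in K, (g x - c) ^ 2 ≤ D ^ 2 * ∫ x in K, ‖p x‖ ^ 2 := by
  have hM0 : 0 ≤ M := (abs_nonneg _).trans (hgM 0)
  have : IsFiniteMeasure (volume.restrict K) := ⟨by simpa using hKfin.lt_top⟩
  -- Rescaling makes V range over [0, 1] on K and gives it the convexity modulus 4/D².
  set V : E d → ℝ := fun x => 2 / D ^ 2 * (U x - u₀) with hVdef
  have hV : Measurable V := by fun_prop
  have hV0 : ∀ x ∈ K, 0 ≤ V x := fun x hx =>
    mul_nonneg (by positivity) (sub_nonneg.2 (hU₀ x hx))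
  have hV1 : ∀ x ∈ K, V x ≤ 1 := fun x hx => by
    have := hU₁ x hx
    rw [hVdef]
    simp only
    rw [div_mul_eq_mul_div, div_le_one (by positivity)]
    linarith
  have hVmid : ∀ x ∈ K, ∀ y ∈ K,
      V (midpoint ℝ x y) ≤ (V x + V y) / 2 - 4 / D ^ 2 * dist x y ^ 2 / 8 := fun x hx y hy => by
    have := mul_le_mul_of_nonneg_left (hUmid x hx y hy) (by positivity : 0 ≤ 2 / D ^ 2)
    rw [hVdef]
    simp only
    have e : 4 / D ^ 2 * dist x y ^ 2 / 8 = 2 / D ^ 2 * (dist x y ^ 2 / 4) := by ring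
    rw [e]
    linarith
  have bint : ∀ (u : E d → ℝ), Measurable u → ∀ C : ℝ, (∀ x ∈ K, |u x| ≤ C) →
      Integrable u (volume.restrict K) := by
    intro u hu C hC
    exact Integrable.of_bound hu.aestronglyMeasurable C ((ae_restrict_iff' hK).2 (ae_of_all _ hC))
  have hexp : ∀ x ∈ K, Real.exp (-V x) ≤ 1 := fun x hx =>
    Real.exp_le_one_iff.2 (neg_nonpos.2 (hV0 x hx))
  have hexp' : ∀ x ∈ K, Real.exp (-1) ≤ Real.exp (-V x) := fun x hx =>
    Real.exp_le_exp.2 (neg_le_neg (hV1 x hx))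
  have bint' : ∀ (u : E d → ℝ), Measurable u → ∀ C : ℝ, (∀ x ∈ K, |u x| ≤ C) →
      Integrable (fun x => u x * Real.exp (-V x)) (volume.restrict K) := by
    intro u hu C hC
    refine bint _ (by fun_prop) C fun x hx => ?_
    rw [abs_mul, abs_of_pos (Real.exp_pos _)]
    exact (mul_le_of_le_one_right (abs_nonneg _) (hexp x hx)).trans (hC x hx)
  have iE : Integrable (fun x => Real.exp (-V x)) (volume.restrict K) := by
    simpa using bint' (fun _ => 1) measurable_const 1 (by simp)
  have hZ : 0 < ∫ x in K, Real.exp (-V x) := by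
    refine lt_of_lt_of_le ?_ (setIntegral_mono_on (f := fun _ => Real.exp (-1))
      (integrable_const _) iE hK hexp')
    simp only [integral_const, smul_eq_mul, measureReal_restrict_apply_univ]
    exact mul_pos (ENNReal.toReal_pos hK0 hKfin) (Real.exp_pos _)
  have ig := bint' g hg M fun x _ => hgM x
  set c := (∫ x in K, g x * Real.exp (-V x)) / ∫ x in K, Real.exp (-V x) with hc
  refine ⟨c, ?_⟩
  have hgc : ∀ x, |g x - c| ≤ M + |c| := fun x =>
    (abs_sub _ _).trans (add_le_add_left (hgM x) _)
  have hpM' : ∀ x, ‖p x‖ ≤ M + |c| := fun x => (hpM x).trans (by simp)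
  have key := mul_integral_sq_le_of_logConcave (lam := 4 / D ^ 2) hK hKc hV (by positivity) hVmid
    iE hZ (g := fun x => g x - c) (p := p) (by fun_prop) hp (M := M + |c|) hgc hpM'
    (fun x y => by
      rw [sub_sub_sub_cancel_right]
      refine (hM x y).trans (mul_le_mul_of_nonneg_right (by simp) (by positivity)))
    (by
      simp only [sub_mul]
      rw [integral_sub ig (iE.const_mul c), integral_const_mul, hc, div_mul_cancel₀ _ hZ.ne',
        sub_self])
  have l1 : Real.exp (-1) * ∫ x in K, (g x - c) ^ 2 ≤ ∫ x in K, (g x - c) ^ 2 * Real.exp (-V x) := by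
    rw [← integral_const_mul]
    have b : ∀ x ∈ K, |(g x - c) ^ 2| ≤ (M + |c|) ^ 2 := fun x _ => by
      rw [abs_pow]; exact pow_le_pow_left₀ (abs_nonneg _) (hgc x) 2
    refine setIntegral_mono_on ((bint _ (by fun_prop) _ b).const_mul _)
      (bint' _ (by fun_prop) _ b) hK fun x hx => ?_
    rw [mul_comm]
    exact mul_le_mul_of_nonneg_left (hexp' x hx) (sq_nonneg _)
  have l2 : ∫ x in K, ‖p x‖ ^ 2 * Real.exp (-V x) ≤ ∫ x in K, ‖p x‖ ^ 2 := by
    have b : ∀ x ∈ K, |‖p x‖ ^ 2| ≤ M ^ 2 := fun x _ => by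
      rw [abs_pow, abs_norm]; exact pow_le_pow_left₀ (norm_nonneg _) (hpM x) 2
    refine setIntegral_mono_on (bint' _ (by fun_prop) _ b) (bint _ (by fun_prop) _ b) hK
      fun x hx => mul_le_of_le_one_right (sq_nonneg _) (hexp x hx)
  -- Replacing the weight by Lebesgue measure costs a factor e, which is absorbed by the 4 in the
  -- spectral gap 4/D².
  have l3 : 1 / 4 ≤ Real.exp (-1) := by
    rw [Real.exp_neg, one_div]
    exact inv_anti₀ (Real.exp_pos _) (Real.exp_one_lt_d9.le.trans (by norm_num))
  have l4 : 0 ≤ ∫ x in K, (g x - c) ^ 2 := integral_nonneg fun x => sq_nonneg _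
  have l5 : 4 / D ^ 2 * (1 / 4 * ∫ x in K, (g x - c) ^ 2) ≤ ∫ x in K, ‖p x‖ ^ 2 :=
    (mul_le_mul_of_nonneg_left ((mul_le_mul_of_nonneg_right l3 l4).trans l1)
      (by positivity)).trans (key.trans l2)
  have l6 : 4 / D ^ 2 * (1 / 4 * ∫ x in K, (g x - c) ^ 2) = (∫ x in K, (g x - c) ^ 2) / D ^ 2 := by
    ring
  rw [l6, div_le_iff₀ (by positivity)] at l5
  linarith

theorem dist_midpoint_sq {d : ℕ} (x y z : E d) :
    dist (midpoint ℝ x y) z ^ 2 = (dist x z ^ 2 + dist y z ^ 2) / 2 - dist x y ^ 2 / 4 := by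
  have h := parallelogram_law_with_norm ℝ (x - z) (y - z)
  have e1 : midpoint ℝ x y - z = (2⁻¹ : ℝ) • ((x - z) + (y - z)) := by
    rw [midpoint_eq_smul_add]
    simp only [invOf_eq_inv]
    module
  rw [dist_eq_norm, e1, norm_smul, mul_pow, dist_eq_norm, dist_eq_norm, dist_eq_norm]
  have e2 : x - z - (y - z) = x - y := by abel
  rw [e2] at h
  norm_num
  linarith

/-- The Poincaré inequality on a bounded convex set, with a constant independent of the
dimension. -/
theorem exists_integral_sub_sq_le_of_convex {d : ℕ} {K : Set (E d)} (hK : MeasurableSet K)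
    (hKc : Convex ℝ K) (hK0 : volume K ≠ 0) {D : ℝ} (hD : 0 < D)
    (hKD : ∀ x ∈ K, ∀ y ∈ K, dist x y ≤ D)
    {g : E d → ℝ} {p : E d → E d} (hg : Measurable g) (hp : Measurable p) {M : ℝ}
    (hgM : ∀ x, |g x| ≤ M) (hpM : ∀ x, ‖p x‖ ≤ M)
    (hM : ∀ x y, |g y - g x - inner ℝ (p x) (y - x)| ≤ M * dist x y ^ 2) :
    ∃ c : ℝ, ∫ x in K, (g x - c) ^ 2 ≤ D ^ 2 * ∫ x in K, ‖p x‖ ^ 2 := by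
  obtain ⟨a, ha⟩ : K.Nonempty := Set.nonempty_iff_ne_empty.2 fun h => hK0 (by simp [h])
  have hKfin : volume K ≠ ⊤ := by
    refine ne_top_of_le_ne_top ?_ (volume_le_volume_closedBall_of_dist_le hK hKD)
    exact measure_closedBall_lt_top.ne
  -- A strongly convex potential of oscillation at most D²/2 exists either way. If some c in K is
  -- within D/√2 of all of K, the squared distance to c has values in [0, D²/2]. Otherwise every
  -- point of K has another point of K farther than D/√2, and the largest squared distance to points
  -- of K has values in [D²/2, D²].
  by_cases hcase : ∃ c ∈ K, ∀ x ∈ K, dist x c ^ 2 ≤ D ^ 2 / 2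
  · obtain ⟨c, -, hc⟩ := hcase
    exact exists_integral_sub_sq_le_of_potential hK hKc hKfin hK0 hD (U := fun x => dist x c ^ 2)
      (u₀ := 0) (by fun_prop) (fun x _ => by positivity) (fun x hx => by simpa using hc x hx)
      (fun x _ y _ => (dist_midpoint_sq x y c).le) hg hp hgM hpM hM
  · push Not at hcase
    have hne : Nonempty K := ⟨⟨a, ha⟩⟩
    have bdd : ∀ x : E d, BddAbove (Set.range fun z : K => dist x z ^ 2) := fun x => by
      refine ⟨(dist x a + D) ^ 2, ?_⟩
      rintro _ ⟨z, rfl⟩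
      refine pow_le_pow_left₀ dist_nonneg ((dist_triangle x a z).trans ?_) 2
      exact add_le_add_right (hKD a ha z z.2) _
    refine exists_integral_sub_sq_le_of_potential hK hKc hKfin hK0 hD
      (U := fun x => ⨆ z : K, dist x z ^ 2) (u₀ := D ^ 2 / 2) ?_ ?_ ?_ ?_ hg hp hgM hpM hM
    · refine LowerSemicontinuous.measurable (lowerSemicontinuous_ciSup bdd fun z => ?_)
      exact Continuous.lowerSemicontinuous (by fun_prop)
    · intro x hx
      obtain ⟨z, hz, hxz⟩ := hcase x hx
      rw [dist_comm] at hxz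
      exact hxz.le.trans (le_ciSup (bdd x) ⟨z, hz⟩)
    · intro x hx
      refine ciSup_le fun z => ?_
      rw [add_halves]
      exact pow_le_pow_left₀ dist_nonneg (hKD x hx z z.2) 2
    · intro x hx y hy
      refine ciSup_le fun z => ?_
      rw [dist_midpoint_sq]
      have h1 := le_ciSup (bdd x) z
      have h2 := le_ciSup (bdd y) z
      linarith

/-- The Poincaré inequality on a bounded convex set, without the mean value. -/
theorem integral_sq_sub_sq_integral_le_of_convex {d : ℕ} {K : Set (E d)} (hK : MeasurableSet K)
    (hKc : Convex ℝ K) {D : ℝ} (hD : 0 < D)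
    (hKD : ∀ x ∈ K, ∀ y ∈ K, dist x y ≤ D)
    {g : E d → ℝ} {p : E d → E d} (hg : Measurable g) (hp : Measurable p) {M : ℝ}
    (hgM : ∀ x, |g x| ≤ M) (hpM : ∀ x, ‖p x‖ ≤ M)
    (hM : ∀ x y, |g y - g x - inner ℝ (p x) (y - x)| ≤ M * dist x y ^ 2) :
    volume.real K * (∫ x in K, g x ^ 2) - (∫ x in K, g x) ^ 2 ≤
      volume.real K * (D ^ 2 * ∫ x in K, ‖p x‖ ^ 2) := by
  by_cases hK0 : volume K = 0
  · simp [Measure.restrict_eq_zero.2 hK0, measureReal_def, hK0]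
  obtain ⟨c, hc⟩ := exists_integral_sub_sq_le_of_convex hK hKc hK0 hD hKD hg hp hgM hpM hM
  have hKfin : volume K ≠ ⊤ := by
    refine ne_top_of_le_ne_top ?_ (volume_le_volume_closedBall_of_dist_le hK hKD)
    exact measure_closedBall_lt_top.ne
  have : IsFiniteMeasure (volume.restrict K) := ⟨by simpa using hKfin.lt_top⟩
  have i1 : Integrable g (volume.restrict K) :=
    Integrable.of_bound hg.aestronglyMeasurable M (ae_of_all _ hgM)
  have i2 : Integrable (fun x => g x ^ 2) (volume.restrict K) :=
    Integrable.of_bound (by fun_prop) (M ^ 2) (ae_of_all _ fun x => by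
      rw [Real.norm_eq_abs, abs_pow]; exact pow_le_pow_left₀ (abs_nonneg _) (hgM x) 2)
  have e : ∫ x in K, (g x - c) ^ 2 = (∫ x in K, g x ^ 2) - 2 * c * (∫ x in K, g x)
      + c ^ 2 * volume.real K := by
    have : ∀ x, (g x - c) ^ 2 = g x ^ 2 - 2 * c * g x + c ^ 2 := fun x => by ring
    simp only [this]
    rw [integral_add (by fun_prop) (by fun_prop), integral_sub (by fun_prop) (by fun_prop),
      integral_const_mul]
    simp [mul_comm]
  have := mul_le_mul_of_nonneg_left hc (measureReal_nonneg (μ := volume) (s := K))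
  rw [e] at this
  -- Completing the square in c shows that |K|∫g² - (∫g)² is at most |K|∫(g - c)² for every c.
  nlinarith [sq_nonneg (c * volume.real K - ∫ x in K, g x)]

/-- A smooth function with compact support is bounded together with its gradient, and has a
first order Taylor expansion with a uniform quadratic remainder. -/
theorem exists_taylor_bound {d : ℕ} {φ : E d → ℝ} (hφ : ContDiff ℝ ∞ φ)
    (hc : HasCompactSupport φ) : ∃ M, (∀ x, |φ x| ≤ M) ∧ (∀ x, ‖gradient φ x‖ ≤ M) ∧
      ∀ x y, |φ y - φ x - inner ℝ (gradient φ x) (y - x)| ≤ M * dist x y ^ 2 := by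
  obtain ⟨M₁, h₁⟩ := hφ.continuous.bounded_above_of_compact_support hc
  have hdc : HasCompactSupport (fderiv ℝ φ) := hc.fderiv ℝ
  have hd : ContDiff ℝ ∞ (fderiv ℝ φ) := hφ.fderiv_right (by simp)
  obtain ⟨M₂, h₂⟩ := hd.continuous.bounded_above_of_compact_support hdc
  obtain ⟨M₃, h₃⟩ := ContDiff.lipschitzWith_of_hasCompactSupport hdc hd (by simp)
  have gn : ∀ x, ‖gradient φ x‖ = ‖fderiv ℝ φ x‖ := fun x => by simp [gradient]
  refine ⟨max (max M₁ M₂) M₃, fun x => ?_, fun x => ?_, fun x y => ?_⟩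
  · exact (h₁ x).trans ((le_max_left _ _).trans (le_max_left _ _))
  · rw [gn]; exact (h₂ x).trans ((le_max_right _ _).trans (le_max_left _ _))
  · have e : inner ℝ (gradient φ x) (y - x) = fderiv ℝ φ x (y - x) := by simp [gradient]
    rw [e]
    have := (convex_segment (𝕜 := ℝ) x y).norm_image_sub_le_of_norm_fderiv_le' (f := φ)
      (φ := fderiv ℝ φ x) (C := M₃ * dist x y) (x := x) (y := y)
      (fun z _ => hφ.differentiable (by simp) z) (fun z hz => by
        rw [← dist_eq_norm]
        refine (h₃.dist_le_mul z x).trans ?_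
        gcongr
        rw [dist_comm z x, dist_eq_norm' x z, dist_eq_norm' x y]
        exact norm_sub_le_of_mem_segment hz) (left_mem_segment ℝ x y)
      (right_mem_segment ℝ x y)
    refine this.trans ?_
    rw [dist_comm x y, ← dist_eq_norm, mul_assoc, ← sq]
    gcongr
    exact le_max_right _ _


/-! ### Analysis in `H¹₀(Ω)` -/

theorem integrable_norm_sq {α : Type*} [MeasurableSpace α] {μ : Measure α} {F : Type*}
    [NormedAddCommGroup F] (f : Lp F 2 μ) : Integrable (fun x => ‖f x‖ ^ 2) μ :=
  (Lp.memLp f).integrable_norm_pow (by norm_num)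

section L2

variable {α : Type*} [MeasurableSpace α] {μ : Measure α} {F : Type*} [NormedAddCommGroup F]
  [InnerProductSpace ℝ F]

theorem norm_sq_eq_integral (f : Lp F 2 μ) : ‖f‖ ^ 2 = ∫ x, ‖f x‖ ^ 2 ∂μ := by
  rw [← real_inner_self_eq_norm_sq, L2.inner_def]
  simp only [real_inner_self_eq_norm_sq]

theorem continuous_setIntegral_norm_sq (K : Set α) :
    Continuous fun f : Lp F 2 μ => ∫ x in K, ‖f x‖ ^ 2 ∂μ := by
  have : (fun f : Lp F 2 μ => ∫ x in K, ‖f x‖ ^ 2 ∂μ)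
      = fun f => ‖LpToLpRestrictCLM α F ℝ μ 2 K f‖ ^ 2 := by
    funext f
    rw [norm_sq_eq_integral]
    refine integral_congr_ae ?_
    filter_upwards [LpToLpRestrictCLM_coeFn ℝ K f] with x hx
    rw [hx]
  rw [this]
  fun_prop

end L2

section Test

variable {d : ℕ} {Ω : Set (E d)}

theorem IsTest.differentiable {φ : E d → ℝ} (h : IsTest Ω φ) : Differentiable ℝ φ :=
  h.1.differentiable (by simp)

theorem IsTest.add {φ ψ : E d → ℝ} (h : IsTest Ω φ) (h' : IsTest Ω ψ) : IsTest Ω (φ + ψ) :=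
  ⟨h.1.add h'.1, h.2.1.add h'.2.1, (tsupport_add φ ψ).trans (Set.union_subset h.2.2 h'.2.2)⟩

theorem IsTest.smul {φ : E d → ℝ} (h : IsTest Ω φ) (c : ℝ) : IsTest Ω (c • φ) :=
  ⟨h.1.const_smul c, h.2.1.smul_left (f := fun _ => c),
    (tsupport_smul_subset_right (fun _ => c) φ).trans h.2.2⟩

theorem isTest_zero : IsTest Ω (0 : E d → ℝ) :=
  ⟨contDiff_const, HasCompactSupport.zero, by simp [tsupport]⟩

theorem continuous_gradient {φ : E d → ℝ} (h : ContDiff ℝ ∞ φ) : Continuous (gradient φ) :=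
  (InnerProductSpace.toDual ℝ (E d)).symm.continuous.comp (h.continuous_fderiv (by simp))

theorem hasCompactSupport_gradient {φ : E d → ℝ} (h : HasCompactSupport φ) :
    HasCompactSupport (gradient φ) :=
  (h.fderiv ℝ).comp_left (g := (InnerProductSpace.toDual ℝ (E d)).symm) (map_zero _)

theorem IsTest.eq_zero {φ : E d → ℝ} (h : IsTest Ω φ) {x : E d} (hx : x ∉ Ω) : φ x = 0 :=
  image_eq_zero_of_notMem_tsupport fun h' => hx (h.2.2 h')

theorem IsTest.gradient_eq_zero {φ : E d → ℝ} (h : IsTest Ω φ) {x : E d} (hx : x ∉ Ω) :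
    gradient φ x = 0 := by
  have : fderiv ℝ φ x = 0 := image_eq_zero_of_notMem_tsupport (f := fderiv ℝ φ) fun h' =>
    hx (h.2.2 (tsupport_fderiv_subset ℝ h'))
  simp [gradient, this]

theorem gradient_add_apply {φ ψ : E d → ℝ} {x : E d} (h : DifferentiableAt ℝ φ x)
    (h' : DifferentiableAt ℝ ψ x) : gradient (φ + ψ) x = gradient φ x + gradient ψ x := by
  simp [gradient, fderiv_add h h']

theorem gradient_smul_apply {φ : E d → ℝ} {x : E d} (h : DifferentiableAt ℝ φ x) (c : ℝ) :
    gradient (c • φ) x = c • gradient φ x := by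
  simp [gradient, fderiv_const_smul h]

/-- A test function together with its gradient. -/
theorem IsTest.exists_pair {φ : E d → ℝ} (h : IsTest Ω φ) : ∃ p : L2Pair Ω,
    p.fst =ᵐ[volume.restrict Ω] φ ∧ p.snd =ᵐ[volume.restrict Ω] fun x => gradient φ x := by
  have h1 : MemLp φ 2 (volume.restrict Ω) := h.1.continuous.memLp_of_hasCompactSupport h.2.1
  have h2 : MemLp (gradient φ) 2 (volume.restrict Ω) :=
    (continuous_gradient h.1).memLp_of_hasCompactSupport (hasCompactSupport_gradient h.2.1)
  exact ⟨WithLp.toLp 2 (h1.toLp φ, h2.toLp (gradient φ)), h1.coeFn_toLp, h2.coeFn_toLp⟩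

theorem IsTest.exists_H10 {φ : E d → ℝ} (h : IsTest Ω φ) : ∃ u : H10 Ω,
    valFn u =ᵐ[volume.restrict Ω] φ ∧ gradFn u =ᵐ[volume.restrict Ω] gradient φ := by
  obtain ⟨p, h1, h2⟩ := h.exists_pair
  exact ⟨⟨p, Submodule.le_topologicalClosure _ (Submodule.subset_span ⟨φ, h, h1, h2⟩)⟩, h1, h2⟩

/-- A closed property of the test functions holds on `H¹₀(Ω)`. -/
theorem H10_induction {P : L2Pair Ω → Prop} (hP : IsClosed {p | P p})
    (h : ∀ p φ, IsTest Ω φ → p.fst =ᵐ[volume.restrict Ω] φ →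
      p.snd =ᵐ[volume.restrict Ω] gradient φ → P p) (u : H10 Ω) : P u.1 := by
  refine hP.closure_subset_iff.2 (fun p hp => ?_) u.2
  suffices ∃ φ, IsTest Ω φ ∧ p.fst =ᵐ[volume.restrict Ω] φ ∧
      p.snd =ᵐ[volume.restrict Ω] gradient φ by
    obtain ⟨φ, h1, h2, h3⟩ := this
    exact h p φ h1 h2 h3
  -- The pairs (φ, ∇φ) already form a linear subspace, so the span contains nothing else.
  refine Submodule.span_induction (fun p hp => hp) ?_ ?_ ?_ hp
  · exact ⟨0, isTest_zero, Lp.coeFn_zero _ _ _, by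
      have : gradient (0 : E d → ℝ) = 0 := by
        funext x; simp only [gradient, fderiv_zero, Pi.zero_apply, map_zero]
      rw [this]; exact Lp.coeFn_zero _ _ _⟩
  · rintro p q - - ⟨φ, h1, h2, h3⟩ ⟨ψ, k1, k2, k3⟩
    refine ⟨φ + ψ, h1.add k1, (Lp.coeFn_add _ _).trans (h2.add k2),
      (Lp.coeFn_add _ _).trans ((h3.add k3).trans (ae_of_all _ fun x => ?_))⟩
    exact (gradient_add_apply (h1.differentiable x) (k1.differentiable x)).symm
  · rintro c p - ⟨φ, h1, h2, h3⟩
    refine ⟨c • φ, h1.smul c, (Lp.coeFn_smul _ _).trans (h2.const_smul c),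
      (Lp.coeFn_smul _ _).trans ((h3.const_smul c).trans (ae_of_all _ fun x => ?_))⟩
    exact (gradient_smul_apply (h1.differentiable x) c).symm


/-- Integration by parts of φ² against the affine function L - c, whose derivative along v is 1.
This identity is the source of Friedrichs' inequality. -/
theorem integral_sq_eq_of_linear {φ : E d → ℝ} (h : ContDiff ℝ ∞ φ) (hs : HasCompactSupport φ)
    (L : E d →L[ℝ] ℝ) {v : E d} (hL : L v = 1) (c : ℝ) :
    ∫ x, φ x ^ 2 = ∫ x, -((L x - c) * (2 * φ x * fderiv ℝ φ x v)) := by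
  have hL' : ∀ x, HasFDerivAt (fun x : E d => L x - c) L x := fun x => L.hasFDerivAt.sub_const c
  have hLv : ∀ x, fderiv ℝ (fun x : E d => L x - c) x v = 1 := fun x => by rw [(hL' x).fderiv, hL]
  have hg : ∀ x, HasFDerivAt (fun x => φ x ^ 2) ((2 * φ x) • fderiv ℝ φ x) x := fun x => by
    simpa using (h.differentiable (by simp) x).hasFDerivAt.pow 2
  have hgv : ∀ x, fderiv ℝ (fun x => φ x ^ 2) x v = 2 * φ x * fderiv ℝ φ x v := fun x => by
    rw [(hg x).fderiv]; rfl
  have cφ := h.continuous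
  have cdφ : Continuous fun x => fderiv ℝ φ x v :=
    (h.continuous_fderiv (by simp)).clm_apply continuous_const
  have sq : HasCompactSupport fun x => φ x ^ 2 := hs.comp_left (g := fun t : ℝ => t ^ 2) (by simp)
  have key := integral_mul_fderiv_eq_neg_fderiv_mul_of_integrable (μ := (volume : Measure (E d)))
    (f := fun x : E d => L x - c) (g := fun x => φ x ^ 2) (v := v) ?_ ?_ ?_
    (fun x _ => (hL' x).differentiableAt) (fun x _ => (hg x).differentiableAt)
  · simp only [hLv, hgv, one_mul] at key
    rw [integral_neg, key, neg_neg]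
  · simp only [hLv, one_mul]
    exact (cφ.pow 2).integrable_of_hasCompactSupport sq
  · simp only [hgv]
    refine Continuous.integrable_of_hasCompactSupport (by fun_prop) ?_
    exact HasCompactSupport.mul_left ((hs.mul_left (f := fun _ => (2 : ℝ))).mul_right)
  · exact Continuous.integrable_of_hasCompactSupport (by fun_prop) sq.mul_left

theorem exists_abs_coord_sub_le (hb : Bornology.IsBounded Ω) (hdiam : Metric.diam Ω ≤ 1)
    (i : Fin d) : ∃ c : ℝ, ∀ x ∈ Ω, |x i - c| ≤ 1 / 2 := by
  rcases Ω.eq_empty_or_nonempty with rfl | hne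
  · exact ⟨0, by simp⟩
  have hbd : ∀ x ∈ Ω, ∀ y ∈ Ω, x i ≤ y i + 1 := fun x hx y hy => by
    have h1 := (Metric.dist_le_diam_of_mem hb hx hy).trans hdiam
    have h2 : |x i - y i| ≤ dist x y := by
      rw [dist_eq_norm]; exact PiLp.norm_apply_le (x - y) i
    linarith [(abs_le.1 (h2.trans h1)).2]
  set S := (fun x : E d => x i) '' Ω with hS
  have hSne : S.Nonempty := hne.image _
  have hSb : BddBelow S := by
    obtain ⟨y, hy⟩ := hne
    exact ⟨y i - 1, by rintro _ ⟨x, hx, rfl⟩; linarith [hbd y hy x hx]⟩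
  refine ⟨sInf S + 1 / 2, fun x hx => ?_⟩
  have h1 : sInf S ≤ x i := csInf_le hSb ⟨x, hx, rfl⟩
  have h2 : x i - 1 ≤ sInf S := le_csInf hSne (by
    rintro _ ⟨y, hy, rfl⟩
    have := hbd x hx y hy
    simp only
    linarith)
  rw [abs_le]
  constructor <;> linarith

/-- The bound |φ||∇φ| ≤ (φ² + |∇φ|²)/2. After integration the half of φ² is absorbed on the other
side, which leaves Friedrichs' inequality with constant 1. -/
theorem neg_mul_fderiv_le {φ : E d → ℝ} {x v : E d} {s : ℝ} (hv : ‖v‖ ≤ 1) (hs : |s| ≤ 1 / 2) :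
    -(s * (2 * φ x * fderiv ℝ φ x v)) ≤ (φ x ^ 2 + ‖gradient φ x‖ ^ 2) / 2 := by
  have a1 : |fderiv ℝ φ x v| ≤ ‖gradient φ x‖ := by
    have e : ‖gradient φ x‖ = ‖fderiv ℝ φ x‖ := by simp [gradient]
    rw [e]
    exact (fderiv ℝ φ x).le_of_opNorm_le_of_le le_rfl hv |>.trans (by simp)
  have a2 : |s * (2 * φ x * fderiv ℝ φ x v)| ≤ 1 / 2 * (2 * |φ x| * ‖gradient φ x‖) := by
    rw [abs_mul, abs_mul, abs_mul, abs_two]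
    exact mul_le_mul hs (mul_le_mul_of_nonneg_left a1 (by positivity)) (by positivity) (by norm_num)
  refine (neg_le_abs _).trans (a2.trans ?_)
  nlinarith [sq_nonneg (|φ x| - ‖gradient φ x‖), sq_abs (φ x)]

/-- Friedrichs' inequality for test functions on a domain between two parallel hyperplanes. -/
theorem IsTest.integral_sq_le_of_linear (L : E d →L[ℝ] ℝ) {v : E d} (hv : ‖v‖ ≤ 1) (hL : L v = 1)
    {c : ℝ} (hc : ∀ x ∈ Ω, |L x - c| ≤ 1 / 2) {φ : E d → ℝ} (h : IsTest Ω φ) :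
    ∫ x in Ω, φ x ^ 2 ≤ ∫ x in Ω, ‖gradient φ x‖ ^ 2 := by
  have key := integral_sq_eq_of_linear h.1 h.2.1 L hL c
  have s1 : HasCompactSupport fun x => φ x ^ 2 :=
    h.2.1.comp_left (g := fun t : ℝ => t ^ 2) (by simp)
  have s2 : HasCompactSupport fun x => ‖gradient φ x‖ ^ 2 :=
    (hasCompactSupport_gradient h.2.1).comp_left (g := fun t : E d => ‖t‖ ^ 2) (by simp)
  have i1 : Integrable (fun x => φ x ^ 2) :=
    (h.1.continuous.pow 2).integrable_of_hasCompactSupport s1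
  have i2 : Integrable (fun x => ‖gradient φ x‖ ^ 2) :=
    ((continuous_gradient h.1).norm.pow 2).integrable_of_hasCompactSupport s2
  have e1 : ∫ x in Ω, φ x ^ 2 = ∫ x, φ x ^ 2 :=
    setIntegral_eq_integral_of_forall_compl_eq_zero fun x hx => by simp [h.eq_zero hx]
  have e2 : ∫ x in Ω, ‖gradient φ x‖ ^ 2 = ∫ x, ‖gradient φ x‖ ^ 2 :=
    setIntegral_eq_integral_of_forall_compl_eq_zero fun x hx => by simp [h.gradient_eq_zero hx]
  rw [e1, e2]
  have hle : ∫ x, φ x ^ 2 ≤ ∫ x, (φ x ^ 2 + ‖gradient φ x‖ ^ 2) / 2 := by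
    nth_rewrite 1 [key]
    -- A non-integrable function has integral 0 by convention, so that case is trivial and
    -- integrability need not be shown.
    by_cases hi : Integrable fun x : E d => -((L x - c) * (2 * φ x * fderiv ℝ φ x v))
    · refine integral_mono hi ((i1.add i2).div_const 2) fun x => ?_
      by_cases hx : x ∈ Ω
      · exact neg_mul_fderiv_le hv (hc x hx)
      · simp only [h.eq_zero hx, mul_zero, zero_mul, neg_zero]
        positivity
    · rw [integral_undef hi]
      positivity
  rw [integral_div, integral_add i1 i2] at hle
  linarith

/-- Friedrichs' inequality for test functions. -/
theorem IsTest.integral_sq_le (i : Fin d) (hb : Bornology.IsBounded Ω)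
    (hdiam : Metric.diam Ω ≤ 1) {φ : E d → ℝ} (h : IsTest Ω φ) :
    ∫ x in Ω, φ x ^ 2 ≤ ∫ x in Ω, ‖gradient φ x‖ ^ 2 := by
  obtain ⟨c, hc⟩ := exists_abs_coord_sub_le hb hdiam i
  exact h.integral_sq_le_of_linear (EuclideanSpace.proj i) (v := EuclideanSpace.single i 1)
    (by simp) (by simp) hc

/-- Friedrichs' inequality on `H¹₀(Ω)`. -/
theorem norm_fst_le_norm_snd (hd : 1 ≤ d) (hb : Bornology.IsBounded Ω)
    (hdiam : Metric.diam Ω ≤ 1) (u : H10 Ω) : ‖u.1.fst‖ ≤ ‖u.1.snd‖ := by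
  refine H10_induction (P := fun p => ‖p.fst‖ ≤ ‖p.snd‖) (isClosed_le
    (WithLp.continuous_fst ..).norm (WithLp.continuous_snd ..).norm) (fun p φ h h1 h2 => ?_) u
  refine (sq_le_sq₀ (norm_nonneg _) (norm_nonneg _)).1 ?_
  have e1 : ‖p.fst‖ ^ 2 = ∫ x in Ω, φ x ^ 2 := by
    refine (norm_sq_eq_integral _).trans (integral_congr_ae ?_)
    filter_upwards [h1] with x hx
    rw [hx, Real.norm_eq_abs, sq_abs]
  have e2 : ‖p.snd‖ ^ 2 = ∫ x in Ω, ‖gradient φ x‖ ^ 2 := by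
    refine (norm_sq_eq_integral _).trans (integral_congr_ae ?_)
    filter_upwards [h2] with x hx
    rw [hx]
  rw [e1, e2]
  exact h.integral_sq_le ⟨0, hd⟩ hb hdiam

/-- The Poincaré inequality on a convex subset of `Ω`, for functions in `H¹₀(Ω)`. -/
theorem setIntegral_sq_le_of_integral_eq_zero {K : Set (E d)} (hK : MeasurableSet K) (hKΩ : K ⊆ Ω)
    (hKc : Convex ℝ K) (hK0 : volume K ≠ 0) {D : ℝ} (hD : 0 < D)
    (hKD : ∀ x ∈ K, ∀ y ∈ K, dist x y ≤ D) (u : H10 Ω) (hu : ∫ x in K, valFn u x = 0) :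
    ∫ x in K, ‖valFn u x‖ ^ 2 ≤ D ^ 2 * ∫ x in K, ‖gradFn u x‖ ^ 2 := by
  have hr : (volume.restrict Ω).restrict K = volume.restrict K :=
    Measure.restrict_restrict_of_subset hKΩ
  have hKfin : volume K ≠ ⊤ := by
    refine ne_top_of_le_ne_top ?_ (volume_le_volume_closedBall_of_dist_le hK hKD)
    exact measure_closedBall_lt_top.ne
  have hKfin' : (volume.restrict Ω) K ≠ ⊤ :=
    ne_top_of_le_ne_top hKfin (Measure.restrict_apply_le _ _)
  -- In the form |K|∫u² - (∫u)² no mean value has to be chosen and both sides are continuous in the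
  -- H¹ norm. The inequality therefore passes from test functions to their closure.
  have key := H10_induction (Ω := Ω) (P := fun p => volume.real K *
    (∫ x in K, ‖p.fst x‖ ^ 2 ∂(volume.restrict Ω)) - (∫ x in K, p.fst x ∂(volume.restrict Ω)) ^ 2 ≤
      volume.real K * (D ^ 2 * ∫ x in K, ‖p.snd x‖ ^ 2 ∂(volume.restrict Ω))) ?_ ?_ u
  · rw [hr] at key
    have hpos : 0 < volume.real K := ENNReal.toReal_pos hK0 hKfin
    have e : ∫ x in K, u.1.fst x = 0 := hu
    rw [e] at key
    refine le_of_mul_le_mul_left ?_ hpos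
    simpa [valFn, gradFn] using key
  · refine isClosed_le (Continuous.sub ?_ (Continuous.pow ?_ 2)) ?_
    · exact continuous_const.mul ((continuous_setIntegral_norm_sq K).comp (WithLp.continuous_fst ..))
    · have : ∀ p : L2Pair Ω, ∫ x in K, p.fst x ∂(volume.restrict Ω)
          = inner ℝ (indicatorConstLp 2 hK hKfin' (1 : ℝ)) p.fst := fun p =>
        (L2.inner_indicatorConstLp_one hK hKfin' p.fst).symm
      simp only [this]
      exact continuous_const.inner (WithLp.continuous_fst ..)
    · exact continuous_const.mul (continuous_const.mul
        ((continuous_setIntegral_norm_sq K).comp (WithLp.continuous_snd ..)))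
  · intro p φ h h1 h2
    obtain ⟨M, m1, m2, m3⟩ := exists_taylor_bound h.1 h.2.1
    have := integral_sq_sub_sq_integral_le_of_convex hK hKc hD hKD h.1.continuous.measurable
      (continuous_gradient h.1).measurable m1 m2 m3
    rw [hr]
    have h1' : p.fst =ᵐ[volume.restrict K] φ := ae_restrict_of_ae_restrict_of_subset hKΩ h1
    have h2' : p.snd =ᵐ[volume.restrict K] gradient φ :=
      ae_restrict_of_ae_restrict_of_subset hKΩ h2
    have e1 : ∫ x in K, ‖p.fst x‖ ^ 2 = ∫ x in K, φ x ^ 2 := integral_congr_ae (by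
      filter_upwards [h1'] with x hx
      rw [hx, Real.norm_eq_abs, sq_abs])
    have e2 : ∫ x in K, ‖p.snd x‖ ^ 2 = ∫ x in K, ‖gradient φ x‖ ^ 2 := integral_congr_ae (by
      filter_upwards [h2'] with x hx
      rw [hx])
    rw [e1, e2, integral_congr_ae h1']
    exact this

end Test


/-! ### The energy form -/

section Energy

variable {d : ℕ} {Ω : Set (E d)} {a : E d → Matrix (Fin d) (Fin d) ℝ} {lmin lmax : ℝ}

theorem dotProduct_ofLp_self (l : E d) : l.ofLp ⬝ᵥ l.ofLp = ‖l‖ ^ 2 := by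
  rw [EuclideanSpace.real_norm_sq_eq, dotProduct]
  exact Finset.sum_congr rfl fun i _ => (sq _).symm

theorem IsUniformlyElliptic.integrable (ha : IsUniformlyElliptic Ω a lmin lmax) {G F : E d → E d}
    (hG : MemLp G 2 (volume.restrict Ω)) (hF : MemLp F 2 (volume.restrict Ω)) :
    Integrable (fun x => (G x).ofLp ⬝ᵥ (a x).mulVec (F x).ofLp) (volume.restrict Ω) := by
  simp only [dotProduct, Matrix.mulVec, Finset.mul_sum]
  refine integrable_finsetSum _ fun i _ => integrable_finsetSum _ fun j _ => ?_
  have hG' : MemLp (fun x => G x i) 2 (volume.restrict Ω) :=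
    hG.continuousLinearMap_comp (EuclideanSpace.proj i : E d →L[ℝ] ℝ)
  have hF' : MemLp (fun x => F x j) 2 (volume.restrict Ω) :=
    hF.continuousLinearMap_comp (EuclideanSpace.proj j : E d →L[ℝ] ℝ)
  have h1 : Integrable (fun x => G x i * F x j) (volume.restrict Ω) := hG'.integrable_mul hF'
  have h2 := h1.mul_of_top_right (ha.entries i j)
  refine h2.congr (ae_of_all _ fun x => ?_)
  simp only [Pi.mul_apply]
  ring

theorem memLp_gradFn (u : H10 Ω) : MemLp (gradFn u) 2 (volume.restrict Ω) := Lp.memLp _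

theorem gradFn_add (u v : H10 Ω) :
    gradFn (u + v) =ᵐ[volume.restrict Ω] gradFn u + gradFn v := Lp.coeFn_add _ _

theorem gradFn_smul (c : ℝ) (u : H10 Ω) :
    gradFn (c • u) =ᵐ[volume.restrict Ω] c • gradFn u := Lp.coeFn_smul _ _

theorem IsUniformlyElliptic.energy_symm (ha : IsUniformlyElliptic Ω a lmin lmax) (u v : H10 Ω) :
    energy a u v = energy a v u := by
  refine integral_congr_ae ?_
  filter_upwards [ha.symm] with x hx
  rw [Matrix.dotProduct_mulVec, ← Matrix.mulVec_transpose, hx.eq, dotProduct_comm]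

theorem IsUniformlyElliptic.energy_add_left (ha : IsUniformlyElliptic Ω a lmin lmax)
    (u v w : H10 Ω) : energy a (u + v) w = energy a u w + energy a v w := by
  simp only [energy]
  rw [← integral_add (ha.integrable (memLp_gradFn u) (memLp_gradFn w))
    (ha.integrable (memLp_gradFn v) (memLp_gradFn w))]
  refine integral_congr_ae ?_
  filter_upwards [gradFn_add u v] with x hx
  rw [hx, Pi.add_apply, WithLp.ofLp_add, add_dotProduct]

theorem energy_smul_left (c : ℝ) (u w : H10 Ω) :
    energy a (c • u) w = c * energy a u w := by
  simp only [energy]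
  rw [← integral_const_mul]
  refine integral_congr_ae ?_
  filter_upwards [gradFn_smul c u] with x hx
  rw [hx, Pi.smul_apply, WithLp.ofLp_smul, smul_dotProduct, smul_eq_mul]

theorem IsUniformlyElliptic.mul_norm_sq_le_energy (ha : IsUniformlyElliptic Ω a lmin lmax)
    (u : H10 Ω) : lmin * ‖u.1.snd‖ ^ 2 ≤ energy a u u := by
  have e : ‖u.1.snd‖ ^ 2 = ∫ x in Ω, ‖gradFn u x‖ ^ 2 := norm_sq_eq_integral _
  rw [e, ← integral_const_mul]
  refine integral_mono_ae ((integrable_norm_sq _).const_mul _)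
    (ha.integrable (memLp_gradFn u) (memLp_gradFn u)) ?_
  filter_upwards [ha.bounds] with x hx
  have := (hx (gradFn u x).ofLp).1
  rwa [dotProduct_ofLp_self] at this

/-- The energy of a vector field is bounded by `lmax` times its squared norm. -/
theorem IsUniformlyElliptic.integral_le (ha : IsUniformlyElliptic Ω a lmin lmax) {G : E d → E d}
    (hG : MemLp G 2 (volume.restrict Ω)) :
    ∫ x in Ω, (G x).ofLp ⬝ᵥ (a x).mulVec (G x).ofLp ≤ lmax * ∫ x in Ω, ‖G x‖ ^ 2 := by
  rw [← integral_const_mul]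
  refine integral_mono_ae (ha.integrable hG hG)
    ((hG.integrable_norm_pow (by norm_num)).const_mul _) ?_
  filter_upwards [ha.bounds] with x hx
  have := (hx (G x).ofLp).2
  rwa [dotProduct_ofLp_self] at this

theorem IsUniformlyElliptic.energy_le (ha : IsUniformlyElliptic Ω a lmin lmax)
    (u : H10 Ω) : energy a u u ≤ lmax * ‖u.1.snd‖ ^ 2 := by
  have e : ‖u.1.snd‖ ^ 2 = ∫ x in Ω, ‖gradFn u x‖ ^ 2 := norm_sq_eq_integral _
  rw [e]
  exact ha.integral_le (memLp_gradFn u)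

theorem norm_snd_le (u : H10 Ω) : ‖u.1.snd‖ ≤ ‖u‖ := WithLp.norm_snd_le _ u.1

/-- The energy product as a bilinear map. -/
noncomputable def energyBilin (ha : IsUniformlyElliptic Ω a lmin lmax) :
    H10 Ω →ₗ[ℝ] H10 Ω →ₗ[ℝ] ℝ :=
  LinearMap.mk₂ ℝ (energy a) ha.energy_add_left energy_smul_left
    (fun u v w => by
      rw [ha.energy_symm, ha.energy_add_left, ha.energy_symm v, ha.energy_symm w])
    (fun c u v => by rw [ha.energy_symm, energy_smul_left, ha.energy_symm v, smul_eq_mul])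

theorem IsUniformlyElliptic.energy_sq_le (ha : IsUniformlyElliptic Ω a lmin lmax) (u v : H10 Ω) :
    energy a u v ^ 2 ≤ energy a u u * energy a v v :=
  LinearMap.BilinForm.apply_sq_le_of_symm (energyBilin ha)
    (fun u => (mul_nonneg ha.pos.le (sq_nonneg _)).trans (ha.mul_norm_sq_le_energy u))
    ⟨fun u v => ha.energy_symm u v⟩ u v

theorem IsUniformlyElliptic.energy_self_nonneg (ha : IsUniformlyElliptic Ω a lmin lmax)
    (u : H10 Ω) : 0 ≤ energy a u u :=
  (mul_nonneg ha.pos.le (sq_nonneg _)).trans (ha.mul_norm_sq_le_energy u)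

theorem IsUniformlyElliptic.abs_energy_le (ha : IsUniformlyElliptic Ω a lmin lmax) (u v : H10 Ω) :
    |energy a u v| ≤ |lmax| * ‖u‖ * ‖v‖ := by
  have h : ∀ w : H10 Ω, energy a w w ≤ |lmax| * ‖w‖ ^ 2 := fun w =>
    (ha.energy_le w).trans (mul_le_mul (le_abs_self _)
      (pow_le_pow_left₀ (norm_nonneg _) (norm_snd_le w) 2) (sq_nonneg _) (abs_nonneg _))
  refine abs_le_of_sq_le_sq ?_ (by positivity)
  refine (ha.energy_sq_le u v).trans ((mul_le_mul (h u) (h v) (ha.energy_self_nonneg v)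
    (by positivity)).trans (le_of_eq (by ring)))

/-- The energy product as a continuous bilinear form. -/
noncomputable def energyForm (ha : IsUniformlyElliptic Ω a lmin lmax) :
    H10 Ω →L[ℝ] H10 Ω →L[ℝ] ℝ :=
  LinearMap.mkContinuous₂ (energyBilin ha) |lmax| ha.abs_energy_le

@[simp]
theorem energyForm_apply (ha : IsUniformlyElliptic Ω a lmin lmax) (u v : H10 Ω) :
    energyForm ha u v = energy a u v := rfl

/-- Friedrichs' inequality gives ‖u‖² ≤ 2‖∇u‖² for the full H¹ norm, hence the constant lmin/2. -/
theorem isCoercive_energyForm (hd : 1 ≤ d) (hb : Bornology.IsBounded Ω)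
    (hdiam : Metric.diam Ω ≤ 1) (ha : IsUniformlyElliptic Ω a lmin lmax) :
    IsCoercive (energyForm ha) := by
  refine ⟨lmin / 2, half_pos ha.pos, fun u => ?_⟩
  have h1 := ha.mul_norm_sq_le_energy u
  have h2 := norm_fst_le_norm_snd hd hb hdiam u
  have h3 : ‖u‖ ^ 2 = ‖u.1.fst‖ ^ 2 + ‖u.1.snd‖ ^ 2 := WithLp.prod_norm_sq_eq_of_L2 u.1
  have h4 : ‖u.1.fst‖ ^ 2 ≤ ‖u.1.snd‖ ^ 2 := pow_le_pow_left₀ (norm_nonneg _) h2 2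
  rw [energyForm_apply, mul_assoc, ← sq, h3]
  have := mul_le_mul_of_nonneg_left h4 ha.pos.le
  linarith

/-- The energy identity `⟨w, v⟩_a = -∫ f w` extends from test functions to `H¹₀(Ω)`. -/
theorem IsWeakDiv.energy_eq (ha : IsUniformlyElliptic Ω a lmin lmax) {v : H10 Ω} {f : L2 Ω}
    (hf : IsWeakDiv a v f) (w : H10 Ω) : energy a w v = -inner ℝ f w.1.fst := by
  have hcl : IsClosed {w : H10 Ω | energy a w v = -inner ℝ f w.1.fst} := by
    refine isClosed_eq ?_ ?_
    · have : (fun w : H10 Ω => energy a w v) = fun w => energyForm ha v w := by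
        funext w; rw [energyForm_apply, ha.energy_symm]
      rw [this]
      fun_prop
    · exact (continuous_const.inner
        ((WithLp.continuous_fst ..).comp continuous_subtype_val)).neg
  -- The induction principle concerns predicates on all pairs, so membership in `H10` is made part
  -- of the predicate. Closedness is transported along the closed embedding of `H10`.
  have hcl2 : IsClosed {p : L2Pair Ω | ∃ h : p ∈ H10 Ω, energy a ⟨p, h⟩ v = -inner ℝ f p.fst} := by
    have := (Submodule.isClosed_topologicalClosure _ : IsClosed (H10 Ω : Set (L2Pair Ω)))
    convert this.isClosedEmbedding_subtypeVal.isClosedMap _ hcl using 1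
    ext p
    constructor
    · rintro ⟨h, e⟩
      exact ⟨⟨p, h⟩, e, rfl⟩
    · rintro ⟨q, e, rfl⟩
      exact ⟨q.2, e⟩
  have key := H10_induction hcl2 ?_ w
  · obtain ⟨_, h⟩ := key
    exact h
  · intro p φ h h1 h2
    have hp : p ∈ H10 Ω := Submodule.le_topologicalClosure _ (Submodule.subset_span ⟨φ, h, h1, h2⟩)
    refine ⟨hp, ?_⟩
    have e1 : energy a ⟨p, hp⟩ v
        = ∫ x in Ω, (gradient φ x).ofLp ⬝ᵥ (a x).mulVec (gradFn v x).ofLp := by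
      refine integral_congr_ae ?_
      filter_upwards [h2] with x hx
      have : gradFn ⟨p, hp⟩ x = gradient φ x := hx
      rw [this]
    rw [e1, hf φ h, L2.inner_def]
    congr 1
    refine integral_congr_ae ?_
    filter_upwards [h1] with x hx
    rw [hx, real_inner_comm]
    simp

theorem isWeakDiv_of_energy_eq {v : H10 Ω} {f : L2 Ω}
    (h : ∀ w : H10 Ω, energy a w v = -inner ℝ f w.1.fst) : IsWeakDiv a v f := by
  intro φ hφ
  obtain ⟨u, h1, h2⟩ := hφ.exists_H10
  have e1 : energy a u v
      = ∫ x in Ω, (gradient φ x).ofLp ⬝ᵥ (a x).mulVec (gradFn v x).ofLp := by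
    refine integral_congr_ae ?_
    filter_upwards [h2] with x hx
    rw [hx]
  rw [← e1, h u, L2.inner_def]
  congr 1
  refine integral_congr_ae ?_
  filter_upwards [h1] with x hx
  have : u.1.fst x = φ x := hx
  rw [this, real_inner_comm]
  simp

/-- The weak divergence is unique. -/
theorem IsWeakDiv.unique (hΩ : IsOpen Ω) {v : H10 Ω} {f g : L2 Ω}
    (hf : IsWeakDiv a v f) (hg : IsWeakDiv a v g) : f = g := by
  have hloc : LocallyIntegrableOn (fun x => f x - g x) Ω volume := by
    have hm : MemLp (fun x => f x - g x) 2 (volume.restrict Ω) := (Lp.memLp f).sub (Lp.memLp g)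
    exact locallyIntegrableOn_of_locallyIntegrable_restrict (hm.locallyIntegrable (by norm_num))
  have key := hΩ.ae_eq_zero_of_integral_contDiff_smul_eq_zero hloc (fun φ h1 h2 h3 => by
    have hφ : IsTest Ω φ := ⟨h1, h2, h3⟩
    have e := (hf φ hφ).symm.trans (hg φ hφ)
    have hφ2 : MemLp φ 2 (volume.restrict Ω) := h1.continuous.memLp_of_hasCompactSupport h2
    have i1 : Integrable (fun x => f x * φ x) (volume.restrict Ω) :=
      (Lp.memLp f).integrable_mul hφ2
    have i2 : Integrable (fun x => g x * φ x) (volume.restrict Ω) :=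
      (Lp.memLp g).integrable_mul hφ2
    have e2 : ∫ x, φ x • (f x - g x) = ∫ x in Ω, φ x • (f x - g x) :=
      (setIntegral_eq_integral_of_forall_compl_eq_zero fun x hx => by simp [hφ.eq_zero hx]).symm
    have e3 : ∀ x, φ x • (f x - g x) = f x * φ x - g x * φ x := fun x => by
      rw [smul_eq_mul]; ring
    rw [e2]
    simp only [e3]
    rw [integral_sub i1 i2]
    linarith)
  refine Lp.ext ?_
  rw [Filter.EventuallyEq, ae_restrict_iff' hΩ.measurableSet]
  filter_upwards [key] with x hx hxΩ
  exact sub_eq_zero.1 (hx hxΩ)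

end Energy


/-! ### Bump functions -/

section Bump

variable {d : ℕ}

/-- The factor (d + 1)² is what a cone costs in the bump estimate. Strictness leaves room for the
mollification. -/
theorem succ_sq_lt_two_pow (d : ℕ) : ((d : ℝ) + 1) ^ 2 < 2 ^ (3 + d) := by
  have h : (d + 1) ^ 2 < 2 ^ (3 + d) := by
    rcases lt_or_ge d 2 with h | h
    · interval_cases d <;> norm_num
    · induction d, h using Nat.le_induction with
      | base => norm_num
      | succ n hn ih =>
        rw [← add_assoc, pow_succ 2]
        nlinarith
  exact_mod_cast h

-- Here θ is the ratio by which the cone is shrunk so that its mollification still fits in the ball.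
-- By continuity at θ = 1 the strict inequality survives.
open Filter Topology in
theorem exists_shrink (d : ℕ) :
    ∃ θ : ℝ, 0 < θ ∧ θ < 1 ∧ ((d : ℝ) + 1) ^ 2 ≤ 2 ^ (3 + d) * (θ ^ (d + 1)) ^ 2 := by
  have h : ContinuousAt (fun θ : ℝ => (2 : ℝ) ^ (3 + d) * (θ ^ (d + 1)) ^ 2) 1 := by fun_prop
  have h1 := (h.tendsto.eventually_const_lt (u := ((d : ℝ) + 1) ^ 2)
    (by simpa using succ_sq_lt_two_pow d)).filter_mono (nhdsWithin_le_nhds (s := Set.Iio 1))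
  have h2 : ∀ᶠ θ in 𝓝[<] (1 : ℝ), 0 < θ :=
    (lt_mem_nhds zero_lt_one).filter_mono nhdsWithin_le_nhds
  obtain ⟨θ, h3, h4, h5⟩ := (h1.and (h2.and self_mem_nhdsWithin)).exists
  exact ⟨θ, h4, h5, h3.le⟩

/-- The integral of a cone. -/
theorem integral_cone (hd : 1 ≤ d) (c : E d) {r : ℝ} (hr : 0 < r) :
    ∫ x, max (r - ‖x - c‖) 0 =
      volume.real (Metric.ball (0 : E d) 1) * r ^ (d + 1) / (d + 1) := by
  have : Nontrivial (E d) := by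
    have : Nonempty (Fin d) := ⟨⟨0, hd⟩⟩
    infer_instance
  rw [integral_sub_right_eq_self (fun x : E d => max (r - ‖x‖) 0) c,
    integral_fun_norm_addHaar volume (fun y => max (r - y) 0)]
  obtain ⟨n, rfl⟩ : ∃ n, d = n + 1 := ⟨d - 1, by omega⟩
  have e1 : ∫ y in Set.Ioi (0 : ℝ), y ^ (n + 1 - 1) • max (r - y) 0
      = ∫ y in (0 : ℝ)..r, (r * y ^ n - y ^ (n + 1)) := by
    rw [intervalIntegral.integral_of_le hr.le, ← Set.Ioc_union_Ioi_eq_Ioi hr.le]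
    rw [setIntegral_eq_of_subset_of_forall_sdiff_eq_zero (s := Set.Ioc 0 r)
      (by measurability) Set.subset_union_left]
    · refine setIntegral_congr_fun measurableSet_Ioc fun y hy => ?_
      simp only [smul_eq_mul, Nat.add_sub_cancel]
      rw [max_eq_left (sub_nonneg.2 hy.2)]
      ring
    · rintro y ⟨hy | hy, hy'⟩
      · exact absurd hy hy'
      · rw [max_eq_right (sub_nonpos.2 (le_of_lt hy)), smul_zero]
  rw [show Module.finrank ℝ (E (n + 1)) = n + 1 by simp, e1, intervalIntegral.integral_sub
    (Continuous.intervalIntegrable (by fun_prop) _ _)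
    (Continuous.intervalIntegrable (by fun_prop) _ _), intervalIntegral.integral_const_mul, integral_pow, integral_pow]
  simp only [nsmul_eq_mul, smul_eq_mul]
  push_cast
  field_simp
  ring

/-- A smooth nonnegative function `ρ` of integral one supported in a small ball regularizes
a `1`-Lipschitz function `f` to a smooth `1`-Lipschitz function with the same integral. -/
theorem exists_mollification {c : E d} {r s : ℝ} (hrs : r < s) {f : E d → ℝ}
    (hf : LipschitzWith 1 f) (hsupp : Function.support f ⊆ Metric.closedBall c r) :
    ∃ b : E d → ℝ, ContDiff ℝ ∞ b ∧ HasCompactSupport b ∧ tsupport b ⊆ Metric.ball c s ∧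
      (∀ x, ‖gradient b x‖ ≤ 1) ∧ ∫ x, b x = ∫ x, f x := by
  have hε : 0 < (s - r) / 4 := by linarith
  let ρ : ContDiffBump (0 : E d) := ⟨(s - r) / 4, (s - r) / 2, hε, by linarith⟩
  have hfc : HasCompactSupport f := HasCompactSupport.of_support_subset_isCompact
    (isCompact_closedBall c r) hsupp
  have hfi : Integrable f := hf.continuous.integrable_of_hasCompactSupport hfc
  have hρi : Integrable (ρ.normed volume) := ρ.integrable_normed
  have hex : ConvolutionExists (ρ.normed volume) f (ContinuousLinearMap.lsmul ℝ ℝ) volume :=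
    ρ.hasCompactSupport_normed.convolutionExists_left _ ρ.continuous_normed hfi.locallyIntegrable
  set b := convolution (ρ.normed volume) f (ContinuousLinearMap.lsmul ℝ ℝ) volume with hb
  have hsup : Function.support b ⊆ Metric.closedBall c ((s + r) / 2) := by
    refine (support_convolution_subset _).trans ?_
    rintro _ ⟨x, hx, y, hy, rfl⟩
    rw [ρ.support_normed_eq, mem_ball_zero_iff] at hx
    have hy' := hsupp hy
    have hx' : ‖x‖ < (s - r) / 2 := hx
    rw [mem_closedBall_iff_norm] at hy' ⊢
    have e : x + y - c = x + (y - c) := by abel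
    simp only [e]
    exact (norm_add_le _ _).trans (by linarith)
  have htsup : tsupport b ⊆ Metric.closedBall c ((s + r) / 2) :=
    closure_minimal hsup Metric.isClosed_closedBall
  have hsm : ContDiff ℝ ∞ b :=
    ρ.hasCompactSupport_normed.contDiff_convolution_left _ ρ.contDiff_normed hfi.locallyIntegrable
  have hlip : LipschitzWith 1 b := by
    refine LipschitzWith.of_dist_le_mul fun x y => ?_
    rw [dist_eq_norm, hb, convolution_def, convolution_def, ← integral_sub (hex x) (hex y)]
    refine (norm_integral_le_integral_norm _).trans ?_
    have : ∫ t, ρ.normed volume t * dist x y = (1 : NNReal) * dist x y := by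
      rw [integral_mul_const, ρ.integral_normed]; simp
    rw [← this]
    refine integral_mono_of_nonneg (ae_of_all _ fun t => norm_nonneg _) (hρi.mul_const _)
      (ae_of_all _ fun t => ?_)
    simp only [ContinuousLinearMap.lsmul_apply, smul_eq_mul]
    rw [← mul_sub, norm_mul, Real.norm_of_nonneg (ρ.nonneg_normed t)]
    refine mul_le_mul_of_nonneg_left ?_ (ρ.nonneg_normed t)
    have := hf.dist_le_mul (x - t) (y - t)
    simpa [dist_eq_norm] using this
  refine ⟨b, hsm, HasCompactSupport.of_support_subset_isCompact
    (isCompact_closedBall c ((s + r) / 2)) hsup, htsup.trans (Metric.closedBall_subset_ball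
    (by linarith)), fun x => ?_, ?_⟩
  · have e : ‖gradient b x‖ = ‖fderiv ℝ b x‖ := by simp [gradient]
    rw [e]
    exact norm_fderiv_le_of_lipschitz ℝ hlip
  · rw [hb, integral_convolution _ hρi hfi, ρ.integral_normed]
    simp

/-- Bump functions with a large integral and a small Dirichlet energy. -/
theorem exists_bump (hd : 1 ≤ d) {r : ℝ} (hr : 0 < r) :
    ∃ β : ℝ, 0 < β ∧ ∀ c : E d, ∃ b : E d → ℝ, IsTest (Metric.ball c r) b ∧ ∫ x, b x = β ∧
      volume.real (Metric.ball (0 : E d) 1) * r ^ (d + 2) * ∫ x, ‖gradient b x‖ ^ 2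
        ≤ 2 ^ (3 + d) * β ^ 2 := by
  obtain ⟨θ, h0, h1, h2⟩ := exists_shrink d
  have hκ : 0 < volume.real (Metric.ball (0 : E d) 1) :=
    ENNReal.toReal_pos (Metric.measure_ball_pos _ _ one_pos).ne' measure_ball_lt_top.ne
  set κ := volume.real (Metric.ball (0 : E d) 1)
  -- β is the integral of the cone of radius θr. It does not depend on the centre, so bumps in
  -- different balls share it; the gradient bound 1 limits the Dirichlet energy to the volume of the
  -- ball.
  refine ⟨κ * (θ * r) ^ (d + 1) / (d + 1), by positivity, fun c => ?_⟩
  have hlip : LipschitzWith 1 fun x : E d => max (θ * r - ‖x - c‖) 0 := by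
    have e1 : LipschitzWith 1 fun x : E d => θ * r - ‖x - c‖ := by
      refine LipschitzWith.of_dist_le_mul fun x y => ?_
      rw [Real.dist_eq, sub_sub_sub_cancel_left, dist_comm, dist_eq_norm]
      refine (abs_norm_sub_norm_le _ _).trans ?_
      simp
    exact e1.max_const 0
  obtain ⟨b, b1, b2, b3, b4, b5⟩ := exists_mollification (c := c) (r := θ * r) (s := r)
    (by nlinarith) hlip (fun x hx => by
      rw [mem_closedBall_iff_norm]
      by_contra hlt
      push Not at hlt
      exact hx (max_eq_right (by linarith)))
  refine ⟨b, ⟨b1, b2, b3⟩, b5.trans (integral_cone hd c (by positivity)), ?_⟩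
  have hT : IsTest (Metric.ball c r) b := ⟨b1, b2, b3⟩
  have hvol : volume.real (Metric.ball c r) = κ * r ^ d := by
    rw [measureReal_def, Measure.addHaar_ball_of_pos _ _ hr, ENNReal.toReal_mul,
      ENNReal.toReal_ofReal (by positivity), mul_comm]
    simp [κ, measureReal_def]
  have hD : ∫ x, ‖gradient b x‖ ^ 2 ≤ κ * r ^ d := by
    rw [← setIntegral_eq_integral_of_forall_compl_eq_zero (s := Metric.ball c r)
      (fun x hx => by simp [hT.gradient_eq_zero hx]), ← hvol]
    have hfin : IsFiniteMeasure (volume.restrict (Metric.ball c r)) :=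
      ⟨by simpa using measure_ball_lt_top⟩
    calc ∫ x in Metric.ball c r, ‖gradient b x‖ ^ 2 ≤ ∫ x in Metric.ball c r, (1 : ℝ) := by
          refine integral_mono_of_nonneg (ae_of_all _ fun x => by positivity)
            (integrable_const _) (ae_of_all _ fun x => ?_)
          exact pow_le_one₀ (norm_nonneg _) (b4 x)
      _ = _ := by simp
  calc κ * r ^ (d + 2) * ∫ x, ‖gradient b x‖ ^ 2 ≤ κ * r ^ (d + 2) * (κ * r ^ d) := by gcongr
    _ = (((d : ℝ) + 1) ^ 2) * (κ * r ^ (d + 1) / (d + 1)) ^ 2 := by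
      field_simp
      ring
    _ ≤ (2 ^ (3 + d) * (θ ^ (d + 1)) ^ 2) * (κ * r ^ (d + 1) / (d + 1)) ^ 2 := by gcongr
    _ = _ := by
      rw [mul_pow θ r]
      ring

end Bump


/-! ### Quadratic forms and condition numbers -/

section CondNum

open Matrix

variable {n : Type*} [Fintype n]

theorem dotProduct_sq_le (x y : n → ℝ) : (x ⬝ᵥ y) ^ 2 ≤ (x ⬝ᵥ x) * (y ⬝ᵥ y) := by
  have := Finset.sum_mul_sq_le_sq_mul_sq Finset.univ x y
  simpa [dotProduct, sq] using this

theorem dotProduct_self_nonneg' (x : n → ℝ) : 0 ≤ x ⬝ᵥ x :=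
  Finset.sum_nonneg fun i _ => mul_self_nonneg (x i)

theorem dotProduct_conjTranspose_mul_self_mulVec (M : Matrix n n ℝ) (x : n → ℝ) :
    x ⬝ᵥ (Mᴴ * M) *ᵥ x = (M *ᵥ x) ⬝ᵥ (M *ᵥ x) := by
  rw [← Matrix.mulVec_mulVec, Matrix.dotProduct_mulVec, Matrix.vecMul_conjTranspose]
  simp

variable [DecidableEq n]

/-- The Cauchy–Schwarz inequality for a positive semidefinite matrix. -/
theorem dotProduct_mulVec_sq_le {M : Matrix n n ℝ} (hM : M.IsSymm)
    (h0 : ∀ x : n → ℝ, 0 ≤ x ⬝ᵥ M *ᵥ x) (x y : n → ℝ) :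
    (x ⬝ᵥ M *ᵥ y) ^ 2 ≤ (x ⬝ᵥ M *ᵥ x) * (y ⬝ᵥ M *ᵥ y) := by
  have := LinearMap.BilinForm.apply_sq_le_of_symm (Matrix.toBilin' M)
    (fun x => by rw [Matrix.toBilin'_apply']; exact h0 x)
    ⟨fun u v => by
      simp only [Matrix.toBilin'_apply', RingHom.id_apply]
      rw [Matrix.dotProduct_mulVec, ← Matrix.mulVec_transpose, hM.eq, dotProduct_comm]⟩ x y
  simpa only [Matrix.toBilin'_apply'] using this

/-- The quadratic form of a symmetric matrix in a basis of eigenvectors. -/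
theorem exists_quadForm_eq_sum {N : Matrix n n ℝ} (hN : N.IsHermitian) (x : n → ℝ) :
    ∃ y : n → ℝ, x ⬝ᵥ N *ᵥ x = ∑ i, hN.eigenvalues i * y i ^ 2 ∧ x ⬝ᵥ x = ∑ i, y i ^ 2 := by
  obtain ⟨U, h1, h2⟩ : ∃ U : Matrix n n ℝ, N = U * diagonal hN.eigenvalues * Uᵀ ∧
      U * Uᵀ = 1 := by
    refine ⟨hN.eigenvectorUnitary.1, ?_, Unitary.coe_mul_star_self hN.eigenvectorUnitary⟩
    have := hN.spectral_theorem
    rw [Unitary.conjStarAlgAut_apply] at this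
    exact this
  have h3 : ∀ z : n → ℝ, x ⬝ᵥ U *ᵥ z = (Uᵀ *ᵥ x) ⬝ᵥ z := fun z => by
    rw [dotProduct_mulVec, mulVec_transpose]
  refine ⟨Uᵀ *ᵥ x, ?_, ?_⟩
  · generalize hN.eigenvalues = e at h1
    rw [h1, ← mulVec_mulVec, ← mulVec_mulVec, h3]
    simp only [dotProduct, mulVec_diagonal]
    exact Finset.sum_congr rfl fun i _ => by ring
  · have h4 : x ⬝ᵥ x = x ⬝ᵥ (U * Uᵀ) *ᵥ x := by rw [h2, one_mulVec]
    rw [h4, ← mulVec_mulVec, h3]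
    simp only [dotProduct, sq]

theorem exists_eigenvector {N : Matrix n n ℝ} (hN : N.IsHermitian) (i : n) :
    ∃ v : n → ℝ, v ⬝ᵥ v = 1 ∧ N *ᵥ v = hN.eigenvalues i • v := by
  refine ⟨(hN.eigenvectorBasis i).ofLp, ?_, hN.mulVec_eigenvectorBasis i⟩
  have h := hN.eigenvectorBasis.orthonormal.1 i
  have h2 : ‖hN.eigenvectorBasis i‖ ^ 2 = 1 := by rw [h]; norm_num
  rw [EuclideanSpace.real_norm_sq_eq] at h2
  simpa [dotProduct, sq] using h2

/-- A bound on the condition number from bounds on the quadratic form. -/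
theorem condNum_le {M : Matrix n n ℝ} (hM : M.IsSymm) {c C : ℝ} (hc : 0 < c) (hC : 0 ≤ C)
    (h1 : ∀ x : n → ℝ, c * (x ⬝ᵥ x) ≤ x ⬝ᵥ M *ᵥ x)
    (h2 : ∀ x : n → ℝ, x ⬝ᵥ M *ᵥ x ≤ C * (x ⬝ᵥ x)) : condNum M ≤ C / c := by
  have h0 : ∀ x : n → ℝ, 0 ≤ x ⬝ᵥ M *ᵥ x := fun x =>
    (mul_nonneg hc.le (dotProduct_self_nonneg' x)).trans (h1 x)
  -- For an empty matrix the supremum of the eigenvalues is 0 by convention, hence so is `condNum`.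
  rcases isEmpty_or_nonempty n with hn | hn
  · simp only [condNum, Real.iSup_of_isEmpty, Real.sqrt_zero, zero_div]
    positivity
  have key : ∀ i, c ^ 2 ≤ (isHermitian_conjTranspose_mul_self M).eigenvalues i ∧
      (isHermitian_conjTranspose_mul_self M).eigenvalues i ≤ C ^ 2 := by
    intro i
    obtain ⟨v, hv, hv'⟩ := exists_eigenvector (isHermitian_conjTranspose_mul_self M) i
    set e := (isHermitian_conjTranspose_mul_self M).eigenvalues i
    have he : (M *ᵥ v) ⬝ᵥ (M *ᵥ v) = e := by
      rw [← dotProduct_conjTranspose_mul_self_mulVec, hv', dotProduct_smul, hv, smul_eq_mul,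
        mul_one]
    have a1 := h1 v
    rw [hv, mul_one] at a1
    have a2 := dotProduct_sq_le v (M *ᵥ v)
    rw [hv, one_mul, he] at a2
    -- For a unit eigenvector v with eigenvalue e = |Mv|², Cauchy–Schwarz in the form of M gives e²
    -- ≤ (Mv · M Mv)(v · Mv) ≤ Ce · C. The ordinary Cauchy–Schwarz inequality `a2` gives e ≥ (v ·
    -- Mv)² ≥ c².
    have a3 := dotProduct_mulVec_sq_le hM h0 (M *ᵥ v) v
    rw [he] at a3
    have a4 := h2 (M *ᵥ v)
    rw [he] at a4
    have a5 := h2 v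
    rw [hv, mul_one] at a5
    have a6 := h0 v
    have e0 : 0 ≤ e := by rw [← he]; exact dotProduct_self_nonneg' _
    constructor
    · exact (pow_le_pow_left₀ hc.le a1 2).trans a2
    · have a7 : e ^ 2 ≤ C * e * C := a3.trans (mul_le_mul a4 a5 a6 (by positivity))
      rcases e0.eq_or_lt with h | h
      · rw [← h]; positivity
      · nlinarith
  rw [condNum]
  have hsup : ⨆ i, (isHermitian_conjTranspose_mul_self M).eigenvalues i ≤ C ^ 2 :=
    ciSup_le fun i => (key i).2
  have hinf : c ^ 2 ≤ ⨅ i, (isHermitian_conjTranspose_mul_self M).eigenvalues i :=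
    le_ciInf fun i => (key i).1
  exact div_le_div₀ hC (Real.sqrt_le_iff.2 ⟨hC, hsup⟩) hc (Real.le_sqrt_of_sq_le hinf)

/-- The condition number of a positive definite matrix is the quotient of bounds on its quadratic
form. -/
theorem exists_condNum_eq [Nonempty n] {N : Matrix n n ℝ} (hN : N.IsSymm)
    (hpos : ∀ x : n → ℝ, x ≠ 0 → 0 < x ⬝ᵥ N *ᵥ x) :
    ∃ l L : ℝ, 0 < l ∧ 0 ≤ L ∧ (∀ x : n → ℝ, l * (x ⬝ᵥ x) ≤ x ⬝ᵥ N *ᵥ x) ∧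
      (∀ x : n → ℝ, x ⬝ᵥ N *ᵥ x ≤ L * (x ⬝ᵥ x)) ∧ condNum N = L / l := by
  have h0 : ∀ x : n → ℝ, 0 ≤ x ⬝ᵥ N *ᵥ x := fun x => by
    rcases eq_or_ne x 0 with rfl | h
    · simp
    · exact (hpos x h).le
  have hinj : Function.Injective N.mulVec := by
    refine (injective_iff_map_eq_zero N.mulVecLin).2 fun x hx => ?_
    by_contra hne
    have := hpos x hne
    rw [show N *ᵥ x = 0 from hx] at this
    simp at this
  have hsurj : Function.Surjective N.mulVec :=
    LinearMap.injective_iff_surjective (f := N.mulVecLin) |>.1 hinj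
  set hH := isHermitian_conjTranspose_mul_self N
  have hepos : ∀ i, 0 < hH.eigenvalues i := fun i => by
    obtain ⟨v, hv, hv'⟩ := exists_eigenvector hH i
    have he : (N *ᵥ v) ⬝ᵥ (N *ᵥ v) = hH.eigenvalues i := by
      rw [← dotProduct_conjTranspose_mul_self_mulVec, hv', dotProduct_smul, hv, smul_eq_mul,
        mul_one]
    rw [← he]
    refine lt_of_le_of_ne (dotProduct_self_nonneg' _) fun h => ?_
    have h3 : N *ᵥ v = N *ᵥ 0 := by rw [mulVec_zero]; exact dotProduct_self_eq_zero.1 h.symm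
    rw [hinj h3] at hv
    simp at hv
  have hfin : (Set.range hH.eigenvalues).Finite := Set.finite_range _
  have hsq : ∀ x, (⨅ i, hH.eigenvalues i) * (x ⬝ᵥ x) ≤ (N *ᵥ x) ⬝ᵥ (N *ᵥ x) ∧
      (N *ᵥ x) ⬝ᵥ (N *ᵥ x) ≤ (⨆ i, hH.eigenvalues i) * (x ⬝ᵥ x) := fun x => by
    obtain ⟨y, h1, h2⟩ := exists_quadForm_eq_sum hH x
    rw [← dotProduct_conjTranspose_mul_self_mulVec, h1, h2, Finset.mul_sum, Finset.mul_sum]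
    exact ⟨Finset.sum_le_sum fun i _ => mul_le_mul_of_nonneg_right
      (ciInf_le hfin.bddBelow i) (sq_nonneg _), Finset.sum_le_sum fun i _ =>
      mul_le_mul_of_nonneg_right (le_ciSup hfin.bddAbove i) (sq_nonneg _)⟩
  have hinf : 0 < ⨅ i, hH.eigenvalues i := by
    obtain ⟨i, hi⟩ := exists_eq_ciInf_of_finite (f := hH.eigenvalues)
    rw [← hi]; exact hepos i
  have hsup : 0 ≤ ⨆ i, hH.eigenvalues i :=
    (hepos (Classical.arbitrary n)).le.trans (le_ciSup hfin.bddAbove _)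
  refine ⟨Real.sqrt (⨅ i, hH.eigenvalues i), Real.sqrt (⨆ i, hH.eigenvalues i),
    Real.sqrt_pos.2 hinf, Real.sqrt_nonneg _, fun x => ?_, fun x => ?_, rfl⟩
  · set l := Real.sqrt (⨅ i, hH.eigenvalues i) with hl
    have hlpos : 0 < l := Real.sqrt_pos.2 hinf
    have hl2 : l ^ 2 = ⨅ i, hH.eigenvalues i := Real.sq_sqrt hinf.le
    -- Writing x = Ny avoids square roots of matrices: (x · x)² ≤ (x · Nx)(y · x) by Cauchy–Schwarz
    -- in the form of N, while l|y| ≤ |x| gives l(y · x) ≤ x · x.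
    obtain ⟨y, hy⟩ := hsurj x
    have a1 := dotProduct_mulVec_sq_le hN h0 x y
    have a2 := (hsq y).1
    rw [← hl2] at a2
    rw [hy] at a1 a2
    have a3 := dotProduct_sq_le y x
    have x0 := dotProduct_self_nonneg' x
    have y0 := dotProduct_self_nonneg' y
    have q0 := h0 x
    have b0 : 0 ≤ y ⬝ᵥ x := by rw [← hy]; exact h0 y
    rcases x0.eq_or_lt with hx | hx
    · rw [← hx, mul_zero]; exact q0
    have a4 : l * (y ⬝ᵥ x) ≤ x ⬝ᵥ x := by
      refine abs_le_of_sq_le_sq' ?_ x0 |>.2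
      nlinarith
    refine le_of_mul_le_mul_left ?_ hx
    calc (x ⬝ᵥ x) * (l * (x ⬝ᵥ x)) = l * (x ⬝ᵥ x) ^ 2 := by ring
      _ ≤ l * ((x ⬝ᵥ N *ᵥ x) * (y ⬝ᵥ x)) := by gcongr
      _ = (x ⬝ᵥ N *ᵥ x) * (l * (y ⬝ᵥ x)) := by ring
      _ ≤ (x ⬝ᵥ N *ᵥ x) * (x ⬝ᵥ x) := by gcongr
      _ = _ := by ring
  · have a1 := dotProduct_sq_le x (N *ᵥ x)
    have a2 := (hsq x).2
    have x0 := dotProduct_self_nonneg' x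
    refine abs_le_of_sq_le_sq' ?_ (by positivity) |>.2
    rw [mul_pow, Real.sq_sqrt hsup]
    nlinarith

end CondNum


/-! ### The index tree and the matrices `W` -/

section Tree

variable {m : List ℕ → ℕ} {k : ℕ}

theorem mem_nodes_succ {i : List ℕ} :
    i ∈ nodes m (k + 1) ↔ ∃ s ∈ nodes m k, ∃ t < m s, t :: s = i := by
  simp [nodes]

theorem mem_subNodes_succ {i : List ℕ} :
    i ∈ subNodes m (k + 1) ↔ ∃ s ∈ nodes m k, ∃ t < m s - 1, t :: s = i := by
  simp [subNodes]

theorem cons_mem_nodes {s : List ℕ} (hs : s ∈ nodes m k) {t : ℕ} (ht : t < m s) :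
    t :: s ∈ nodes m (k + 1) := mem_nodes_succ.2 ⟨s, hs, t, ht, rfl⟩

theorem sum_biUnion_cons {M : Type*} [AddCommMonoid M] (S : Finset (List ℕ)) (c : List ℕ → ℕ)
    (F : List ℕ → M) :
    ∑ i ∈ S.biUnion fun s => (Finset.range (c s)).image fun t => t :: s, F i
      = ∑ s ∈ S, ∑ t ∈ Finset.range (c s), F (t :: s) := by
  rw [Finset.sum_biUnion]
  · exact Finset.sum_congr rfl fun s _ => Finset.sum_image fun t _ t' _ h => by simpa using h
  · intro s _ s' _ hss
    rw [Function.onFun, Finset.disjoint_left]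
    intro i hi hi'
    simp only [Finset.mem_image, Finset.mem_range] at hi hi'
    obtain ⟨t, -, rfl⟩ := hi
    obtain ⟨t', -, h⟩ := hi'
    exact hss (List.cons.inj h).2.symm

theorem sum_nodes_succ {M : Type*} [AddCommMonoid M] (F : List ℕ → M) :
    ∑ i : nodes m (k + 1), F i = ∑ s ∈ nodes m k, ∑ t ∈ Finset.range (m s), F (t :: s) := by
  rw [Finset.sum_coe_sort (nodes m (k + 1)) F]
  exact sum_biUnion_cons _ _ F

theorem sum_subNodes_succ {M : Type*} [AddCommMonoid M] (F : List ℕ → M) :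
    ∑ i : subNodes m (k + 1), F i
      = ∑ s ∈ nodes m k, ∑ t ∈ Finset.range (m s - 1), F (t :: s) := by
  rw [Finset.sum_coe_sort (subNodes m (k + 1)) F]
  exact sum_biUnion_cons _ _ F

/-- The extension by zero of a function on a finite set of nodes. -/
noncomputable def ext0 {S : Finset (List ℕ)} (y : S → ℝ) : List ℕ → ℝ :=
  Function.extend Subtype.val y 0

@[simp]
theorem ext0_coe {S : Finset (List ℕ)} (y : S → ℝ) (i : S) : ext0 y i = y i :=
  Subtype.val_injective.extend_apply y 0 i

/-- The count that makes 𝒥 the right index set for Ker π. Positivity of each `m s` is essential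
because `m s - 1` is truncated subtraction. -/
theorem card_nodes_succ (hm : ∀ s ∈ nodes m k, 0 < m s) :
    (nodes m (k + 1)).card = (subNodes m (k + 1)).card + (nodes m k).card := by
  have h1 := sum_nodes_succ (m := m) (k := k) fun _ => 1
  have h2 := sum_subNodes_succ (m := m) (k := k) fun _ => 1
  simp only [Finset.sum_const, Finset.card_univ, Fintype.card_coe, Finset.card_range,
    smul_eq_mul, mul_one] at h1 h2
  rw [h1, h2, Finset.card_eq_sum_ones, ← Finset.sum_add_distrib]
  exact Finset.sum_congr rfl fun s hs => (Nat.sub_add_cancel (hm s hs)).symm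

theorem piMat_mulVec (x : nodes m (k + 1) → ℝ) (s : nodes m k) :
    (piMat m k).mulVec x s = ∑ t ∈ Finset.range (m s.1), ext0 x (t :: s.1) := by
  have : (piMat m k).mulVec x s
      = ∑ i : nodes m (k + 1), (if i.1.tail = s.1 then ext0 x i else 0) := by
    refine Finset.sum_congr rfl fun i _ => ?_
    simp [piMat]
  rw [this, sum_nodes_succ fun i => if i.tail = s.1 then ext0 x i else 0]
  simp only [List.tail_cons]
  rw [Finset.sum_eq_single_of_mem s.1 s.2]
  · simp
  · intro s' _ hne
    simp [hne]

theorem piMat_surjective (hm : ∀ s ∈ nodes m k, 0 < m s) :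
    Function.Surjective (piMat m k).mulVecLin := by
  intro z
  -- The preimage puts the value at s on the first child of s and zero on the others.
  refine ⟨fun i => if i.1.headI = 0 then ext0 z i.1.tail else 0, ?_⟩
  funext s
  rw [Matrix.mulVecLin_apply, piMat_mulVec]
  have h : ∀ t ∈ Finset.range (m s.1), ext0 (fun i : nodes m (k + 1) =>
      if i.1.headI = 0 then ext0 z i.1.tail else 0) (t :: s.1) = if t = 0 then z s else 0 := by
    intro t ht
    have := ext0_coe (fun i : nodes m (k + 1) =>
      if i.1.headI = 0 then ext0 z i.1.tail else 0)
      ⟨t :: s.1, cons_mem_nodes s.2 (Finset.mem_range.1 ht)⟩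
    rw [this]
    simp
  rw [Finset.sum_congr rfl h, Finset.sum_ite_eq' ]
  simp [hm s.1 s.2]

theorem finrank_ker_piMat (hm : ∀ s ∈ nodes m k, 0 < m s) :
    Module.finrank ℝ (LinearMap.ker (piMat m k).mulVecLin) = (subNodes m (k + 1)).card := by
  have h := LinearMap.finrank_range_add_finrank_ker (piMat m k).mulVecLin
  rw [LinearMap.range_eq_top.2 (piMat_surjective hm), finrank_top, Module.finrank_pi,
    Module.finrank_pi, Fintype.card_coe, Fintype.card_coe, card_nodes_succ hm] at h
  omega

/-- The rows of an admissible matrix are linearly independent. -/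
theorem IsAdmissible.injective (hm : ∀ s ∈ nodes m k, 0 < m s)
    {W : Matrix (subNodes m (k + 1)) (nodes m (k + 1)) ℝ} (hW : IsAdmissible m k W) :
    Function.Injective W.transpose.mulVec := by
  have h := LinearMap.finrank_range_add_finrank_ker W.transpose.mulVecLin
  rw [hW, finrank_ker_piMat hm, Module.finrank_pi, Fintype.card_coe] at h
  have h0 : Module.finrank ℝ (LinearMap.ker W.transpose.mulVecLin) = 0 := by omega
  exact LinearMap.ker_eq_bot.1 (Submodule.finrank_eq_zero.1 h0)

/-- By rank–nullity Ker π has dimension |𝒥|, so an injective Wᵀ with range inside the kernel fills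
it. -/
theorem isAdmissible_of_injective (hm : ∀ s ∈ nodes m k, 0 < m s)
    {W : Matrix (subNodes m (k + 1)) (nodes m (k + 1)) ℝ}
    (hinj : Function.Injective W.transpose.mulVec)
    (h0 : ∀ y, (piMat m k).mulVec (W.transpose.mulVec y) = 0) : IsAdmissible m k W := by
  refine Submodule.eq_of_le_of_finrank_eq ?_ ?_
  · rintro _ ⟨y, rfl⟩
    exact h0 y
  · rw [finrank_ker_piMat hm, LinearMap.finrank_range_of_inj (f := W.transpose.mulVecLin) hinj,
      Module.finrank_pi, Fintype.card_coe]

/-- The block diagonal matrix with blocks `R`. -/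
def blockMat (m : List ℕ → ℕ) (k : ℕ) (R : ℕ → ℕ → ℝ) :
    Matrix (subNodes m (k + 1)) (nodes m (k + 1)) ℝ :=
  Matrix.of fun j i => if j.1.tail = i.1.tail then R j.1.headI i.1.headI else 0

theorem blockMat_transpose_mulVec (R : ℕ → ℕ → ℝ) (y : subNodes m (k + 1) → ℝ)
    {s : List ℕ} (hs : s ∈ nodes m k) {t' : ℕ} (ht' : t' < m s) :
    ext0 ((blockMat m k R).transpose.mulVec y) (t' :: s)
      = ∑ t ∈ Finset.range (m s - 1), R t t' * ext0 y (t :: s) := by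
  rw [ext0_coe _ ⟨t' :: s, cons_mem_nodes hs ht'⟩]
  have : (blockMat m k R).transpose.mulVec y ⟨t' :: s, cons_mem_nodes hs ht'⟩
      = ∑ j : subNodes m (k + 1), (if j.1.tail = s then R j.1.headI t' * ext0 y j else 0) := by
    refine Finset.sum_congr rfl fun j _ => ?_
    by_cases h : j.1.tail = s <;> simp [blockMat, h]
  rw [this, sum_subNodes_succ fun j => if j.tail = s then R j.headI t' * ext0 y j else 0]
  simp only [List.tail_cons, List.headI_cons]
  rw [Finset.sum_eq_single_of_mem s hs]
  · simp
  · intro s' _ hne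
    simp [hne]

/-- π sums over the children of each node, so after exchanging the sums only the row sums of the
blocks appear. -/
theorem piMat_blockMat (R : ℕ → ℕ → ℝ)
    (hR : ∀ N t, t < N - 1 → ∑ t' ∈ Finset.range N, R t t' = 0) (y : subNodes m (k + 1) → ℝ) :
    (piMat m k).mulVec ((blockMat m k R).transpose.mulVec y) = 0 := by
  funext s
  rw [piMat_mulVec, Finset.sum_congr rfl fun t' ht' =>
    blockMat_transpose_mulVec R y s.2 (Finset.mem_range.1 ht'), Finset.sum_comm]
  refine Finset.sum_eq_zero fun t ht => ?_
  rw [← Finset.sum_mul, hR _ _ (Finset.mem_range.1 ht), zero_mul]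

theorem dotProduct_self_nodes (x : nodes m (k + 1) → ℝ) :
    x ⬝ᵥ x = ∑ s ∈ nodes m k, ∑ t ∈ Finset.range (m s), ext0 x (t :: s) ^ 2 := by
  rw [← sum_nodes_succ fun i => ext0 x i ^ 2]
  exact Finset.sum_congr rfl fun i _ => by rw [ext0_coe, sq]

theorem dotProduct_self_subNodes (y : subNodes m (k + 1) → ℝ) :
    y ⬝ᵥ y = ∑ s ∈ nodes m k, ∑ t ∈ Finset.range (m s - 1), ext0 y (t :: s) ^ 2 := by
  rw [← sum_subNodes_succ fun i => ext0 y i ^ 2]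
  exact Finset.sum_congr rfl fun i _ => by rw [ext0_coe, sq]

theorem dotProduct_mul_transpose_mulVec {p n : Type*} [Fintype p] [Fintype n]
    (W : Matrix p n ℝ) (y : p → ℝ) :
    y ⬝ᵥ (W * W.transpose).mulVec y = W.transpose.mulVec y ⬝ᵥ W.transpose.mulVec y := by
  rw [← Matrix.mulVec_mulVec, Matrix.dotProduct_mulVec, Matrix.mulVec_transpose]

theorem injective_of_le {p n : Type*} [Fintype p] [Fintype n] (V : Matrix n p ℝ) {c : ℝ}
    (hc : 0 < c) (h : ∀ y : p → ℝ, c * (y ⬝ᵥ y) ≤ V.mulVec y ⬝ᵥ V.mulVec y) :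
    Function.Injective V.mulVec := by
  refine (injective_iff_map_eq_zero V.mulVecLin).2 fun y hy => ?_
  have h1 := h y
  rw [show V.mulVec y = 0 from hy, dotProduct_zero] at h1
  have h2 := dotProduct_self_nonneg' y
  exact dotProduct_self_eq_zero.1 (le_antisymm (by nlinarith) h2)

/-! #### The difference matrix -/

/-- The rows of the difference matrix. -/
def diffRow (t t' : ℕ) : ℝ := (if t = t' then 1 else 0) - (if t + 1 = t' then 1 else 0)

theorem diffW_eq : diffW m k = blockMat m k diffRow := rfl

theorem sum_diffRow (N t : ℕ) (h : t < N - 1) : ∑ t' ∈ Finset.range N, diffRow t t' = 0 := by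
  have h1 : t < N := by omega
  have h2 : t + 1 < N := by omega
  simp [diffRow, Finset.sum_sub_distrib, h1, h2]

/-- On a block, the transpose acts as the backward difference of Y extended by zero at both ends.
The two conditionals are these boundary values. -/
theorem sum_diffRow_mul (n t' : ℕ) (Y : ℕ → ℝ) :
    ∑ t ∈ Finset.range n, diffRow t t' * Y t = (if t' < n then Y t' else 0) -
      (if t' ≠ 0 ∧ t' - 1 < n then Y (t' - 1) else 0) := by
  simp only [diffRow, sub_mul, Finset.sum_sub_distrib, ite_mul, one_mul, zero_mul]
  congr 1
  · simp
  · rcases t' with _ | t'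
    · simp
    · simp

theorem sum_range_sum_diffRow_mul {n t : ℕ} (ht : t < n) (Y : ℕ → ℝ) :
    ∑ t' ∈ Finset.range (t + 1), ∑ u ∈ Finset.range n, diffRow u t' * Y u = Y t := by
  induction t with
  | zero => simp [sum_diffRow_mul, ht]
  | succ t ih =>
    rw [Finset.sum_range_succ, ih (by omega), sum_diffRow_mul]
    simp [ht, show t < n by omega]

/-- A discrete Poincaré inequality. Y t telescopes into t + 1 differences, Cauchy–Schwarz costs the
factor t + 1, and these factors add up to N(N - 1)/2 ≤ N²/2. -/
theorem sum_sq_le_diff (N : ℕ) (Y : ℕ → ℝ) :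
    ∑ t ∈ Finset.range (N - 1), Y t ^ 2 ≤ (N : ℝ) ^ 2 / 2 *
      ∑ t' ∈ Finset.range N, (∑ t ∈ Finset.range (N - 1), diffRow t t' * Y t) ^ 2 := by
  set z : ℕ → ℝ := fun t' => ∑ t ∈ Finset.range (N - 1), diffRow t t' * Y t with hz
  have h0 : 0 ≤ ∑ t' ∈ Finset.range N, z t' ^ 2 := Finset.sum_nonneg fun _ _ => sq_nonneg _
  have h1 : ∀ t ∈ Finset.range (N - 1), Y t ^ 2 ≤ ((t : ℝ) + 1) * ∑ t' ∈ Finset.range N, z t' ^ 2 := by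
    intro t ht
    rw [Finset.mem_range] at ht
    rw [← sum_range_sum_diffRow_mul ht Y]
    refine (sq_sum_le_card_mul_sum_sq (s := Finset.range (t + 1)) (f := z)).trans ?_
    rw [Finset.card_range]
    push_cast
    refine mul_le_mul_of_nonneg_left ?_ (by positivity)
    exact Finset.sum_le_sum_of_subset_of_nonneg (Finset.range_mono (by omega))
      fun _ _ _ => sq_nonneg _
  refine (Finset.sum_le_sum h1).trans ?_
  rw [← Finset.sum_mul]
  refine mul_le_mul_of_nonneg_right ?_ h0
  have h2 : ∀ n : ℕ, ∑ t ∈ Finset.range n, ((t : ℝ) + 1) = n * (n + 1) / 2 := by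
    intro n
    induction n with
    | zero => simp
    | succ n ih => rw [Finset.sum_range_succ, ih]; push_cast; ring
  rw [h2]
  rcases N with _ | N
  · simp
  · push_cast
    have : (0 : ℝ) ≤ N := by positivity
    nlinarith

theorem sum_sq_diff_le (N : ℕ) (Y : ℕ → ℝ) :
    ∑ t' ∈ Finset.range N, (∑ t ∈ Finset.range (N - 1), diffRow t t' * Y t) ^ 2
      ≤ 4 * ∑ t ∈ Finset.range (N - 1), Y t ^ 2 := by
  rcases N with _ | n
  · simp
  simp only [sum_diffRow_mul, Nat.add_sub_cancel]
  have h1 : ∀ t' ∈ Finset.range (n + 1), ((if t' < n then Y t' else 0) -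
      (if t' ≠ 0 ∧ t' - 1 < n then Y (t' - 1) else 0)) ^ 2 ≤ 2 * (if t' < n then Y t' ^ 2 else 0) +
      2 * (if t' ≠ 0 ∧ t' - 1 < n then Y (t' - 1) ^ 2 else 0) := by
    intro t' _
    split_ifs <;> nlinarith [sq_nonneg (Y t' + Y (t' - 1)), sq_nonneg (Y t'), sq_nonneg (Y (t' - 1))]
  refine (Finset.sum_le_sum h1).trans ?_
  rw [Finset.sum_add_distrib, ← Finset.mul_sum, ← Finset.mul_sum, Finset.sum_range_succ,
    Finset.sum_range_succ' (fun t' => if t' ≠ 0 ∧ t' - 1 < n then Y (t' - 1) ^ 2 else 0)]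
  have e1 : ∑ t ∈ Finset.range n, (if t < n then Y t ^ 2 else 0) = ∑ t ∈ Finset.range n, Y t ^ 2 :=
    Finset.sum_congr rfl fun t ht => by simp [Finset.mem_range.1 ht]
  have e2 : ∑ t ∈ Finset.range n, (if t + 1 ≠ 0 ∧ t + 1 - 1 < n then Y (t + 1 - 1) ^ 2 else 0)
      = ∑ t ∈ Finset.range n, Y t ^ 2 :=
    Finset.sum_congr rfl fun t ht => by simp [Finset.mem_range.1 ht]
  rw [e1, e2]
  simp
  linarith

theorem sum_sq_blockMat (R : ℕ → ℕ → ℝ) (y : subNodes m (k + 1) → ℝ) :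
    (blockMat m k R).transpose.mulVec y ⬝ᵥ (blockMat m k R).transpose.mulVec y
      = ∑ s ∈ nodes m k, ∑ t' ∈ Finset.range (m s),
        (∑ t ∈ Finset.range (m s - 1), R t t' * ext0 y (t :: s)) ^ 2 := by
  rw [dotProduct_self_nodes]
  exact Finset.sum_congr rfl fun s hs => Finset.sum_congr rfl fun t' ht' => by
    rw [blockMat_transpose_mulVec R y hs (Finset.mem_range.1 ht')]

theorem diffW_lower {M : ℝ} (hM : ∀ s ∈ nodes m k, (m s : ℝ) ≤ M) (y : subNodes m (k + 1) → ℝ) :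
    y ⬝ᵥ y ≤ M ^ 2 / 2 *
      ((diffW m k).transpose.mulVec y ⬝ᵥ (diffW m k).transpose.mulVec y) := by
  rw [diffW_eq, sum_sq_blockMat, dotProduct_self_subNodes, Finset.mul_sum]
  refine Finset.sum_le_sum fun s hs => (sum_sq_le_diff (m s) fun t => ext0 y (t :: s)).trans ?_
  refine mul_le_mul_of_nonneg_right ?_ (Finset.sum_nonneg fun _ _ => sq_nonneg _)
  have := pow_le_pow_left₀ (by positivity) (hM s hs) 2
  linarith

theorem diffW_upper (y : subNodes m (k + 1) → ℝ) :
    (diffW m k).transpose.mulVec y ⬝ᵥ (diffW m k).transpose.mulVec y ≤ 4 * (y ⬝ᵥ y) := by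
  rw [diffW_eq, sum_sq_blockMat, dotProduct_self_subNodes, Finset.mul_sum]
  exact Finset.sum_le_sum fun s hs => sum_sq_diff_le (m s) fun t => ext0 y (t :: s)

theorem isSymm_mul_transpose_self' {p n : Type*} [Fintype n] (W : Matrix p n ℝ) :
    (W * W.transpose).IsSymm := by
  rw [Matrix.IsSymm, Matrix.transpose_mul, Matrix.transpose_transpose]

theorem condNum_diffW_le {M : ℝ} (hM0 : 0 < M) (hM : ∀ s ∈ nodes m k, (m s : ℝ) ≤ M) :
    condNum (diffW m k * (diffW m k).transpose) ≤ 2 * M ^ 2 := by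
  have h := condNum_le (isSymm_mul_transpose_self' (diffW m k)) (c := 2 / M ^ 2) (C := 4)
    (by positivity) (by norm_num) (fun y => by
      rw [dotProduct_mul_transpose_mulVec]
      have := diffW_lower hM y
      rw [div_mul_eq_mul_div, div_le_iff₀ (by positivity)]
      linarith) (fun y => by
      rw [dotProduct_mul_transpose_mulVec]
      exact diffW_upper y)
  refine h.trans (le_of_eq ?_)
  field_simp
  norm_num

theorem isAdmissible_diffW (hm : ∀ s ∈ nodes m k, 0 < m s) : IsAdmissible m k (diffW m k) := by
  obtain ⟨M, hM⟩ : ∃ M : ℕ, ∀ s ∈ nodes m k, m s ≤ M :=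
    ⟨(nodes m k).sup m, fun s hs => Finset.le_sup hs⟩
  refine isAdmissible_of_injective hm (injective_of_le _ (c := 2 / ((M : ℝ) + 1) ^ 2)
    (by positivity) fun y => ?_) (piMat_blockMat diffRow sum_diffRow)
  have := diffW_lower (m := m) (k := k) (M := (M : ℝ) + 1) (fun s hs => by
    have : (m s : ℝ) ≤ M := by exact_mod_cast hM s hs
    linarith) y
  rw [div_mul_eq_mul_div, div_le_iff₀ (by positivity)]
  linarith

/-! #### The orthonormal matrix -/

/-- The normalized rows of the orthonormal matrix. -/
noncomputable def orthRow' (t t' : ℕ) : ℝ :=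
  orthRow t t' / Real.sqrt (((t : ℝ) + 1) * ((t : ℝ) + 2))

theorem sum_orthRow_mul {N t : ℕ} (h : t + 1 < N) (g : ℕ → ℝ) :
    ∑ t' ∈ Finset.range N, orthRow t t' * g t'
      = (∑ t' ∈ Finset.range (t + 1), g t') - (t + 1) * g (t + 1) := by
  induction N, h using Nat.le_induction with
  | base =>
    rw [Finset.sum_range_succ, sub_eq_add_neg]
    congr 1
    · refine Finset.sum_congr rfl fun t' ht' => ?_
      have := Finset.mem_range.1 ht'
      simp [orthRow, show t' ≤ t by omega]
    · simp [orthRow]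
      ring
  | succ N hN ih =>
    rw [Finset.sum_range_succ, ih]
    have h1 : ¬ N ≤ t := by omega
    have h2 : N ≠ t + 1 := by omega
    simp [orthRow, h1, h2]

theorem sum_orthRow (N t : ℕ) (h : t < N - 1) : ∑ t' ∈ Finset.range N, orthRow' t t' = 0 := by
  have := sum_orthRow_mul (N := N) (t := t) (by omega) fun _ => 1
  simp only [orthRow', ← Finset.sum_div]
  simp only [mul_one, Finset.sum_const, Finset.card_range, nsmul_eq_mul] at this
  rw [this]
  push_cast
  simp

/-- If t < u, row u is constantly 1 where row t is nonzero, and the entries of row t sum to zero. On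
the diagonal the normalization is (t + 1) + (t + 1)² = (t + 1)(t + 2). -/
theorem sum_orthRow_mul_orthRow {N t u : ℕ} (ht : t < N - 1) (hu : u < N - 1) :
    ∑ t' ∈ Finset.range N, orthRow' t t' * orthRow' u t' = if t = u then 1 else 0 := by
  have lt : ∀ {t u : ℕ}, t < u → u < N - 1 →
      ∑ t' ∈ Finset.range N, orthRow t t' * orthRow u t' = 0 := by
    intro t u h hu
    rw [sum_orthRow_mul (by omega)]
    have h1 : ∀ t' ∈ Finset.range (t + 1), orthRow u t' = 1 := fun t' ht' => by
      have := Finset.mem_range.1 ht'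
      simp [orthRow, show t' ≤ u by omega]
    rw [Finset.sum_congr rfl h1]
    simp [orthRow, show t + 1 ≤ u by omega]
  have e : ∑ t' ∈ Finset.range N, orthRow' t t' * orthRow' u t'
      = (∑ t' ∈ Finset.range N, orthRow t t' * orthRow u t') /
        (Real.sqrt (((t : ℝ) + 1) * ((t : ℝ) + 2)) * Real.sqrt (((u : ℝ) + 1) * ((u : ℝ) + 2))) := by
    rw [Finset.sum_div]
    exact Finset.sum_congr rfl fun t' _ => by rw [orthRow', orthRow', div_mul_div_comm]
  rw [e]
  rcases lt_trichotomy t u with h | rfl | h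
  · rw [lt h hu, zero_div, if_neg h.ne]
  · rw [sum_orthRow_mul (by omega), Real.mul_self_sqrt (by positivity), if_pos rfl]
    have h1 : ∀ t' ∈ Finset.range (t + 1), orthRow t t' = 1 := fun t' ht' => by
      have := Finset.mem_range.1 ht'
      simp [orthRow, show t' ≤ t by omega]
    rw [Finset.sum_congr rfl h1]
    have h2 : orthRow t (t + 1) = -((t : ℝ) + 1) := by simp [orthRow]
    rw [h2, div_eq_one_iff_eq (by positivity)]
    simp
    ring
  · rw [if_neg h.ne']
    simp only [mul_comm (orthRow t _)]
    rw [lt h ht, zero_div]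

theorem orthW_mul_transpose : orthW m k * (orthW m k).transpose = 1 := by
  ext j j'
  obtain ⟨s, hs, t, ht, hj⟩ := mem_subNodes_succ.1 j.2
  obtain ⟨s', hs', t', ht', hj'⟩ := mem_subNodes_succ.1 j'.2
  have e : (orthW m k * (orthW m k).transpose) j j' = ∑ i : nodes m (k + 1),
      (if s = i.1.tail then orthRow' t i.1.headI else 0) *
      (if s' = i.1.tail then orthRow' t' i.1.headI else 0) := by
    refine Finset.sum_congr rfl fun i _ => ?_
    change blockMat m k orthRow' j i * blockMat m k orthRow' j' i = _
    simp [blockMat, ← hj, ← hj']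
  rw [e, sum_nodes_succ fun i => (if s = i.tail then orthRow' t i.headI else 0) *
      (if s' = i.tail then orthRow' t' i.headI else 0)]
  simp only [List.tail_cons, List.headI_cons]
  rw [Finset.sum_eq_single_of_mem s hs]
  · by_cases hss : s' = s
    · subst hss
      simp only [if_true]
      rw [sum_orthRow_mul_orthRow ht ht', Matrix.one_apply]
      refine if_congr ?_ rfl rfl
      rw [Subtype.ext_iff, ← hj, ← hj']
      simp
    · have hne : j ≠ j' := fun h => hss (by
        rw [Subtype.ext_iff, ← hj, ← hj'] at h
        exact (List.cons.inj h).2.symm)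
      simp [hss, Matrix.one_apply_ne hne]
  · intro s'' _ hne
    simp [hne.symm]

theorem condNum_one {n : Type*} [Fintype n] [DecidableEq n] [Nonempty n] :
    condNum (1 : Matrix n n ℝ) = 1 := by
  have hs : (1 : Matrix n n ℝ).IsSymm := Matrix.transpose_one
  refine le_antisymm ?_ ?_
  · simpa using condNum_le hs (c := 1) (C := 1) one_pos zero_le_one (by simp) (by simp)
  · obtain ⟨l, L, hl, hL, h1, h2, h3⟩ := exists_condNum_eq hs (fun x hx => by
      rw [Matrix.one_mulVec]
      exact lt_of_le_of_ne (dotProduct_self_nonneg' x)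
        fun h => hx (dotProduct_self_eq_zero.1 h.symm))
    rw [h3, one_le_div hl]
    have a1 := h1 1
    have a2 := h2 1
    have : (0 : ℝ) < (1 : n → ℝ) ⬝ᵥ 1 := by simp [Fintype.card_pos]
    exact le_of_mul_le_mul_right (a1.trans a2) this

theorem isAdmissible_orthW (hm : ∀ s ∈ nodes m k, 0 < m s) : IsAdmissible m k (orthW m k) := by
  refine isAdmissible_of_injective hm (injective_of_le _ one_pos fun y => ?_)
    (piMat_blockMat orthRow' sum_orthRow)
  rw [← dotProduct_mul_transpose_mulVec, orthW_mul_transpose]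
  simp

end Tree


/-! ### Constrained minimization for a coercive symmetric form -/

section Abstract

variable {X : Type*} [NormedAddCommGroup X] [InnerProductSpace ℝ X] {B : X →L[ℝ] X →L[ℝ] ℝ}
  {ι : Type*} [Fintype ι]

theorem IsCoercive.self_nonneg (hB : IsCoercive B) (u : X) : 0 ≤ B u u := by
  obtain ⟨C, hC, h⟩ := hB
  exact (by positivity : 0 ≤ C * ‖u‖ * ‖u‖).trans (h u)

theorem IsCoercive.eq_zero (hB : IsCoercive B) {u : X} (hu : B u u ≤ 0) : u = 0 := by
  obtain ⟨C, hC, h⟩ := hB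
  have h1 := (h u).trans hu
  by_contra hne
  have : 0 < ‖u‖ := norm_pos_iff.2 hne
  have : 0 < C * ‖u‖ * ‖u‖ := by positivity
  linarith

theorem IsCoercive.sq_le (hB : IsCoercive B) (hs : ∀ u v, B u v = B v u) (u v : X) :
    B u v ^ 2 ≤ B u u * B v v := by
  let B' : X →ₗ[ℝ] X →ₗ[ℝ] ℝ := LinearMap.mk₂ ℝ (fun u v => B u v) (by simp) (by simp) (by simp)
    (by simp)
  exact LinearMap.BilinForm.apply_sq_le_of_symm B' (fun u => IsCoercive.self_nonneg hB u)
    ⟨fun u v => hs u v⟩ u v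

/-- Lax–Milgram, combined with the Riesz representation of ℓ in the ambient inner product. -/
theorem IsCoercive.exists_representer [CompleteSpace X] (hB : IsCoercive B) (ℓ : X →L[ℝ] ℝ) :
    ∃ u, ∀ w, B u w = ℓ w := by
  refine ⟨hB.continuousLinearEquivOfBilin.symm ((InnerProductSpace.toDual ℝ X).symm ℓ), fun w => ?_⟩
  rw [← hB.continuousLinearEquivOfBilin_apply]
  simp

theorem sum_smul_apply (x : ι → ℝ) (P : ι → X) (w : X) :
    B (∑ i, x i • P i) w = ∑ i, x i * B (P i) w := by
  simp

/-- The dual basis: elements `P i` satisfying the constraints whose images under the form are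
combinations of the constraint functionals. -/
theorem IsCoercive.exists_dual [DecidableEq ι] [CompleteSpace X] (hB : IsCoercive B) (hs : ∀ u v, B u v = B v u)
    (ℓ : ι → X →L[ℝ] ℝ) {b : ι → X} {β : ℝ} (hβ : β ≠ 0)
    (hb : ∀ i j, ℓ i (b j) = if i = j then β else 0) :
    ∃ (P : ι → X) (C : Matrix ι ι ℝ), (∀ i j, ℓ j (P i) = if i = j then 1 else 0) ∧
      (∀ i w, B (P i) w = ∑ j, C i j * ℓ j w) ∧
      ∀ w, (∀ i, B (P i) w = 0) → ∀ i, ℓ i w = 0 := by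
  -- Θ is the Gram matrix of the representers in the form B. If Θx = 0 then ∑ x_j u_j has zero
  -- energy and vanishes, and testing it against b_j gives β x_j = 0; so Θ is invertible and P =
  -- Θ⁻¹u is dual. The same invertibility yields the last claim.
  choose u hu using fun i => IsCoercive.exists_representer hB (ℓ i)
  set Θ : Matrix ι ι ℝ := Matrix.of fun i j => ℓ i (u j) with hΘ
  have hsymm : ∀ i j, Θ i j = Θ j i := fun i j => by
    simp only [hΘ, Matrix.of_apply]
    rw [← hu, ← hu, hs]
  have hinj : Function.Injective Θ.mulVec := by
    refine (injective_iff_map_eq_zero Θ.mulVecLin).2 fun x hx => ?_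
    have e0 : ∀ i, ℓ i (∑ j, x j • u j) = 0 := fun i => by
      have h1 : Θ.mulVec x i = 0 := congrFun hx i
      rw [← h1]
      simp [hΘ, Matrix.mulVec, dotProduct, mul_comm]
    have e1 : B (∑ j, x j • u j) (∑ j, x j • u j) = 0 := by
      rw [sum_smul_apply]
      exact Finset.sum_eq_zero fun i _ => by rw [hu, e0, mul_zero]
    have e2 := IsCoercive.eq_zero hB e1.le
    funext j
    have e3 : B (∑ i, x i • u i) (b j) = 0 := by rw [e2]; simp
    rw [sum_smul_apply] at e3
    simp only [hu, hb, mul_ite, mul_zero, Finset.sum_ite_eq', Finset.mem_univ, if_true] at e3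
    exact (mul_eq_zero.1 e3).resolve_right hβ
  have hunit : IsUnit Θ.det := (Matrix.isUnit_iff_isUnit_det Θ).1
    (Matrix.mulVec_injective_iff_isUnit.1 hinj)
  have hmul : Θ⁻¹ * Θ = 1 := Matrix.nonsing_inv_mul Θ hunit
  have hmul' : Θ * Θ⁻¹ = 1 := Matrix.mul_nonsing_inv Θ hunit
  refine ⟨fun i => ∑ j, Θ⁻¹ i j • u j, Θ⁻¹, fun i j => ?_, fun i w => ?_, fun w hw i => ?_⟩
  · have : ℓ j (∑ l, Θ⁻¹ i l • u l) = (Θ⁻¹ * Θ) i j := by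
      simp only [map_sum, map_smul, smul_eq_mul, Matrix.mul_apply]
      exact Finset.sum_congr rfl fun l _ => by rw [hsymm l j]; rfl
    rw [this, hmul, Matrix.one_apply]
  · rw [sum_smul_apply]
    simp only [hu]
  · have h1 : (Θ⁻¹).mulVec (fun j => ℓ j w) = 0 := by
      funext i
      have := hw i
      rw [sum_smul_apply] at this
      simp only [hu] at this
      exact this
    have h2 : (fun j => ℓ j w) = 0 := by
      rw [← Matrix.one_mulVec (fun j => ℓ j w), ← hmul', ← Matrix.mulVec_mulVec, h1,
        Matrix.mulVec_zero]
    exact congrFun h2 i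

/-- The energy splitting of an element that satisfies the constraints. -/
theorem apply_self_eq_add (hs : ∀ u v, B u v = B v u) {ℓ : ι → X →L[ℝ] ℝ} {p ψ : X} {c : ι → ℝ}
    (hp : ∀ w, B p w = ∑ j, c j * ℓ j w) (h : ∀ j, ℓ j ψ = ℓ j p) :
    B ψ ψ = B p p + B (ψ - p) (ψ - p) := by
  have h1 : B p (ψ - p) = 0 := by
    rw [hp]
    exact Finset.sum_eq_zero fun j _ => by rw [map_sub, h, sub_self, mul_zero]
  have h2 : B (ψ - p) p = 0 := by rw [hs]; exact h1
  have h3 : ψ = p + (ψ - p) := by abel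
  conv_lhs => rw [h3]
  simp only [map_add, add_apply, h1, h2]
  ring

/-! ### Inverse inequality and energy bound from a family of orthogonal bumps. -/

section Estimates

variable {ℓ : ι → X →L[ℝ] ℝ} {b : ι → X} {β Γ : ℝ}

/-- The inverse inequality. -/
theorem IsCoercive.sum_sq_le [DecidableEq ι] (hB : IsCoercive B) (hs : ∀ u v, B u v = B v u) (hβ : β ≠ 0)
    (hb : ∀ i j, ℓ i (b j) = if i = j then β else 0)
    (hb0 : ∀ i j, i ≠ j → B (b i) (b j) = 0) (hbΓ : ∀ i, B (b i) (b i) ≤ Γ * β ^ 2)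
    {v : X} {c : ι → ℝ} (hv : ∀ w, B v w = ∑ j, c j * ℓ j w) :
    ∑ j, c j ^ 2 ≤ Γ * B v v := by
  set S := ∑ j, c j ^ 2 with hS
  have hS0 : 0 ≤ S := Finset.sum_nonneg fun _ _ => sq_nonneg _
  -- The test element ∑ c_j b_j pairs with v to βS and has energy at most Γβ²S, so Cauchy–Schwarz
  -- gives S ≤ Γ B v v after division by β²S.
  have h1 : B v (∑ j, c j • b j) = β * S := by
    rw [hv, hS, Finset.mul_sum]
    refine Finset.sum_congr rfl fun j _ => ?_
    simp only [map_sum, map_smul, hb, smul_eq_mul, mul_ite, mul_zero, Finset.sum_ite_eq,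
      Finset.mem_univ, if_true]
    ring
  have h2 : B (∑ j, c j • b j) (∑ j, c j • b j) ≤ Γ * β ^ 2 * S := by
    rw [sum_smul_apply, hS, Finset.mul_sum]
    refine Finset.sum_le_sum fun i _ => ?_
    rw [map_sum, Finset.sum_eq_single i]
    · rw [map_smul, smul_eq_mul, ← mul_assoc, ← sq, mul_comm]
      exact mul_le_mul_of_nonneg_right (hbΓ i) (sq_nonneg _)
    · intro j _ hne
      rw [map_smul, hb0 i j hne.symm, smul_zero]
    · simp
  have h3 := IsCoercive.sq_le hB hs v (∑ j, c j • b j)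
  rw [h1] at h3
  have h4 := IsCoercive.self_nonneg hB v
  rcases hS0.eq_or_lt with h | h
  · rw [← h]
    -- When S = 0 only the sign of Γ is needed; it comes from the energy of one bump, or the index
    -- set is empty and the energy of v vanishes.
    rcases isEmpty_or_nonempty ι with hι | ⟨⟨i⟩⟩
    · have : B v v = 0 := by rw [hv]; simp
      rw [this, mul_zero]
    · have h5 := (IsCoercive.self_nonneg hB (b i)).trans (hbΓ i)
      have h6 : 0 ≤ Γ := nonneg_of_mul_nonneg_left h5 (by positivity)
      positivity
  · have h5 : (β * S) ^ 2 ≤ B v v * (Γ * β ^ 2 * S) :=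
      h3.trans (mul_le_mul_of_nonneg_left h2 h4)
    have h6 : 0 < β ^ 2 * S := by positivity
    refine le_of_mul_le_mul_right ?_ h6
    calc S * (β ^ 2 * S) = (β * S) ^ 2 := by ring
      _ ≤ _ := h5
      _ = _ := by ring

variable {P : ι → X} {C : Matrix ι ι ℝ}

theorem sum_smul_apply_eq (hC : ∀ i w, B (P i) w = ∑ j, C i j * ℓ j w) (x : ι → ℝ) (w : X) :
    B (∑ i, x i • P i) w = ∑ j, C.transpose.mulVec x j * ℓ j w := by
  rw [sum_smul_apply]
  simp only [hC, Finset.mul_sum]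
  rw [Finset.sum_comm]
  refine Finset.sum_congr rfl fun j _ => ?_
  simp only [Matrix.mulVec, dotProduct, Matrix.transpose_apply, Finset.sum_mul]
  exact Finset.sum_congr rfl fun i _ => by ring

theorem apply_sum_smul [DecidableEq ι] (hP : ∀ i j, ℓ j (P i) = if i = j then 1 else 0) (x : ι → ℝ) (j : ι) :
    ℓ j (∑ i, x i • P i) = x j := by
  simp [hP]

theorem quadForm_gram (x : ι → ℝ) :
    x ⬝ᵥ (Matrix.of fun i j => B (P i) (P j)).mulVec x
      = B (∑ i, x i • P i) (∑ i, x i • P i) := by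
  rw [sum_smul_apply]
  refine Finset.sum_congr rfl fun i _ => ?_
  rw [map_sum]
  congr 1
  exact Finset.sum_congr rfl fun j _ => by simp [mul_comm]

/-- The upper bound on the stiffness matrix. -/
theorem IsCoercive.quadForm_le [DecidableEq ι] (hB : IsCoercive B) (hs : ∀ u v, B u v = B v u) (hβ : β ≠ 0)
    (hb : ∀ i j, ℓ i (b j) = if i = j then β else 0)
    (hb0 : ∀ i j, i ≠ j → B (b i) (b j) = 0) (hbΓ : ∀ i, B (b i) (b i) ≤ Γ * β ^ 2)
    (hP : ∀ i j, ℓ j (P i) = if i = j then 1 else 0)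
    (hC : ∀ i w, B (P i) w = ∑ j, C i j * ℓ j w) (x : ι → ℝ) :
    B (∑ i, x i • P i) (∑ i, x i • P i) ≤ Γ * (x ⬝ᵥ x) := by
  set v := ∑ i, x i • P i with hv
  have h1 := IsCoercive.sum_sq_le hB hs hβ hb hb0 hbΓ (sum_smul_apply_eq hC x)
  -- With c = Cᵀx, duality gives B v v = c · x. Then (B v v)² ≤ |c|²|x|² ≤ Γ B v v |x|² by the
  -- inverse inequality.
  have h2 : B v v = C.transpose.mulVec x ⬝ᵥ x := by
    rw [hv, sum_smul_apply_eq hC]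
    exact Finset.sum_congr rfl fun j _ => by rw [apply_sum_smul hP]
  have h3 := dotProduct_sq_le (C.transpose.mulVec x) x
  rw [← h2] at h3
  have h4 : C.transpose.mulVec x ⬝ᵥ C.transpose.mulVec x ≤ Γ * B v v := by
    refine le_trans (le_of_eq ?_) h1
    exact Finset.sum_congr rfl fun j _ => (sq _).symm
  have h5 := IsCoercive.self_nonneg hB v
  have h6 := dotProduct_self_nonneg' x
  rcases h5.eq_or_lt with h | h
  · rw [← h]
    rcases isEmpty_or_nonempty ι with hι | ⟨⟨i⟩⟩
    · simp [dotProduct]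
    · have h5 := (IsCoercive.self_nonneg hB (b i)).trans (hbΓ i)
      have h6 : 0 ≤ Γ := nonneg_of_mul_nonneg_left h5 (by positivity)
      positivity
  · refine le_of_mul_le_mul_left ?_ h
    calc B v v * B v v = B v v ^ 2 := (sq _).symm
      _ ≤ _ := h3
      _ ≤ (Γ * B v v) * (x ⬝ᵥ x) := mul_le_mul_of_nonneg_right h4 h6
      _ = _ := by ring

end Estimates

end Abstract


/-! ### Partitions into convex open sets -/

/-- A finite family of disjoint open convex subsets of `Ω` of diameter at most `h` that contain
balls of diameter `δ h` and cover `Ω` up to a null set. -/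
structure IsConvexPartition {d : ℕ} (Ω : Set (E d)) {ι : Type*} (K : ι → Set (E d)) (δ h : ℝ) :
    Prop where
  δ_pos : 0 < δ
  h_pos : 0 < h
  isOpen : ∀ i, IsOpen (K i)
  convex : ∀ i, Convex ℝ (K i)
  subset : ∀ i, K i ⊆ Ω
  dist_le : ∀ i, ∀ x ∈ K i, ∀ y ∈ K i, dist x y ≤ h
  ball_subset : ∀ i, ∃ c, Metric.ball c (δ * h / 2) ⊆ K i
  disjoint : ∀ i j, i ≠ j → Disjoint (K i) (K j)
  cover : (⋃ i, K i) =ᵐ[volume] Ω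

theorem unitBall_pos (d : ℕ) : 0 < volume.real (Metric.ball (0 : E d) 1) :=
  ENNReal.toReal_pos (Metric.measure_ball_pos _ _ one_pos).ne' measure_ball_lt_top.ne

theorem volume_real_ball {d : ℕ} (c : E d) {r : ℝ} (hr : 0 < r) :
    volume.real (Metric.ball c r) = volume.real (Metric.ball (0 : E d) 1) * r ^ d := by
  rw [measureReal_def, Measure.addHaar_ball_of_pos _ _ hr, ENNReal.toReal_mul,
    ENNReal.toReal_ofReal (by positivity), mul_comm]
  simp [measureReal_def]

/-- The isodiametric radius h/2, in place of the trivial h, saves the factor 2^d needed for the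
stated constants. -/
theorem volume_real_le_of_dist_le {d : ℕ} {K : Set (E d)} (hK : MeasurableSet K)
    {h : ℝ} (hh : 0 < h) (hD : ∀ x ∈ K, ∀ y ∈ K, dist x y ≤ h) :
    volume.real K ≤ volume.real (Metric.ball (0 : E d) 1) * (h / 2) ^ d := by
  have h1 := volume_le_volume_closedBall_of_dist_le hK hD
  have h2 : volume.real K ≤ volume.real (Metric.closedBall (0 : E d) (h / 2)) :=
    ENNReal.toReal_mono measure_closedBall_lt_top.ne h1
  refine h2.trans (le_of_eq ?_)
  rw [measureReal_def, Measure.addHaar_closedBall _ _ (by positivity), ENNReal.toReal_mul,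
    ENNReal.toReal_ofReal (by positivity), mul_comm]
  simp [measureReal_def]

namespace IsConvexPartition

variable {d : ℕ} {Ω : Set (E d)} {ι : Type*} {K : ι → Set (E d)} {δ h : ℝ}

theorem measurableSet (hK : IsConvexPartition Ω K δ h) (i : ι) : MeasurableSet (K i) :=
  (hK.isOpen i).measurableSet

theorem volume_ne_top (hK : IsConvexPartition Ω K δ h) (i : ι) : volume (K i) ≠ ⊤ :=
  ne_top_of_le_ne_top measure_closedBall_lt_top.ne
    (volume_le_volume_closedBall_of_dist_le (hK.measurableSet i) (hK.dist_le i))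

theorem restrict_volume_ne_top (hK : IsConvexPartition Ω K δ h) (i : ι) :
    (volume.restrict Ω) (K i) ≠ ⊤ :=
  ne_top_of_le_ne_top (hK.volume_ne_top i) (Measure.restrict_apply_le _ _)

theorem volume_ne_zero (hK : IsConvexPartition Ω K δ h) (i : ι) : volume (K i) ≠ 0 := by
  obtain ⟨c, hc⟩ := hK.ball_subset i
  have := hK.δ_pos
  have := hK.h_pos
  exact ((Metric.measure_ball_pos volume c (by positivity)).trans_le (measure_mono hc)).ne'

theorem volume_real_le (hK : IsConvexPartition Ω K δ h) (i : ι) :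
    volume.real (K i) ≤ volume.real (Metric.ball (0 : E d) 1) * (h / 2) ^ d :=
  volume_real_le_of_dist_le (hK.measurableSet i) hK.h_pos (hK.dist_le i)

/-- The indicator function of a cell, as an element of `L²(Ω)`. -/
noncomputable def cellInd (hK : IsConvexPartition Ω K δ h) (i : ι) : L2 Ω :=
  indicatorConstLp 2 (hK.measurableSet i) (hK.restrict_volume_ne_top i) (1 : ℝ)

theorem inner_cellInd (hK : IsConvexPartition Ω K δ h) (i : ι) (f : L2 Ω) :
    inner ℝ (hK.cellInd i) f = ∫ x in K i, f x := by
  rw [cellInd, L2.inner_indicatorConstLp_one, Measure.restrict_restrict_of_subset (hK.subset i)]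

theorem inner_cellInd_cellInd [DecidableEq ι] (hK : IsConvexPartition Ω K δ h) (i j : ι) :
    inner ℝ (hK.cellInd i) (hK.cellInd j) = if i = j then volume.real (K i) else 0 := by
  rw [cellInd, cellInd, L2.real_inner_indicatorConstLp_one_indicatorConstLp_one
    (hK.measurableSet i) (hK.measurableSet j) (hK.restrict_volume_ne_top i)
    (hK.restrict_volume_ne_top j)]
  split_ifs with hij
  · subst hij
    rw [Set.inter_self, measureReal_def, measureReal_def,
      Measure.restrict_eq_self _ (hK.subset i)]
  · rw [(hK.disjoint i j hij).inter_eq]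
    simp

/-- The functional `u ↦ ∫ u` over a cell. -/
noncomputable def cellInt (hK : IsConvexPartition Ω K δ h) (i : ι) : H10 Ω →L[ℝ] ℝ :=
  (innerSL ℝ (hK.cellInd i)).comp ((WithLp.fstL 2 ℝ _ _).comp (H10 Ω).subtypeL)

theorem cellInt_apply (hK : IsConvexPartition Ω K δ h) (i : ι) (u : H10 Ω) :
    hK.cellInt i u = inner ℝ (hK.cellInd i) u.1.fst := rfl

theorem cellInt_eq_integral (hK : IsConvexPartition Ω K δ h) (i : ι) (u : H10 Ω) :
    hK.cellInt i u = ∫ x in K i, valFn u x := by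
  rw [cellInt_apply, inner_cellInd]; rfl

/-- Bump functions in the cells. -/
theorem exists_bumps [DecidableEq ι] (hK : IsConvexPartition Ω K δ h) (hd : 1 ≤ d)
    {a : E d → Matrix (Fin d) (Fin d) ℝ} {lmin lmax : ℝ} (ha : IsUniformlyElliptic Ω a lmin lmax)
    (hl : 0 ≤ lmax) :
    ∃ (b : ι → H10 Ω) (β : ℝ), 0 < β ∧ (∀ i j, hK.cellInt i (b j) = if i = j then β else 0) ∧
      (∀ i j, i ≠ j → energy a (b i) (b j) = 0) ∧
      ∀ i, energy a (b i) (b i) ≤ lmax * 2 ^ (3 + d) /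
        (volume.real (Metric.ball (0 : E d) 1) * (δ * h / 2) ^ (d + 2)) * β ^ 2 := by
  have hr : 0 < δ * h / 2 := by have := hK.δ_pos; have := hK.h_pos; positivity
  have hκ := unitBall_pos d
  obtain ⟨β, hβ, hb⟩ := exists_bump hd hr
  choose c hc using hK.ball_subset
  choose φ hφ1 hφ2 hφ3 using fun i => hb (c i)
  have hφK : ∀ i, IsTest (K i) (φ i) := fun i =>
    ⟨(hφ1 i).1, (hφ1 i).2.1, (hφ1 i).2.2.trans (hc i)⟩
  have hφΩ : ∀ i, IsTest Ω (φ i) := fun i =>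
    ⟨(hφ1 i).1, (hφ1 i).2.1, (hφK i).2.2.trans (hK.subset i)⟩
  choose b hb1 hb2 using fun i => (hφΩ i).exists_H10
  refine ⟨b, β, hβ, fun i j => ?_, fun i j hij => ?_, fun i => ?_⟩
  · rw [hK.cellInt_eq_integral]
    have e1 : ∫ x in K i, valFn (b j) x = ∫ x in K i, φ j x :=
      integral_congr_ae (ae_restrict_of_ae_restrict_of_subset (hK.subset i) (hb1 j))
    rw [e1]
    split_ifs with hij
    · subst hij
      rw [setIntegral_eq_integral_of_forall_compl_eq_zero fun x hx => (hφK i).eq_zero hx, hφ2]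
    · refine setIntegral_eq_zero_of_forall_eq_zero fun x hx => (hφK j).eq_zero fun hx' => ?_
      exact Set.disjoint_left.1 (hK.disjoint i j hij) hx hx'
  · refine integral_eq_zero_of_ae ?_
    filter_upwards [hb2 i, hb2 j] with x hx hx'
    rw [hx, hx']
    by_cases hxi : x ∈ K i
    · rw [(hφK j).gradient_eq_zero fun hxj => Set.disjoint_left.1 (hK.disjoint i j hij) hxi hxj]
      simp
    · rw [(hφK i).gradient_eq_zero hxi]
      simp
  · have h1 := ha.energy_le (b i)
    have h2 : ‖(b i).1.snd‖ ^ 2 = ∫ x, ‖gradient (φ i) x‖ ^ 2 := by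
      have : ‖(b i).1.snd‖ ^ 2 = ∫ x in Ω, ‖gradFn (b i) x‖ ^ 2 := norm_sq_eq_integral _
      have e2 : ∫ x in Ω, ‖gradient (φ i) x‖ ^ 2 = ∫ x, ‖gradient (φ i) x‖ ^ 2 :=
        setIntegral_eq_integral_of_forall_compl_eq_zero fun x hx => by
          rw [(hφΩ i).gradient_eq_zero hx]; simp
      rw [this, ← e2]
      refine integral_congr_ae ?_
      filter_upwards [hb2 i] with x hx
      rw [hx]
    rw [h2] at h1
    refine h1.trans ?_
    rw [mul_div_assoc, mul_assoc]
    refine mul_le_mul_of_nonneg_left ?_ hl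
    rw [div_mul_eq_mul_div, le_div_iff₀ (by positivity)]
    have := hφ3 i
    linarith

variable [Fintype ι]

theorem norm_sum_cellInd_sq_le (hK : IsConvexPartition Ω K δ h) (c : ι → ℝ) :
    ‖∑ i, c i • hK.cellInd i‖ ^ 2
      ≤ volume.real (Metric.ball (0 : E d) 1) * (h / 2) ^ d * ∑ i, c i ^ 2 := by
  classical
  rw [← real_inner_self_eq_norm_sq, Finset.mul_sum]
  simp only [sum_inner, inner_sum, real_inner_smul_left, real_inner_smul_right,
    hK.inner_cellInd_cellInd]
  refine Finset.sum_le_sum fun i _ => ?_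
  simp only [mul_ite, mul_zero, Finset.sum_ite_eq', Finset.mem_univ, if_true]
  have := mul_le_mul_of_nonneg_right (hK.volume_real_le i) (sq_nonneg (c i))
  linarith

/-- Bessel's inequality for the averages over the cells. -/
theorem sum_inner_sq_le (hK : IsConvexPartition Ω K δ h) (f : L2 Ω) :
    ∑ i, (inner ℝ (hK.cellInd i) f : ℝ) ^ 2
      ≤ volume.real (Metric.ball (0 : E d) 1) * (h / 2) ^ d * ‖f‖ ^ 2 := by
  set S := ∑ i, (inner ℝ (hK.cellInd i) f : ℝ) ^ 2 with hS
  set V := volume.real (Metric.ball (0 : E d) 1) * (h / 2) ^ d with hV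
  have hS0 : 0 ≤ S := Finset.sum_nonneg fun _ _ => sq_nonneg _
  -- Bessel by duality: f is tested against the combination of indicators whose coefficients are its
  -- own cell integrals.
  have h1 := hK.norm_sum_cellInd_sq_le fun i => (inner ℝ (hK.cellInd i) f : ℝ)
  have h2 : inner ℝ (∑ i, (inner ℝ (hK.cellInd i) f : ℝ) • hK.cellInd i) f = S := by
    rw [sum_inner, hS]
    exact Finset.sum_congr rfl fun i _ => by rw [real_inner_smul_left, sq]
  have h3 := real_inner_le_norm (∑ i, (inner ℝ (hK.cellInd i) f : ℝ) • hK.cellInd i) f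
  rw [h2] at h3
  have h4 : S ^ 2 ≤ V * S * ‖f‖ ^ 2 := by
    refine (pow_le_pow_left₀ hS0 h3 2).trans ?_
    rw [mul_pow]
    exact mul_le_mul_of_nonneg_right h1 (sq_nonneg _)
  have hV0 : 0 ≤ V := mul_nonneg (unitBall_pos d).le (by have := hK.h_pos; positivity)
  rcases hS0.eq_or_lt with h0 | h0
  · rw [← h0]; positivity
  · exact le_of_mul_le_mul_left (by linarith) h0

theorem integral_eq_sum (hK : IsConvexPartition Ω K δ h) {g : E d → ℝ}
    (hg : Integrable g (volume.restrict Ω)) : ∫ x in Ω, g x = ∑ i, ∫ x in K i, g x := by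
  rw [← setIntegral_congr_set hK.cover]
  refine integral_iUnion_fintype hK.measurableSet (fun i j hij => hK.disjoint i j hij) fun i => ?_
  exact hg.mono_measure (Measure.restrict_mono_set _ (hK.subset i))

/-- The Poincaré inequality for functions whose averages over the cells vanish. -/
theorem norm_fst_le (hK : IsConvexPartition Ω K δ h) {u : H10 Ω}
    (hu : ∀ i, inner ℝ (hK.cellInd i) u.1.fst = (0 : ℝ)) : ‖u.1.fst‖ ≤ h * ‖u.1.snd‖ := by
  have h1 : ‖u.1.fst‖ ^ 2 = ∫ x in Ω, ‖valFn u x‖ ^ 2 := norm_sq_eq_integral _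
  have h2 : ‖u.1.snd‖ ^ 2 = ∫ x in Ω, ‖gradFn u x‖ ^ 2 := norm_sq_eq_integral _
  have i1 : Integrable (fun x => ‖valFn u x‖ ^ 2) (volume.restrict Ω) := integrable_norm_sq _
  have i2 : Integrable (fun x => ‖gradFn u x‖ ^ 2) (volume.restrict Ω) := integrable_norm_sq _
  refine (sq_le_sq₀ (norm_nonneg _) (mul_nonneg hK.h_pos.le (norm_nonneg _))).1 ?_
  rw [mul_pow, h1, h2, hK.integral_eq_sum i1, hK.integral_eq_sum i2, Finset.mul_sum]
  refine Finset.sum_le_sum fun i _ => setIntegral_sq_le_of_integral_eq_zero (hK.measurableSet i)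
    (hK.subset i) (hK.convex i) (hK.volume_ne_zero i) hK.h_pos (hK.dist_le i) u ?_
  rw [← hu i, hK.inner_cellInd]
  rfl

end IsConvexPartition

/-! ### The cells of a nested partition -/

section Nested

variable {d : ℕ} {Ω : Set (E d)} {q : ℕ} {m : List ℕ → ℕ} {τ : List ℕ → Set (E d)} {δ : ℝ}
  {H : ℕ → ℝ} {k : ℕ}

/-- Convex sets have null frontier, so cells may be replaced by their interiors without changing any
integral. The interiors are open and, unlike the cells, disjoint outright. -/
theorem interior_ae_eq {K : Set (E d)} (hK : Convex ℝ K) : interior K =ᵐ[volume] K := by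
  refine (interior_ae_eq_of_null_frontier (hK.addHaar_frontier volume))

/-- Two interiors meet in an open null set, which is empty. The inscribed open balls lie in the
interiors. -/
theorem IsNestedPartition.isConvexPartition (hτ : IsNestedPartition Ω q m τ δ H)
    (hb : Bornology.IsBounded Ω) (hk : 1 ≤ k) (hkq : k ≤ q) :
    IsConvexPartition Ω (fun i : nodes m k => interior (τ i.1)) δ (H k) where
  δ_pos := hτ.δ_pos
  h_pos := hτ.H_pos k hk hkq
  isOpen _ := isOpen_interior
  convex i := (hτ.convex k hk hkq i.1 i.2).interior
  subset i := interior_subset.trans (hτ.subset k hk hkq i.1 i.2)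
  dist_le i x hx y hy := (Metric.dist_le_diam_of_mem (hb.subset (hτ.subset k hk hkq i.1 i.2))
    (interior_subset hx) (interior_subset hy)).trans (hτ.diam_le k hk hkq i.1 i.2)
  ball_subset i := by
    obtain ⟨c, hc⟩ := hτ.ball_subset k hk hkq i.1 i.2
    exact ⟨c, interior_maximal hc Metric.isOpen_ball⟩
  disjoint i j hij := by
    have h1 : volume (interior (τ i.1) ∩ interior (τ j.1)) = 0 :=
      measure_mono_null (Set.inter_subset_inter interior_subset interior_subset)
        (hτ.disjoint k hk hkq i.1 i.2 j.1 j.2 fun h => hij (Subtype.ext h))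
    exact Set.disjoint_iff_inter_eq_empty.2
      ((isOpen_interior.inter isOpen_interior).measure_eq_zero_iff volume |>.1 h1)
  cover := by
    refine Filter.EventuallyEq.trans ?_ (hτ.cover k hk hkq)
    have h1 : (⋃ i ∈ nodes m k, τ i) = ⋃ i : nodes m k, τ i.1 := by ext; simp
    rw [h1]
    exact Filter.EventuallyEq.countable_iUnion fun i => interior_ae_eq (hτ.convex k hk hkq i.1 i.2)

/-- The number of children of a node is bounded by a power of the ratio of scales. -/
theorem IsNestedPartition.children_le (hτ : IsNestedPartition Ω q m τ δ H)
    (hb : Bornology.IsBounded Ω) (hk : 1 ≤ k) (hkq : k + 1 ≤ q) {s : List ℕ}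
    (hs : s ∈ nodes m k) : (m s : ℝ) ≤ (H k / (δ * H (k + 1))) ^ d := by
  have hP := hτ.isConvexPartition hb hk (by omega)
  have hP' := hτ.isConvexPartition hb (by omega : 1 ≤ k + 1) hkq
  have hκ := unitBall_pos d
  have hh := hP.h_pos
  have hh' := hP'.h_pos
  have hδ := hτ.δ_pos
  have h1 := hP.volume_real_le ⟨s, hs⟩
  have h2 : (⋃ t ∈ Finset.range (m s), interior (τ (t :: s))) ≤ᵐ[volume] interior (τ s) := by
    refine Filter.EventuallyLE.trans_eq ?_ (interior_ae_eq (hτ.convex k hk (by omega) s hs)).symm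
    refine Filter.EventuallyLE.trans_eq ?_ (hτ.nested k hk hkq s hs).symm
    exact (Set.iUnion₂_mono fun t _ => interior_subset).eventuallyLE
  have h3 : ∑ t ∈ Finset.range (m s), volume.real (interior (τ (t :: s)))
      ≤ volume.real (interior (τ s)) := by
    rw [← measureReal_biUnion_finset (h := fun t ht =>
      hP'.volume_ne_top ⟨t :: s, cons_mem_nodes hs (by simpa using ht)⟩)]
    · exact ENNReal.toReal_mono (hP.volume_ne_top ⟨s, hs⟩) (measure_mono_ae h2)
    · intro t ht t' ht' hne
      exact hP'.disjoint ⟨t :: s, cons_mem_nodes hs (by simpa using ht)⟩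
        ⟨t' :: s, cons_mem_nodes hs (by simpa using ht')⟩ (by simpa using hne)
    · exact fun t _ => isOpen_interior.measurableSet
  have h4 : ∀ t ∈ Finset.range (m s), volume.real (Metric.ball (0 : E d) 1) *
      (δ * H (k + 1) / 2) ^ d ≤ volume.real (interior (τ (t :: s))) := by
    intro t ht
    have ht' : t :: s ∈ nodes m (k + 1) := cons_mem_nodes hs (by simpa using ht)
    obtain ⟨c, hc⟩ := hP'.ball_subset ⟨t :: s, ht'⟩
    rw [← volume_real_ball c (by positivity)]
    exact measureReal_mono hc (hP'.volume_ne_top ⟨t :: s, ht'⟩)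
  -- Each child has at least the volume of a ball of diameter δ H (k + 1), and together they have at
  -- most the volume of the parent, bounded isodiametrically.
  have h5 := (Finset.sum_le_sum h4).trans (h3.trans h1)
  rw [Finset.sum_const, Finset.card_range, nsmul_eq_mul] at h5
  rw [div_pow, le_div_iff₀ (by positivity)]
  have h6 : volume.real (Metric.ball (0 : E d) 1) * ((m s : ℝ) * (δ * H (k + 1) / 2) ^ d)
      ≤ volume.real (Metric.ball (0 : E d) 1) * (H k / 2) ^ d := by linarith
  have h7 := le_of_mul_le_mul_left h6 hκ
  rw [div_pow, div_pow, ← mul_div_assoc] at h7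
  exact (div_le_div_iff_of_pos_right (by positivity)).1 h7

/-- The integral over a cell is the sum of the integrals over its children. -/
theorem IsNestedPartition.cellInt_eq_sum (hτ : IsNestedPartition Ω q m τ δ H)
    (hb : Bornology.IsBounded Ω) (hk : 1 ≤ k) (hkq : k + 1 ≤ q) (s : nodes m k) (u : H10 Ω) :
    (hτ.isConvexPartition hb hk (by omega)).cellInt s u
      = ∑ t ∈ Finset.range (m s.1), ∫ x in interior (τ (t :: s.1)), valFn u x := by
  have hP := hτ.isConvexPartition hb hk (by omega)
  have hP' := hτ.isConvexPartition hb (by omega : 1 ≤ k + 1) hkq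
  rw [IsConvexPartition.cellInt_eq_integral]
  have h2 : interior (τ s.1) =ᵐ[volume] ⋃ t ∈ Finset.range (m s.1), interior (τ (t :: s.1)) := by
    refine (interior_ae_eq (hτ.convex k hk (by omega) s.1 s.2)).trans
      ((hτ.nested k hk hkq s.1 s.2).trans ?_)
    refine Filter.EventuallyEq.countable_bUnion (Finset.countable_toSet _) fun t ht => ?_
    exact (interior_ae_eq (hτ.convex (k + 1) (by omega) hkq _
      (cons_mem_nodes s.2 (by simpa using ht)))).symm
  rw [setIntegral_congr_set h2, integral_biUnion_finset]
  · exact fun t _ => isOpen_interior.measurableSet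
  · intro t ht t' ht' hne
    exact hP'.disjoint ⟨t :: s.1, cons_mem_nodes s.2 (by simpa using ht)⟩
      ⟨t' :: s.1, cons_mem_nodes s.2 (by simpa using ht')⟩ (by simpa using hne)
  · intro t ht
    have ht' : t :: s.1 ∈ nodes m (k + 1) := cons_mem_nodes s.2 (by simpa using ht)
    have hfin := hP'.volume_ne_top ⟨t :: s.1, ht'⟩
    have : IsFiniteMeasure (volume.restrict (interior (τ (t :: s.1)))) :=
      ⟨by simpa using hfin.lt_top⟩
    have hm : MemLp (valFn u) 2 (volume.restrict (interior (τ (t :: s.1)))) :=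
      (Lp.memLp u.1.fst).mono_measure (Measure.restrict_mono_set _ (hP'.subset ⟨t :: s.1, ht'⟩))
    exact hm.integrable (by norm_num)

/-- Identifies the constraints defining the gamblets with the continuous functionals on the open
cells. -/
theorem IsNestedPartition.integral_indicator_mul (hτ : IsNestedPartition Ω q m τ δ H)
    (hb : Bornology.IsBounded Ω) (hk : 1 ≤ k) (hkq : k ≤ q) (j : nodes m k) (u : H10 Ω) :
    ∫ x in Ω, (τ j.1).indicator (fun _ => (1 : ℝ)) x * valFn u x
      = (hτ.isConvexPartition hb hk hkq).cellInt j u := by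
  have hP := hτ.isConvexPartition hb hk hkq
  rw [IsConvexPartition.cellInt_eq_integral,
    ← Measure.restrict_restrict_of_subset (hP.subset j),
    ← integral_indicator (hP.measurableSet j)]
  refine integral_congr_ae ?_
  have := ae_restrict_of_ae (s := Ω) (interior_ae_eq (hτ.convex k hk hkq j.1 j.2)).mem_iff
  filter_upwards [this] with x hx
  by_cases h : x ∈ τ j.1
  · simp [h, hx.2 h]
  · simp [h, hx]

end Nested


instance {d : ℕ} (Ω : Set (E d)) : CompleteSpace (H10 Ω) :=
  IsClosed.completeSpace_coe (hs := Submodule.isClosed_topologicalClosure _)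

/-! ### Dual families and their estimates -/

section Dual

variable {d : ℕ} {Ω : Set (E d)} {ι : Type*} [Fintype ι] [DecidableEq ι] {K : ι → Set (E d)}
  {δ h : ℝ} {a : E d → Matrix (Fin d) (Fin d) ℝ} {lmin lmax : ℝ}

/-- The bound for the volumes of the cells. -/
noncomputable def cellVol (d : ℕ) (h : ℝ) : ℝ :=
  volume.real (Metric.ball (0 : E d) 1) * (h / 2) ^ d

/-- The bound for the normalized energies of the bump functions. -/
noncomputable def bumpEnergy (d : ℕ) (δ h lmax : ℝ) : ℝ :=
  lmax * 2 ^ (3 + d) / (volume.real (Metric.ball (0 : E d) 1) * (δ * h / 2) ^ (d + 2))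

theorem cellVol_pos (d : ℕ) {h : ℝ} (hh : 0 < h) : 0 < cellVol d h :=
  mul_pos (unitBall_pos d) (by positivity)

theorem bumpEnergy_pos (d : ℕ) {δ h lmax : ℝ} (hδ : 0 < δ) (hh : 0 < h) (hl : 0 < lmax) :
    0 < bumpEnergy d δ h lmax := by
  have := unitBall_pos d
  unfold bumpEnergy
  positivity

/-- The unit ball volumes cancel, and (h/2)^d against (δh/2)^(d+2) leaves 4/(δ^(d+2) h²), which
turns 2^(3+d) into 2^(5+d). -/
theorem cellVol_mul_bumpEnergy (d : ℕ) {δ h lmax : ℝ} (hδ : 0 < δ) (hh : 0 < h) :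
    cellVol d h * bumpEnergy d δ h lmax = lmax * 2 ^ (5 + d) / (δ ^ (2 + d) * h ^ 2) := by
  have := unitBall_pos d
  unfold cellVol bumpEnergy
  rw [div_pow, div_pow, mul_pow]
  field_simp
  ring

/-- A family of elements of `H¹₀(Ω)` that is dual to the integrals over the cells, consists of
solutions with piecewise constant divergence, and satisfies the inverse inequalities. -/
structure IsDualFamily (hK : IsConvexPartition Ω K δ h) (a : E d → Matrix (Fin d) (Fin d) ℝ)
    (G : ι → H10 Ω) (Γ : ℝ) : Prop where
  dual : ∀ i j, hK.cellInt j (G i) = if i = j then 1 else 0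
  exists_coeff : ∃ C : Matrix ι ι ℝ, ∀ i w, energy a (G i) w = ∑ j, C i j * hK.cellInt j w
  cellInt_eq_zero : ∀ w, (∀ i, energy a (G i) w = 0) → ∀ i, hK.cellInt i w = 0
  sum_sq_le : ∀ v (c : ι → ℝ), (∀ w, energy a v w = ∑ j, c j * hK.cellInt j w) →
    ∑ j, c j ^ 2 ≤ Γ * energy a v v
  energy_le : ∀ x : ι → ℝ,
    energy a (∑ i, x i • G i) (∑ i, x i • G i) ≤ Γ * (x ⬝ᵥ x)

theorem IsConvexPartition.exists_isDualFamily (hK : IsConvexPartition Ω K δ h) (hd : 1 ≤ d)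
    (hb : Bornology.IsBounded Ω) (hdiam : Metric.diam Ω ≤ 1)
    (ha : IsUniformlyElliptic Ω a lmin lmax) (hl : 0 ≤ lmax) :
    ∃ G : ι → H10 Ω, IsDualFamily hK a G (bumpEnergy d δ h lmax) := by
  obtain ⟨b, β, hβ, h1, h2, h3⟩ := hK.exists_bumps hd ha hl
  have hB := isCoercive_energyForm hd hb hdiam ha
  have hs : ∀ u v, energyForm ha u v = energyForm ha v u := ha.energy_symm
  obtain ⟨P, C, hP, hC, h0⟩ := IsCoercive.exists_dual hB hs hK.cellInt hβ.ne' h1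
  exact ⟨P, hP, ⟨C, hC⟩, h0,
    fun v c hv => IsCoercive.sum_sq_le hB hs hβ.ne' h1 h2 h3 hv,
    fun x => IsCoercive.quadForm_le hB hs hβ.ne' h1 h2 h3 hP hC x⟩

theorem IsDualFamily.cellInt_sum {hK : IsConvexPartition Ω K δ h} {G : ι → H10 Ω} {Γ : ℝ}
    (hG : IsDualFamily hK a G Γ) (x : ι → ℝ) (j : ι) :
    hK.cellInt j (∑ i, x i • G i) = x j :=
  apply_sum_smul hG.dual x j

/-- The inverse inequality. -/
theorem IsDualFamily.exists_isWeakDiv {hK : IsConvexPartition Ω K δ h} {G : ι → H10 Ω} {Γ : ℝ}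
    (hG : IsDualFamily hK a G Γ) (ha : IsUniformlyElliptic Ω a lmin lmax) {v : H10 Ω}
    (hv : v ∈ Submodule.span ℝ (Set.range G)) :
    ∃ f : L2 Ω, IsWeakDiv a v f ∧ ‖f‖ ^ 2 ≤ cellVol d h * Γ * energy a v v := by
  obtain ⟨x, rfl⟩ := (Submodule.mem_span_range_iff_exists_fun ℝ).1 hv
  obtain ⟨C, hC⟩ := hG.exists_coeff
  set c := C.transpose.mulVec x
  have hc : ∀ w, energy a (∑ i, x i • G i) w = ∑ j, c j * hK.cellInt j w := fun w =>
    sum_smul_apply_eq (B := energyForm ha) hC x w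
  -- The energy product with v is a combination of cell integrals, so its divergence is piecewise
  -- constant with values -c_j.
  refine ⟨-∑ j, c j • hK.cellInd j, isWeakDiv_of_energy_eq fun w => ?_, ?_⟩
  · rw [ha.energy_symm, hc, inner_neg_left, neg_neg, sum_inner]
    exact Finset.sum_congr rfl fun j _ => by rw [real_inner_smul_left, hK.cellInt_apply]
  · rw [norm_neg, mul_assoc]
    refine (hK.norm_sum_cellInd_sq_le c).trans ?_
    exact mul_le_mul_of_nonneg_left (hG.sum_sq_le _ c hc) (cellVol_pos d hK.h_pos).le

/-- Testing the equation with v itself gives ‖v‖_a² = -∫ f v ≤ ‖f‖ D ‖∇v‖, and √lmin ‖∇v‖ ≤ ‖v‖_a by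
ellipticity. -/
theorem IsWeakDiv.energyNorm_le (ha : IsUniformlyElliptic Ω a lmin lmax) {v : H10 Ω} {f : L2 Ω}
    (hf : IsWeakDiv a v f) {D : ℝ} (hD : 0 ≤ D) (h : ‖v.1.fst‖ ≤ D * ‖v.1.snd‖) :
    energyNorm a v ≤ 1 / Real.sqrt lmin * D * ‖f‖ := by
  have hl := Real.sqrt_pos.2 ha.pos
  have hE := ha.energy_self_nonneg v
  have hn : 0 ≤ energyNorm a v := Real.sqrt_nonneg _
  have h1 : energyNorm a v ^ 2 = energy a v v := Real.sq_sqrt hE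
  have h2 : energyNorm a v ^ 2 ≤ ‖f‖ * (D * ‖v.1.snd‖) := by
    rw [h1, hf.energy_eq ha v]
    refine (neg_le_abs _).trans ((abs_real_inner_le_norm _ _).trans ?_)
    exact mul_le_mul_of_nonneg_left h (norm_nonneg _)
  have h3 : Real.sqrt lmin * ‖v.1.snd‖ ≤ energyNorm a v := by
    refine Real.le_sqrt_of_sq_le ?_
    rw [mul_pow, Real.sq_sqrt ha.pos.le]
    exact ha.mul_norm_sq_le_energy v
  rw [div_mul_eq_mul_div, div_mul_eq_mul_div, one_mul, le_div_iff₀ hl]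
  rcases hn.eq_or_lt with h0 | h0
  · rw [← h0, zero_mul]; positivity
  · refine le_of_mul_le_mul_left ?_ h0
    have h4 := mul_le_mul_of_nonneg_left h3 (mul_nonneg hD (norm_nonneg f))
    have h5 := mul_le_mul_of_nonneg_right h2 hl.le
    nlinarith

/-- By duality the coefficients are the cell integrals of the combination, so Bessel bounds them by
its L² norm; the assumed Poincaré bound and ellipticity pass to the energy. -/
theorem IsDualFamily.dotProduct_self_le {hK : IsConvexPartition Ω K δ h} {G : ι → H10 Ω} {Γ : ℝ}
    (hG : IsDualFamily hK a G Γ) (ha : IsUniformlyElliptic Ω a lmin lmax) (x : ι → ℝ) {D : ℝ}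
    (hD : ‖(∑ i, x i • G i).1.fst‖ ≤ D * ‖(∑ i, x i • G i).1.snd‖) :
    lmin / (cellVol d h * D ^ 2) * (x ⬝ᵥ x) ≤ energy a (∑ i, x i • G i) (∑ i, x i • G i) := by
  set v := ∑ i, x i • G i with hv
  have hV := cellVol_pos d hK.h_pos
  have h1 : x ⬝ᵥ x ≤ cellVol d h * ‖v.1.fst‖ ^ 2 := by
    refine le_trans (le_of_eq ?_) (hK.sum_inner_sq_le v.1.fst)
    exact Finset.sum_congr rfl fun i _ => by rw [← hK.cellInt_apply, hv, hG.cellInt_sum, sq]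
  have h2 : ‖v.1.fst‖ ^ 2 ≤ D ^ 2 * ‖v.1.snd‖ ^ 2 := by
    rw [← mul_pow]; exact pow_le_pow_left₀ (norm_nonneg _) hD 2
  have h3 := ha.mul_norm_sq_le_energy v
  -- For D = 0 the quotient is 0 by convention and only nonnegativity of the energy remains.
  rcases eq_or_ne D 0 with rfl | hD0
  · simpa using ha.energy_self_nonneg v
  have hD2 : 0 < D ^ 2 := by positivity
  rw [div_mul_eq_mul_div, div_le_iff₀ (by positivity)]
  calc lmin * (x ⬝ᵥ x) ≤ lmin * (cellVol d h * (D ^ 2 * ‖v.1.snd‖ ^ 2)) :=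
        mul_le_mul_of_nonneg_left (h1.trans (mul_le_mul_of_nonneg_left h2 hV.le)) ha.pos.le
    _ = cellVol d h * D ^ 2 * (lmin * ‖v.1.snd‖ ^ 2) := by ring
    _ ≤ cellVol d h * D ^ 2 * energy a v v := mul_le_mul_of_nonneg_left h3 (by positivity)
    _ = _ := mul_comm _ _

end Dual

theorem IsUniformlyElliptic.le {d : ℕ} {Ω : Set (E d)} {a : E d → Matrix (Fin d) (Fin d) ℝ}
    {lmin lmax : ℝ} (ha : IsUniformlyElliptic Ω a lmin lmax) (hd : 1 ≤ d) (hΩ : volume Ω ≠ 0) :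
    lmin ≤ lmax := by
  have : (ae (volume.restrict Ω)).NeBot := ae_restrict_neBot.2 hΩ
  obtain ⟨x, hx⟩ := ha.bounds.exists
  have h := hx (Pi.single (⟨0, hd⟩ : Fin d) 1)
  have h1 : (Pi.single (⟨0, hd⟩ : Fin d) (1 : ℝ)) ⬝ᵥ (Pi.single ⟨0, hd⟩ 1) = 1 := by simp
  rw [h1] at h
  linarith [h.1, h.2]

theorem nodes_nonempty {m : List ℕ → ℕ} {q : ℕ} (hm : ∀ k < q, ∀ s ∈ nodes m k, 0 < m s) :
    ∀ k ≤ q, (nodes m k).Nonempty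
  | 0, _ => ⟨[], by simp [nodes]⟩
  | k + 1, hk => by
    obtain ⟨s, hs⟩ := nodes_nonempty hm k (by omega)
    exact ⟨0 :: s, cons_mem_nodes hs (hm k hk s hs)⟩

/-! ### The gamblets -/

section Gamblet

variable {d : ℕ} {Ω : Set (E d)} {a : E d → Matrix (Fin d) (Fin d) ℝ} {lmin lmax : ℝ} {q : ℕ}
  {m : List ℕ → ℕ} {τ : List ℕ → Set (E d)} {δ : ℝ} {H : ℕ → ℝ} {k : ℕ}

theorem IsNestedPartition.lmin_le_lmax (hτ : IsNestedPartition Ω q m τ δ H)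
    (hb : Bornology.IsBounded Ω) (hd : 1 ≤ d) (hq : 1 ≤ q)
    (ha : IsUniformlyElliptic Ω a lmin lmax) : lmin ≤ lmax := by
  obtain ⟨s, hs⟩ := nodes_nonempty hτ.m_pos 1 hq
  have hP := hτ.isConvexPartition hb le_rfl hq
  refine ha.le hd fun h0 => hP.volume_ne_zero ⟨s, hs⟩ ?_
  exact measure_mono_null (hP.subset ⟨s, hs⟩) h0

theorem IsNestedPartition.feasible_iff (hτ : IsNestedPartition Ω q m τ δ H)
    (hb : Bornology.IsBounded Ω) (hk : 1 ≤ k) (hkq : k ≤ q) (i : nodes m k) (ψ : H10 Ω) :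
    Feasible Ω τ m k i ψ ↔
      ∀ j, (hτ.isConvexPartition hb hk hkq).cellInt j ψ = if i = j then 1 else 0 := by
  simp only [Feasible, hτ.integral_indicator_mul hb hk hkq]

/-- The difference of a feasible ψ and G i is annihilated by all cell functionals, hence
energy-orthogonal to G i. By Pythagoras the energy of ψ exceeds that of G i by the energy of the
difference. -/
theorem IsDualFamily.isGamblet_iff (hτ : IsNestedPartition Ω q m τ δ H)
    (hd : 1 ≤ d) (hb : Bornology.IsBounded Ω) (hdiam : Metric.diam Ω ≤ 1)
    (ha : IsUniformlyElliptic Ω a lmin lmax) (hk : 1 ≤ k) (hkq : k ≤ q)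
    {G : nodes m k → H10 Ω} {Γ : ℝ} (hG : IsDualFamily (hτ.isConvexPartition hb hk hkq) a G Γ)
    (i : nodes m k) (ψ : H10 Ω) : IsGamblet Ω a τ m k i ψ ↔ ψ = G i := by
  obtain ⟨C, hC⟩ := hG.exists_coeff
  have hB := isCoercive_energyForm hd hb hdiam ha
  have hGi : Feasible Ω τ m k i (G i) := (hτ.feasible_iff hb hk hkq i _).2 (hG.dual i)
  have key : ∀ ψ', Feasible Ω τ m k i ψ' →
      energy a ψ' ψ' = energy a (G i) (G i) + energy a (ψ' - G i) (ψ' - G i) := fun ψ' h =>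
    apply_self_eq_add (B := energyForm ha) ha.energy_symm (hC i) fun j => by
      rw [(hτ.feasible_iff hb hk hkq i _).1 h, hG.dual]
  constructor
  · rintro ⟨h1, h2⟩
    have h3 := (Real.sqrt_le_sqrt_iff (ha.energy_self_nonneg _)).1 (h2 _ hGi)
    rw [key ψ h1] at h3
    exact sub_eq_zero.1 (IsCoercive.eq_zero hB (u := ψ - G i) (by
      rw [energyForm_apply]; linarith))
  · rintro rfl
    refine ⟨hGi, fun ψ' h => Real.sqrt_le_sqrt ?_⟩
    rw [key ψ' h]
    linarith [ha.energy_self_nonneg (ψ' - G i)]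

theorem IsNestedPartition.existsUnique_isGamblet (hτ : IsNestedPartition Ω q m τ δ H)
    (hd : 1 ≤ d) (hb : Bornology.IsBounded Ω) (hdiam : Metric.diam Ω ≤ 1)
    (ha : IsUniformlyElliptic Ω a lmin lmax) (hk : 1 ≤ k) (hkq : k ≤ q) (i : nodes m k) :
    ∃! ψ : H10 Ω, IsGamblet Ω a τ m k i ψ := by
  have hl := ha.pos.le.trans (hτ.lmin_le_lmax hb hd (hk.trans hkq) ha)
  obtain ⟨G, hG⟩ := (hτ.isConvexPartition hb hk hkq).exists_isDualFamily hd hb hdiam ha hl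
  have := IsDualFamily.isGamblet_iff hτ hd hb hdiam ha hk hkq hG i
  exact ⟨G i, (this _).2 rfl, fun ψ hψ => (this ψ).1 hψ⟩

/-- The gamblets are an arbitrary choice of minimizers; uniqueness identifies the choice with the
dual family and transfers its estimates. -/
theorem IsNestedPartition.isDualFamily_gamblet (hτ : IsNestedPartition Ω q m τ δ H)
    (hd : 1 ≤ d) (hb : Bornology.IsBounded Ω) (hdiam : Metric.diam Ω ≤ 1)
    (ha : IsUniformlyElliptic Ω a lmin lmax) (hk : 1 ≤ k) (hkq : k ≤ q) :
    IsDualFamily (hτ.isConvexPartition hb hk hkq) a (gamblet Ω a τ m k)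
      (bumpEnergy d δ (H k) lmax) := by
  have hl := ha.pos.le.trans (hτ.lmin_le_lmax hb hd (hk.trans hkq) ha)
  obtain ⟨G, hG⟩ := (hτ.isConvexPartition hb hk hkq).exists_isDualFamily hd hb hdiam ha hl
  have : gamblet Ω a τ m k = G := by
    funext i
    have h := IsDualFamily.isGamblet_iff hτ hd hb hdiam ha hk hkq hG i
    exact (h _).1 (Classical.epsilon_spec (p := IsGamblet Ω a τ m k i) ⟨G i, (h _).2 rfl⟩)
  rwa [this]

theorem stiffA_quadForm (ha : IsUniformlyElliptic Ω a lmin lmax) (x : nodes m k → ℝ) :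
    x ⬝ᵥ (stiffA Ω a τ m k).mulVec x =
      energy a (∑ i, x i • gamblet Ω a τ m k i) (∑ i, x i • gamblet Ω a τ m k i) :=
  quadForm_gram (B := energyForm ha) x

theorem stiffA_isSymm (ha : IsUniformlyElliptic Ω a lmin lmax) : (stiffA Ω a τ m k).IsSymm :=
  Matrix.IsSymm.ext fun _ _ => ha.energy_symm _ _

theorem stiffB_eq (ha : IsUniformlyElliptic Ω a lmin lmax)
    (W : Matrix (subNodes m k) (nodes m k) ℝ) :
    stiffB Ω a τ m k W = W * stiffA Ω a τ m k * W.transpose := by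
  ext i j
  have h : stiffB Ω a τ m k W i j = energyForm ha (∑ p, W i p • gamblet Ω a τ m k p)
    (∑ r, W j r • gamblet Ω a τ m k r) := rfl
  rw [h, map_sum]
  simp only [Matrix.mul_apply, Matrix.transpose_apply, stiffA, Matrix.of_apply]
  refine Finset.sum_congr rfl fun r _ => ?_
  rw [map_smul, sum_smul_apply, smul_eq_mul, mul_comm]
  rfl

theorem stiffB_quadForm (ha : IsUniformlyElliptic Ω a lmin lmax)
    (W : Matrix (subNodes m k) (nodes m k) ℝ) (y : subNodes m k → ℝ) :
    y ⬝ᵥ (stiffB Ω a τ m k W).mulVec y =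
      W.transpose.mulVec y ⬝ᵥ (stiffA Ω a τ m k).mulVec (W.transpose.mulVec y) := by
  rw [stiffB_eq ha, ← Matrix.mulVec_mulVec, ← Matrix.mulVec_mulVec, Matrix.dotProduct_mulVec,
    Matrix.mulVec_transpose]

theorem posDef_of_le {n : Type*} [Fintype n] {M : Matrix n n ℝ} (hM : M.IsSymm) {c : ℝ}
    (hc : 0 < c) (h : ∀ x : n → ℝ, c * (x ⬝ᵥ x) ≤ x ⬝ᵥ M.mulVec x) : M.PosDef := by
  refine Matrix.PosDef.of_dotProduct_mulVec_pos hM fun x hx => ?_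
  refine lt_of_lt_of_le (mul_pos hc ?_) (h x)
  exact (dotProduct_self_nonneg' x).lt_of_ne' (by simpa using hx)

end Gamblet


/-! ### Comparison of the constants -/

theorem inverse_const_sq (d : ℕ) {δ lmax : ℝ} (hδ : 0 < δ) (hl : 0 < lmax) :
    (δ ^ (1 + (d : ℝ) / 2) / (Real.sqrt lmax * 2 ^ ((5 : ℝ) / 2 + (d : ℝ) / 2))) ^ 2
      = δ ^ (2 + d) / (lmax * 2 ^ (5 + d)) := by
  have h1 : (δ ^ (1 + (d : ℝ) / 2)) ^ 2 = δ ^ (2 + d) := by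
    rw [← Real.rpow_natCast, ← Real.rpow_mul hδ.le, ← Real.rpow_natCast δ]
    congr 1; push_cast; ring
  have h2 : ((2 : ℝ) ^ ((5 : ℝ) / 2 + (d : ℝ) / 2)) ^ 2 = 2 ^ (5 + d) := by
    rw [← Real.rpow_natCast, ← Real.rpow_mul two_pos.le, ← Real.rpow_natCast 2]
    congr 1; push_cast; ring
  rw [div_pow, mul_pow, Real.sq_sqrt hl.le, h1, h2]

/-- The argument produces the left-hand constant. The right-hand one is weaker, since δ < 1 and π² ≤
16 ≤ 2^(6+d). -/
theorem two_pow_div_le (d : ℕ) {δ : ℝ} (hδ : 0 < δ) (hδ1 : δ < 1) :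
    (2 : ℝ) ^ (5 + d) / δ ^ (2 + d) ≤ 2 ^ (11 + 2 * d) / (δ ^ (4 + 7 * d) * Real.pi ^ 2) := by
  have hπ : Real.pi ^ 2 ≤ 2 ^ (6 + d) :=
    calc Real.pi ^ 2 ≤ 4 ^ 2 := pow_le_pow_left₀ Real.pi_pos.le Real.pi_le_four 2
      _ ≤ 2 ^ 6 := by norm_num
      _ ≤ 2 ^ (6 + d) := pow_le_pow_right₀ one_le_two (by omega)
  have h1 : δ ^ (4 + 7 * d) ≤ δ ^ (2 + d) := pow_le_pow_of_le_one hδ.le hδ1.le (by omega)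
  have hπ0 := Real.pi_pos
  rw [div_le_div_iff₀ (by positivity) (by positivity)]
  calc (2 : ℝ) ^ (5 + d) * (δ ^ (4 + 7 * d) * Real.pi ^ 2)
      ≤ 2 ^ (5 + d) * (δ ^ (2 + d) * 2 ^ (6 + d)) := by gcongr
    _ = _ := by ring

/-! ### The estimates on each level of the hierarchy. -/

section Levels

variable {d : ℕ} {Ω : Set (E d)} {a : E d → Matrix (Fin d) (Fin d) ℝ} {lmin lmax : ℝ} {q : ℕ}
  {m : List ℕ → ℕ} {τ : List ℕ → Set (E d)} {δ : ℝ} {H : ℕ → ℝ} {k : ℕ}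

theorem IsNestedPartition.inverse_le (hτ : IsNestedPartition Ω q m τ δ H)
    (hd : 1 ≤ d) (hΩ : IsOpen Ω) (hb : Bornology.IsBounded Ω) (hdiam : Metric.diam Ω ≤ 1)
    (ha : IsUniformlyElliptic Ω a lmin lmax) (hk : 1 ≤ k) (hkq : k ≤ q) {v : H10 Ω}
    (hv : v ∈ spaceV Ω a τ m k) :
    (∃! f : L2 Ω, IsWeakDiv a v f) ∧ ∀ f : L2 Ω, IsWeakDiv a v f →
      δ ^ (1 + (d : ℝ) / 2) / (Real.sqrt lmax * 2 ^ ((5 : ℝ) / 2 + (d : ℝ) / 2)) * H k * ‖f‖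
        ≤ energyNorm a v := by
  have hl := ha.pos.trans_le (hτ.lmin_le_lmax hb hd (hk.trans hkq) ha)
  have hG := hτ.isDualFamily_gamblet hd hb hdiam ha hk hkq
  obtain ⟨f, hf, hfn⟩ := hG.exists_isWeakDiv ha hv
  refine ⟨⟨f, hf, fun g hg => hg.unique hΩ hf⟩, fun g hg => ?_⟩
  rw [hg.unique hΩ hf]
  have hδ := hτ.δ_pos
  have hH := hτ.H_pos k hk hkq
  refine Real.le_sqrt_of_sq_le ?_
  rw [mul_pow, mul_pow, inverse_const_sq d hδ hl]
  rw [cellVol_mul_bumpEnergy d hδ hH] at hfn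
  refine (mul_le_mul_of_nonneg_left hfn (by positivity)).trans (le_of_eq ?_)
  field_simp

/-- Orthogonality to all gamblets of level k forces the integrals over the cells of level k to
vanish, and the Poincaré inequality applies cell by cell at scale H k. -/
theorem IsNestedPartition.norm_fst_le_of_mem_spaceW (hτ : IsNestedPartition Ω q m τ δ H)
    (hd : 1 ≤ d) (hb : Bornology.IsBounded Ω) (hdiam : Metric.diam Ω ≤ 1)
    (ha : IsUniformlyElliptic Ω a lmin lmax) (hk : 1 ≤ k) (hkq : k + 1 ≤ q) {v : H10 Ω}
    (hv : v ∈ spaceW Ω a τ m k) : ‖v.1.fst‖ ≤ H k * ‖v.1.snd‖ := by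
  have hG := hτ.isDualFamily_gamblet hd hb hdiam ha hk (by omega)
  refine (hτ.isConvexPartition hb hk (by omega)).norm_fst_le fun i => ?_
  refine hG.cellInt_eq_zero v (fun j => ?_) i
  rw [ha.energy_symm]
  exact hv.2 _ (Submodule.subset_span ⟨j, rfl⟩)

/-- Valid on every level. The lower bound uses Friedrichs' inequality, that is D = 1, which explains
the factor 1 / H k ^ 2. -/
theorem IsNestedPartition.posDef_stiffA_and_condNum_le (hτ : IsNestedPartition Ω q m τ δ H)
    (hd : 1 ≤ d) (hb : Bornology.IsBounded Ω) (hdiam : Metric.diam Ω ≤ 1)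
    (ha : IsUniformlyElliptic Ω a lmin lmax) (hk : 1 ≤ k) (hkq : k ≤ q) :
    (stiffA Ω a τ m k).PosDef ∧ condNum (stiffA Ω a τ m k)
      ≤ 1 / H k ^ 2 * (lmax * 2 ^ (5 + d) / (lmin * δ ^ (2 + 2 * d))) := by
  have hl := ha.pos.trans_le (hτ.lmin_le_lmax hb hd (hk.trans hkq) ha)
  have hG := hτ.isDualFamily_gamblet hd hb hdiam ha hk hkq
  have hδ := hτ.δ_pos
  have hH := hτ.H_pos k hk hkq
  have hV := cellVol_pos d hH
  have hΓ := bumpEnergy_pos d hδ hH hl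
  have hc : 0 < lmin / (cellVol d (H k) * 1 ^ 2) := div_pos ha.pos (by positivity)
  have h1 : ∀ x, lmin / (cellVol d (H k) * 1 ^ 2) * (x ⬝ᵥ x)
      ≤ x ⬝ᵥ (stiffA Ω a τ m k).mulVec x := fun x => by
    rw [stiffA_quadForm ha]
    exact hG.dotProduct_self_le ha x (by
      rw [one_mul]; exact norm_fst_le_norm_snd hd hb hdiam _)
  have h2 : ∀ x, x ⬝ᵥ (stiffA Ω a τ m k).mulVec x ≤ bumpEnergy d δ (H k) lmax * (x ⬝ᵥ x) :=
    fun x => by rw [stiffA_quadForm ha]; exact hG.energy_le x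
  have hS : (stiffA Ω a τ m k).IsSymm := stiffA_isSymm ha
  refine ⟨posDef_of_le hS hc h1, (condNum_le hS hc hΓ.le h1 h2).trans ?_⟩
  have e : bumpEnergy d δ (H k) lmax / (lmin / (cellVol d (H k) * 1 ^ 2))
      = 1 / H k ^ 2 * (lmax * 2 ^ (5 + d) / (lmin * δ ^ (2 + d))) := by
    have h3 := cellVol_mul_bumpEnergy d (lmax := lmax) hδ hH
    rw [div_div_eq_mul_div, one_pow, mul_one, mul_comm, h3]
    have := ha.pos
    field_simp
  have h4 : δ ^ (2 + 2 * d) ≤ δ ^ (2 + d) :=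
    pow_le_pow_of_le_one hδ.le hτ.δ_lt_one.le (by omega)
  have := ha.pos
  rw [e]
  gcongr

theorem IsAdmissible.piMat_mulVec_eq_zero
    {W : Matrix (subNodes m (k + 1)) (nodes m (k + 1)) ℝ} (hW : IsAdmissible m k W)
    (y : subNodes m (k + 1) → ℝ) : (piMat m k).mulVec (W.transpose.mulVec y) = 0 := by
  have : W.transpose.mulVecLin y ∈ LinearMap.ker (piMat m k).mulVecLin := by
    rw [← hW]; exact ⟨y, rfl⟩
  exact LinearMap.mem_ker.1 this

/-- The coefficients are the integrals over the fine cells, so πx = 0 says that the integrals over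
the coarse cells vanish. This gives the coarse Poincaré bound from the coefficients directly. -/
theorem IsNestedPartition.norm_fst_le_of_piMat_mulVec_eq_zero
    (hτ : IsNestedPartition Ω q m τ δ H)
    (hb : Bornology.IsBounded Ω) (hk : 1 ≤ k) (hkq : k + 1 ≤ q) {G : nodes m (k + 1) → H10 Ω}
    {Γ : ℝ} (hG : IsDualFamily (hτ.isConvexPartition hb (by omega : 1 ≤ k + 1) hkq) a G Γ)
    {x : nodes m (k + 1) → ℝ} (hx : (piMat m k).mulVec x = 0) :
    ‖(∑ i, x i • G i).1.fst‖ ≤ H k * ‖(∑ i, x i • G i).1.snd‖ := by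
  refine (hτ.isConvexPartition hb hk (by omega)).norm_fst_le fun s => ?_
  rw [← IsConvexPartition.cellInt_apply, hτ.cellInt_eq_sum hb hk hkq]
  have h1 := congrFun hx s
  rw [piMat_mulVec] at h1
  rw [← show _ = (0 : ℝ) from h1]
  refine Finset.sum_congr rfl fun t ht => ?_
  have ht' := cons_mem_nodes s.2 (Finset.mem_range.1 ht)
  have h2 := hG.cellInt_sum x ⟨t :: s.1, ht'⟩
  rw [IsConvexPartition.cellInt_eq_integral] at h2
  rw [h2]
  exact (ext0_coe x ⟨t :: s.1, ht'⟩).symm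

theorem IsNestedPartition.posDef_stiffB_and_condNum_le (hτ : IsNestedPartition Ω q m τ δ H)
    (hd : 1 ≤ d) (hb : Bornology.IsBounded Ω) (hdiam : Metric.diam Ω ≤ 1)
    (ha : IsUniformlyElliptic Ω a lmin lmax) (hk : 1 ≤ k) (hkq : k + 1 ≤ q)
    {W : Matrix (subNodes m (k + 1)) (nodes m (k + 1)) ℝ} (hW : IsAdmissible m k W) :
    (stiffB Ω a τ m (k + 1) W).PosDef ∧ condNum (stiffB Ω a τ m (k + 1) W) ≤
      (H k / H (k + 1)) ^ 2 * (lmax / lmin) ^ 2 *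
        (2 ^ (11 + 2 * d) / (δ ^ (4 + 7 * d) * Real.pi ^ 2)) * condNum (W * W.transpose) := by
  have hll := hτ.lmin_le_lmax hb hd (by omega) ha
  have hl0 := ha.pos
  have hl := ha.pos.trans_le hll
  have hk1 : 1 ≤ k + 1 := by omega
  have hG := hτ.isDualFamily_gamblet hd hb hdiam ha hk1 hkq
  have hδ := hτ.δ_pos
  have hH := hτ.H_pos k hk (by omega)
  have hH' := hτ.H_pos (k + 1) hk1 hkq
  have hV := cellVol_pos d hH'
  have hΓ := bumpEnergy_pos d hδ hH' hl
  have hS : (stiffB Ω a τ m (k + 1) W).IsSymm := Matrix.IsSymm.ext fun _ _ => ha.energy_symm _ _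
  rcases isEmpty_or_nonempty (subNodes m (k + 1)) with hJ | hJ
  · refine ⟨posDef_of_le hS one_pos fun x => by simp [dotProduct], le_of_eq ?_⟩
    simp only [condNum, Real.iSup_of_isEmpty, Real.sqrt_zero, zero_div, mul_zero]
  have hinj := hW.injective (hτ.m_pos k (by omega))
  obtain ⟨l, L, hl1, hL, hlow, hup, hcond⟩ :=
    exists_condNum_eq (isSymm_mul_transpose_self' W) fun y hy => by
      rw [dotProduct_mul_transpose_mulVec]
      refine (dotProduct_self_nonneg' _).lt_of_ne' fun h0 => hy (hinj ?_)
      rw [dotProduct_self_eq_zero.1 h0, Matrix.mulVec_zero]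
  -- The volume is that of the fine cells, where the coefficients live, and the Poincaré scale is
  -- the coarse H k. Their mismatch produces the ratio H k / H (k + 1).
  set c := lmin / (cellVol d (H (k + 1)) * H k ^ 2) with hc_def
  have hc : 0 < c := div_pos ha.pos (by positivity)
  have h1 : ∀ y, c * l * (y ⬝ᵥ y) ≤ y ⬝ᵥ (stiffB Ω a τ m (k + 1) W).mulVec y := fun y => by
    rw [stiffB_quadForm ha, stiffA_quadForm ha, mul_assoc]
    refine (mul_le_mul_of_nonneg_left (hlow y) hc.le).trans ?_
    rw [dotProduct_mul_transpose_mulVec]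
    exact hG.dotProduct_self_le ha _ (hτ.norm_fst_le_of_piMat_mulVec_eq_zero hb hk hkq hG
      (hW.piMat_mulVec_eq_zero y))
  have h2 : ∀ y, y ⬝ᵥ (stiffB Ω a τ m (k + 1) W).mulVec y
      ≤ bumpEnergy d δ (H (k + 1)) lmax * L * (y ⬝ᵥ y) := fun y => by
    rw [stiffB_quadForm ha, stiffA_quadForm ha, mul_assoc]
    refine (hG.energy_le _).trans (mul_le_mul_of_nonneg_left ?_ hΓ.le)
    rw [← dotProduct_mul_transpose_mulVec]
    exact hup y
  have hcl := mul_pos hc hl1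
  refine ⟨posDef_of_le hS hcl h1, (condNum_le hS hcl (by positivity) h1 h2).trans ?_⟩
  have e : bumpEnergy d δ (H (k + 1)) lmax * L / (c * l)
      = (H k / H (k + 1)) ^ 2 * (lmax / lmin) * (2 ^ (5 + d) / δ ^ (2 + d)) * (L / l) := by
    have h3 := cellVol_mul_bumpEnergy d (lmax := lmax) hδ hH'
    have h4 : bumpEnergy d δ (H (k + 1)) lmax
        = lmax * 2 ^ (5 + d) / (δ ^ (2 + d) * H (k + 1) ^ 2) / cellVol d (H (k + 1)) := by
      rw [← h3, mul_div_cancel_left₀ _ hV.ne']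
    rw [h4, hc_def]
    field_simp
  -- The argument yields the first power of the contrast; as the contrast is at least 1, the stated
  -- square is weaker.
  have h5 : lmax / lmin ≤ (lmax / lmin) ^ 2 :=
    le_self_pow₀ ((one_le_div hl0).2 hll) two_ne_zero
  have h6 := two_pow_div_le d hδ hτ.δ_lt_one
  rw [e, hcond]
  gcongr

/-- An inequality rather than an equality, because for empty 𝒥 the condition number is 0 by
convention. -/
theorem condNum_orthW_le (k : ℕ) : condNum (orthW m k * (orthW m k).transpose) ≤ 1 := by
  rw [orthW_mul_transpose]
  rcases isEmpty_or_nonempty (subNodes m (k + 1)) with hJ | hJ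
  · simp only [condNum, Real.iSup_of_isEmpty, Real.sqrt_zero, zero_div, zero_le_one]
  · exact condNum_one.le

theorem IsNestedPartition.condNum_diffW_le (hτ : IsNestedPartition Ω q m τ δ H)
    (hb : Bornology.IsBounded Ω) (hk : 1 ≤ k) (hkq : k + 1 ≤ q) :
    condNum (diffW m k * (diffW m k).transpose) ≤ 2 * (H k / (δ * H (k + 1))) ^ (2 * d) := by
  have hδ := hτ.δ_pos
  have hH := hτ.H_pos k hk (by omega)
  have hH' := hτ.H_pos (k + 1) (by omega) hkq
  rw [mul_comm 2 d, pow_mul]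
  exact Gamblets.condNum_diffW_le (by positivity) fun s hs => hτ.children_le hb hk hkq hs

end Levels

end Gamblets

/-! ### The theorem, assembled from the level estimates. -/

theorem mainTheorem1 (d : ℕ) (hd : 1 ≤ d) (Ω : Set (E d)) (hΩ_open : IsOpen Ω)
    (hΩ_bdd : Bornology.IsBounded Ω) (hΩ_diam : Metric.diam Ω ≤ 1)
    (a : E d → Matrix (Fin d) (Fin d) ℝ) (lmin lmax : ℝ)
    (ha : IsUniformlyElliptic Ω a lmin lmax)
    (q : ℕ) (hq : 1 ≤ q) (m : List ℕ → ℕ) (τ : List ℕ → Set (E d)) (δ : ℝ) (H : ℕ → ℝ)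
    (hτ : IsNestedPartition Ω q m τ δ H) :
    -- the gamblets are well defined
    (∀ k, 1 ≤ k → k ≤ q → ∀ i : nodes m k, ∃! ψ : H10 Ω, IsGamblet Ω a τ m k i ψ) ∧
    -- on the spaces V, div (a ∇v) is an element of L², and the inverse inequality holds
    (∀ k, 1 ≤ k → k ≤ q → ∀ v ∈ spaceV Ω a τ m k,
      (∃! f : L2 Ω, IsWeakDiv a v f) ∧
      ∀ f : L2 Ω, IsWeakDiv a v f →
        δ ^ (1 + (d : ℝ) / 2) / (Real.sqrt lmax * 2 ^ ((5 : ℝ) / 2 + (d : ℝ) / 2)) * H k * ‖f‖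
          ≤ energyNorm a v) ∧
    -- the Poincaré type inequality on the coarsest space
    (∀ v ∈ spaceV Ω a τ m 1, ∀ f : L2 Ω, IsWeakDiv a v f →
      energyNorm a v ≤ 1 / Real.sqrt lmin * ‖f‖) ∧
    -- the Poincaré type inequality on the subbands
    (∀ k, 1 ≤ k → k + 1 ≤ q → ∀ v ∈ spaceW Ω a τ m k, ∀ f : L2 Ω, IsWeakDiv a v f →
      energyNorm a v ≤ 1 / Real.sqrt lmin * H k * ‖f‖) ∧
    -- the condition number of the coarsest stiffness matrix
    (stiffA Ω a τ m 1).PosDef ∧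
    condNum (stiffA Ω a τ m 1) ≤ 1 / H 1 ^ 2 * (lmax * 2 ^ (5 + d) / (lmin * δ ^ (2 + 2 * d))) ∧
    -- the condition numbers of the subband stiffness matrices
    (∀ k, 1 ≤ k → k + 1 ≤ q → ∀ W : Matrix (subNodes m (k + 1)) (nodes m (k + 1)) ℝ,
      IsAdmissible m k W →
        stiffB Ω a τ m (k + 1) W = W * stiffA Ω a τ m (k + 1) * W.transpose ∧
        (stiffB Ω a τ m (k + 1) W).PosDef ∧
        condNum (stiffB Ω a τ m (k + 1) W) ≤
          (H k / H (k + 1)) ^ 2 * (lmax / lmin) ^ 2 *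
            (2 ^ (11 + 2 * d) / (δ ^ (4 + 7 * d) * Real.pi ^ 2)) * condNum (W * W.transpose)) ∧
    -- the two constructions of W
    (∀ k, 1 ≤ k → k + 1 ≤ q →
      IsAdmissible m k (orthW m k) ∧ IsAdmissible m k (diffW m k) ∧
      ((subNodes m (k + 1)).Nonempty → condNum (orthW m k * (orthW m k).transpose) = 1) ∧
      condNum (diffW m k * (diffW m k).transpose) ≤ 2 * (H k / (δ * H (k + 1))) ^ (2 * d)) ∧
    -- the resulting uniform bounds when the ratios of consecutive scales are bounded
    (∀ ρ : ℝ, ∀ k, 1 ≤ k → k + 1 ≤ q → H k / H (k + 1) ≤ ρ →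
      condNum (stiffB Ω a τ m (k + 1) (orthW m k)) ≤
        ρ ^ 2 * (lmax / lmin) ^ 2 * (2 ^ (11 + 2 * d) / (δ ^ (4 + 7 * d) * Real.pi ^ 2)) ∧
      condNum (stiffB Ω a τ m (k + 1) (diffW m k)) ≤
        ρ ^ 2 * (lmax / lmin) ^ 2 * (2 ^ (11 + 2 * d) / (δ ^ (4 + 7 * d) * Real.pi ^ 2)) *
          (2 * (ρ / δ) ^ (2 * d))) := by
  have hk1 : ∀ {k : ℕ}, 1 ≤ k + 1 := by omega
  have hm : ∀ k, k + 1 ≤ q → ∀ s ∈ nodes m k, 0 < m s := fun k hk => hτ.m_pos k (by omega)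
  obtain ⟨hA, hAc⟩ := hτ.posDef_stiffA_and_condNum_le hd hΩ_bdd hΩ_diam ha le_rfl hq
  refine ⟨fun k hk hkq i => hτ.existsUnique_isGamblet hd hΩ_bdd hΩ_diam ha hk hkq i,
    fun k hk hkq v hv => hτ.inverse_le hd hΩ_open hΩ_bdd hΩ_diam ha hk hkq hv,
    fun v _ f hf => ?_, fun k hk hkq v hv f hf => ?_, hA, hAc, fun k hk hkq W hW => ?_,
    fun k hk hkq => ?_, fun ρ k hk hkq hρ => ?_⟩
  · have := hf.energyNorm_le ha zero_le_one
      (by rw [one_mul]; exact norm_fst_le_norm_snd hd hΩ_bdd hΩ_diam v)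
    rwa [mul_one] at this
  · exact hf.energyNorm_le ha (hτ.H_pos k hk (by omega)).le
      (hτ.norm_fst_le_of_mem_spaceW hd hΩ_bdd hΩ_diam ha hk hkq hv)
  · exact ⟨stiffB_eq ha W, hτ.posDef_stiffB_and_condNum_le hd hΩ_bdd hΩ_diam ha hk hkq hW⟩
  · refine ⟨isAdmissible_orthW (hm k hkq), isAdmissible_diffW (hm k hkq), fun ⟨j, hj⟩ => ?_,
      hτ.condNum_diffW_le hΩ_bdd hk hkq⟩
    have : Nonempty (subNodes m (k + 1)) := ⟨⟨j, hj⟩⟩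
    rw [orthW_mul_transpose, condNum_one]
  · have hδ := hτ.δ_pos
    have hH := hτ.H_pos k hk (by omega)
    have hH' := hτ.H_pos (k + 1) hk1 hkq
    -- Positivity of ρ follows from that of the scale ratio it bounds.
    have hρ0 : 0 < ρ := (div_pos hH hH').trans_le hρ
    have hB := fun W hW => (hτ.posDef_stiffB_and_condNum_le hd hΩ_bdd hΩ_diam ha hk hkq
      (W := W) hW).2
    have hlow : (H k / H (k + 1)) ^ 2 * (lmax / lmin) ^ 2 *
          (2 ^ (11 + 2 * d) / (δ ^ (4 + 7 * d) * Real.pi ^ 2))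
        ≤ ρ ^ 2 * (lmax / lmin) ^ 2 *
          (2 ^ (11 + 2 * d) / (δ ^ (4 + 7 * d) * Real.pi ^ 2)) := by
      gcongr
    constructor
    · refine (hB _ (isAdmissible_orthW (hm k hkq))).trans (le_trans ?_ hlow)
      exact mul_le_of_le_one_right (by positivity) (condNum_orthW_le k)
    · refine (hB _ (isAdmissible_diffW (hm k hkq))).trans ?_
      have h1 : condNum (diffW m k * (diffW m k).transpose) ≤ 2 * (ρ / δ) ^ (2 * d) := by
        refine (hτ.condNum_diffW_le hΩ_bdd hk hkq).trans ?_
        have e : H k / (δ * H (k + 1)) = H k / H (k + 1) / δ := by rw [div_div, mul_comm]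
        rw [e]
        gcongr
      refine (mul_le_mul_of_nonneg_left h1 (by positivity)).trans ?_
      exact mul_le_mul_of_nonneg_right hlow (by positivity)
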